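/- For a complex-valued $u\in L^2(\mathbb R^3)$ let $\hat u(\xi)=\int_{\mathbb R^3}e^{-2\pi i x\cdot\xi}u(x)\,dx$ be its ($L^2$) Fourier transform, and for $s\in\mathbb R$ let $\|u\|_{H^s}^2=\int_{\mathbb R^3}(1+|\xi|^2)^s|\hat u(\xi)|^2\,d\xi$; $H^{1/2}(\mathbb R^3)$ is the space of those $u\in L^2(\mathbb R^3)$ for which $\|u\|_{H^{1/2}}<\infty$. For $p,\alpha,\beta>0$, $u\in H^{1/2}(\mathbb R^3)$ and $\rho>0$ put $$\mathcal E_p^{\alpha,\beta}(u)=\frac12\|u\|_{H^{1/2}}^2+\alpha\iint_{\mathbb R^3\times\mathbb R^3}\frac{|u(x)|^2|u(y)|^2}{|x-y|}\,dx\,dy-\beta\int_{\mathbb R^3}|u|^p\,dx,$$ $$S(\rho)=\Big\{u\in H^{1/2}(\mathbb R^3):\int_{\mathbb R^3}|u|^2\,dx=\rho\Big\},\qquad I_p^{\alpha,\beta}(\rho)=\inf_{u\in S(\rho)}\mathcal E_p^{\alpha,\beta}(u).$$ **Theorem.** Let $2<p<8/3$ and $\alpha,\beta>0$. All the integrals in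 $\mathcal E_p^{\alpha,\beta}(u)$ are finite for every $u\in H^{1/2}(\mathbb R^3)$, and $I_p^{\alpha,\beta}(\rho)>-\infty$ for every $\rho>0$. Moreover, there exists $\rho_1=\rho_1(p,\alpha,\beta)>0$ such that for every $0<\rho<\rho_1$: 1. for every sequence $u_n\in S(\rho)$ with $\mathcal E_p^{\alpha,\beta}(u_n)\to I_p^{\alpha,\beta}(\rho)$ there are a subsequence $u_{n_k}$ and translations $\tau_k\in\mathbb R^3$ such that $u_{n_k}(\cdot+\tau_k)$ converges strongly in $H^{1/2}(\mathbb R^3)$; 2. there exists a minimizer for $I_p^{\alpha,\beta}(\rho)$, i.e. $v\in S(\rho)$ with $\mathcal E_p^{\alpha,\beta}(v)=I_p^{\alpha,\beta}(\rho)$. Finally, for every $\rho>0$, every minimizer $v$ for $I_p^{\alpha,\beta}(\rho)$ satisfies $$\frac12\|v\|_{H^{1/2}}^2-\frac12\|v\|_{H^{-1/2}}^2+\alpha\iint_{\mathbb R^3\times\mathbb R^3}\frac{|v(x)|^2|v(y)|^2}{|x-y|}\,dx\,dy-\beta\,\frac{3p-6}{2}\,\int_{\mathbb R^3}|v|^p\,dx=0.$$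 -/

import Mathlib

open MeasureTheory Filter Topology FourierTransform
open scoped SchwartzMap

noncomputable section

namespace SemiRelativistic

/-- Three-dimensional Euclidean space. -/
abbrev R3 : Type := EuclideanSpace ℝ (Fin 3)

/-- The complex-valued square-integrable functions on `R3`, modulo a.e. equality. -/
abbrev L2 : Type := Lp ℂ 2 (volume : Measure R3)

/-- The norm of `H^s`: the square root of `∫ (1 + |ξ|²)^s |û(ξ)|² dξ`, where `û = 𝓕 u` is the
`L²` Fourier transform with kernel `exp (-2 π i x · ξ)`. The integral is finite
exactly when `u` belongs to `H^s`; for `s ≤ 0` this is every `u` in `L²`. -/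
def sobolevNorm (s : ℝ) (u : L2) : ℝ :=
  Real.sqrt (∫ ξ : R3, (1 + ‖ξ‖ ^ 2) ^ s * ‖(𝓕 u : L2) ξ‖ ^ 2)

/-- Membership in `H^{1/2}(R3)`, for a function in `L²`. -/
def MemHHalf (u : L2) : Prop :=
  TemperedDistribution.MemSobolev (1 / 2) 2 (u : 𝓢'(R3, ℂ))

/-- `u ∈ H^{1/2}` if and only if `∫ (1 + |ξ|²)^{1/2} |û(ξ)|² dξ` is finite. -/
theorem memHHalf_iff_integrable (u : L2) :
    MemHHalf u ↔
      Integrable (fun ξ : R3 => (1 + ‖ξ‖ ^ 2) ^ (1 / 2 : ℝ) * ‖(𝓕 u : L2) ξ‖ ^ 2) := by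
  set g : R3 → ℂ := fun x => (((1 + ‖x‖ ^ 2) ^ ((1 / 2 : ℝ) / 2) : ℝ) : ℂ) with hg
  set h : R3 → ℂ := fun x => (((1 + ‖x‖ ^ 2) ^ (-((1 / 2 : ℝ) / 2)) : ℝ) : ℂ) with hh
  have hgt : g.HasTemperateGrowth := by fun_prop
  have hht : h.HasTemperateGrowth := by fun_prop
  have hgh : g * h = fun _ => 1 := by
    ext x
    simp only [hg, hh, Pi.mul_apply]
    norm_cast
    rw [← Real.rpow_add (by positivity)]
    simp
  have hhb : MemLp h ⊤ (volume : Measure R3) := by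
    refine memLp_top_of_bound hht.1.continuous.aestronglyMeasurable 1 (Eventually.of_forall ?_)
    intro x
    simp only [hh]
    rw [Complex.norm_real, Real.norm_eq_abs, abs_eq_self.mpr (by positivity)]
    exact Real.rpow_le_one_of_one_le_of_nonpos (by simp) (by norm_num)
  have hsq : ∀ ξ : R3, ‖g ξ * (𝓕 u : L2) ξ‖ ^ 2
      = (1 + ‖ξ‖ ^ 2) ^ (1 / 2 : ℝ) * ‖(𝓕 u : L2) ξ‖ ^ 2 := by
    intro ξ
    rw [norm_mul, mul_pow]
    congr 1
    simp only [hg]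
    rw [Complex.norm_real, Real.norm_eq_abs, abs_eq_self.mpr (by positivity),
      ← Real.rpow_mul_natCast (by positivity)]
    norm_num
  have hmeas : AEStronglyMeasurable (fun ξ : R3 => g ξ * (𝓕 u : L2) ξ) volume :=
    hgt.1.continuous.aestronglyMeasurable.mul (Lp.aestronglyMeasurable _)
  have hint : Integrable (fun ξ : R3 => (1 + ‖ξ‖ ^ 2) ^ (1 / 2 : ℝ) * ‖(𝓕 u : L2) ξ‖ ^ 2) ↔
      MemLp (fun ξ : R3 => g ξ * (𝓕 u : L2) ξ) 2 volume := by
    rw [memLp_two_iff_integrable_sq_norm hmeas]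
    simp only [hsq]
  rw [hint, MemHHalf, TemperedDistribution.memSobolev_iff_exists_smulLeftCLM_fourier,
    Lp.fourier_toTemperedDistribution_eq]
  have hinj : Function.Injective (Lp.toTemperedDistributionCLM ℂ (volume : Measure R3) 2) :=
    LinearMap.ker_eq_bot.mp Lp.ker_toTemperedDistributionCLM_eq_bot
  constructor
  · rintro ⟨f, hf⟩
    have h1 : (hhb.toLp h • f : L2) = 𝓕 u := by
      apply hinj
      simp only [Lp.toTemperedDistributionCLM_apply]
      rw [Lp.toTemperedDistribution_smul_eq hht hhb, ← hf,
        TemperedDistribution.smulLeftCLM_smulLeftCLM_apply hgt hht, hgh]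
      simp
    refine (memLp_congr_ae ?_).mp (Lp.memLp f)
    filter_upwards [Lp.coeFn_lpSMul (r := 2) (hhb.toLp h) f, hhb.coeFn_toLp] with x hx hx'
    rw [← h1, hx, Pi.smul_apply', hx', smul_eq_mul, ← mul_assoc]
    have := congrFun hgh x
    simp only [Pi.mul_apply] at this
    rw [this, one_mul]
  · intro hm
    obtain ⟨f, hf⟩ : ∃ f : L2, f = hm.toLp _ := ⟨_, rfl⟩
    refine ⟨f, ?_⟩
    have h1 : (hhb.toLp h • f : L2) = 𝓕 u := by
      apply Lp.ext
      rw [hf]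
      filter_upwards [Lp.coeFn_lpSMul (r := 2) (hhb.toLp h) (hm.toLp _), hhb.coeFn_toLp,
        hm.coeFn_toLp] with x hx hx' hx''
      rw [hx, Pi.smul_apply', hx', hx'', smul_eq_mul, ← mul_assoc, mul_comm (h x)]
      have := congrFun hgh x
      simp only [Pi.mul_apply] at this
      rw [this, one_mul]
    rw [← h1, Lp.toTemperedDistribution_smul_eq hht hhb,
      TemperedDistribution.smulLeftCLM_smulLeftCLM_apply hht hgt, mul_comm, hgh]
    simp

/-- The integrand `|u(x)|² |u(y)|² / |x - y|` of the Coulomb energy. -/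
def coulombIntegrand (u : L2) (z : R3 × R3) : ℝ :=
  ‖u z.1‖ ^ 2 * ‖u z.2‖ ^ 2 / ‖z.1 - z.2‖

/-- `∫∫ |u(x)|² |u(y)|² / |x - y| dx dy`. -/
def coulomb (u : L2) : ℝ := ∫ z : R3 × R3, coulombIntegrand u z

/-- `∫ |u|^p dx`. -/
def powerIntegral (p : ℝ) (u : L2) : ℝ := ∫ x : R3, ‖u x‖ ^ p

/-- The Schrödinger-Poisson-Slater energy. -/
def energy (p α β : ℝ) (u : L2) : ℝ :=
  1 / 2 * sobolevNorm (1 / 2) u ^ 2 + α * coulomb u - β * powerIntegral p u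

/-- The constraint set `S(ρ)`. -/
def massSphere (ρ : ℝ) : Set L2 :=
  {u | MemHHalf u ∧ ∫ x : R3, ‖u x‖ ^ 2 = ρ}

/-- The infimum of the energy on `S(ρ)`, taken in the extended reals so that the value `-∞`
is allowed. -/
def groundEnergy (p α β ρ : ℝ) : EReal :=
  ⨅ u ∈ massSphere ρ, (energy p α β u : EReal)

/-- `v` is a minimizer of the energy on `S(ρ)`. -/
def IsMinimizer (p α β ρ : ℝ) (v : L2) : Prop :=
  v ∈ massSphere ρ ∧ (energy p α β v : EReal) = groundEnergy p α β ρ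

/-- The translate `u(· + τ)`. -/
def translate (τ : R3) (u : L2) : L2 :=
  Lp.compMeasurePreserving (fun x : R3 => x + τ) (measurePreserving_add_right volume τ) u

end SemiRelativistic

end

noncomputable section

namespace SemiRelativistic

/-! On the sphere of mass ρ the energy is J + ρ/2, where J = T + αD − βP, T(u) = ½∫(√(1+|ξ|²) −
1)|û|², D is the Coulomb energy and P = ∫|u|^p. The Gagliardo-Nirenberg inequality, in the form P ≤
C‖u‖^(p-2) ∫|ξ|^s|û|² with s = 3(p-2)/2 < 1, makes J coercive (`coercive`). Its endpoint p = 8/3, s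
= 1 controls D.

Small mass enters through scaling. At low frequency T behaves like ¼∫|ξ|²|û|², so T and P balance at
the frequency κ = ρ^((p-2)/(10-3p)), where both have order ρκ², while D has order ρ²κ. The ratio ρ/κ
tends to 0 with ρ because p < 3. Hence D is negligible against P for functions of nearly minimal
energy (`exists_small_mass`). Under u ↦ √θ u the gain from P, of degree p > 2, then beats the loss
from D, so the infimum I of J satisfies I(ρ) < (ρ/s) I(s) for masses 0 < s < ρ < ρ₁
(`exists_strict_subhomogeneous`).

Along a minimizing sequence I(ρ) < 0 keeps P away from 0, so the low-frequency part of each late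
term has size at least ε at some point (`exists_lowpass_ge`). Translating that point to the origin
yields a nonzero weak limit w in H^{1/2}. Mass and T split between w and the remainder by Hilbert
space orthogonality, P and D by one-sided Brezis-Lieb estimates (`reducedEnergy_splitting`). If ‖w‖²
< ρ, subhomogeneity applied to the remainder gives J(w) ≤ (‖w‖²/ρ) I(ρ) < I(‖w‖²), which is absurd.
So no mass is lost: the remainder tends to 0 in L², then in L^p, then in T, hence in H^{1/2}, and w
is a minimizer (`compact_of_lowpass`).

The final identity is stationarity of the energy at c = 1 along the mass-preserving dilations
c^{3/2} v(c·) (`pohozaev`). -/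

/-! ### The `L²` Fourier transform; low and high frequencies. -/

theorem integral_schwartz_mul_fourier (u : L2) (φ : 𝓢(R3, ℂ)) :
    ∫ x, φ x * (𝓕 u : L2) x = ∫ x, (𝓕 φ) x * u x := by
  have h := congrArg (fun T : 𝓢'(R3, ℂ) => T φ) (Lp.fourier_toTemperedDistribution_eq u)
  simpa [TemperedDistribution.fourier_apply] using h.symm

theorem integral_schwartz_mul_fourierInv (u : L2) (φ : 𝓢(R3, ℂ)) :
    ∫ x, φ x * (𝓕⁻ u : L2) x = ∫ x, (𝓕⁻ φ) x * u x := by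
  have h := congrArg (fun T : 𝓢'(R3, ℂ) => T φ) (Lp.fourierInv_toTemperedDistribution_eq u)
  simpa [TemperedDistribution.fourierInv_apply] using h.symm

theorem ext_of_integral_schwartz {f g : L2}
    (h : ∀ φ : 𝓢(R3, ℂ), ∫ x, φ x * f x = ∫ x, φ x * g x) : f = g := by
  apply LinearMap.ker_eq_bot.mp (Lp.ker_toTemperedDistributionCLM_eq_bot (F := ℂ)
    (μ := (volume : Measure R3)) (p := 2))
  ext φ
  simpa using h φ

theorem continuous_neg_innerₗ :
    Continuous fun p : R3 × R3 => (-innerₗ R3) p.1 p.2 := by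
  simp only [LinearMap.neg_apply, innerₗ_apply_apply]
  fun_prop

/-- Both sides have the same integrals against smooth compactly supported functions: for the `L²`
transform by duality with Schwartz functions, for the integral transform by Fubini. This makes
`lowpass` a genuine continuous representative. -/
theorem fourierInv_ae_eq (g : L2) (hg : Integrable g) :
    (𝓕⁻ g : L2) =ᵐ[volume] 𝓕⁻ (g : R3 → ℂ) := by
  have hcont : Continuous (𝓕⁻ (g : R3 → ℂ)) := by
    have := VectorFourier.fourierIntegral_continuous (L := -innerₗ R3) Real.continuous_fourierChar
      continuous_neg_innerₗ hg
    exact this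
  refine ae_eq_of_integral_contDiff_smul_eq
    ((Lp.memLp _).locallyIntegrable (by norm_num)) hcont.locallyIntegrable ?_
  intro ψ hψ hψc
  have hg₁ : HasCompactSupport (Complex.ofRealCLM ∘ ψ) := hψc.comp_left rfl
  have hg₂ : ContDiff ℝ ((⊤ : ℕ∞) : WithTop ℕ∞) (Complex.ofRealCLM ∘ ψ) := by fun_prop
  have h := integral_schwartz_mul_fourierInv g (hg₁.toSchwartzMap hg₂)
  have h2 := VectorFourier.integral_fourierIntegral_smul_eq_flip (L := -innerₗ R3)
    (f := (hg₁.toSchwartzMap hg₂ : R3 → ℂ)) (g := (g : R3 → ℂ)) (μ := volume) (ν := volume)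
    Real.continuous_fourierChar continuous_neg_innerₗ (SchwartzMap.integrable _) hg
  have hfl : (-innerₗ R3).flip = -innerₗ R3 := by
    ext x y
    simp [real_inner_comm]
  rw [hfl] at h2
  simp only [Complex.real_smul]
  refine Eq.trans ?_ (h.trans (Eq.trans ?_ h2))
  · simp
  · rw [SchwartzMap.fourierInv_coe]
    rfl

/-- The low-frequency part of `u`, as a function defined at every point. -/
def lowpass (R : ℝ) (u : L2) (x : R3) : ℂ :=
  𝓕⁻ (Set.indicator (Metric.ball 0 R) ((𝓕 u : L2) : R3 → ℂ)) x

/-- Restriction of an `L²` function to the complement of the ball of radius `R`. -/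
def cutoff (R : ℝ) (u : L2) : L2 :=
  ((Lp.memLp u).indicator (measurableSet_ball (x := (0 : R3)) (ε := R)).compl).toLp

/-- Restriction of an `L²` function to the ball of radius `R`. -/
def cutin (R : ℝ) (u : L2) : L2 :=
  ((Lp.memLp u).indicator (measurableSet_ball (x := (0 : R3)) (ε := R))).toLp

/-- The high-frequency part of `u`. -/
def highpass (R : ℝ) (u : L2) : L2 := 𝓕⁻ (cutoff R (𝓕 u))

theorem coeFn_cutoff (R : ℝ) (u : L2) :
    cutoff R u =ᵐ[volume] Set.indicator (Metric.ball 0 R)ᶜ (u : R3 → ℂ) := MemLp.coeFn_toLp _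

theorem coeFn_cutin (R : ℝ) (u : L2) :
    cutin R u =ᵐ[volume] Set.indicator (Metric.ball 0 R) (u : R3 → ℂ) := MemLp.coeFn_toLp _

theorem fourier_highpass (R : ℝ) (u : L2) : (𝓕 (highpass R u) : L2) = cutoff R (𝓕 u) :=
  FourierTransform.fourier_fourierInv_eq _

theorem cutin_add_cutoff (R : ℝ) (u : L2) : cutin R u + cutoff R u = u := by
  apply Lp.ext
  filter_upwards [Lp.coeFn_add (cutin R u) (cutoff R u), coeFn_cutin R u, coeFn_cutoff R u]
    with x h1 h2 h3
  rw [h1, Pi.add_apply, h2, h3, Set.indicator_self_add_compl_apply]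

theorem integrableOn_ball (R : ℝ) (u : L2) : IntegrableOn u (Metric.ball 0 R) := by
  have : IsFiniteMeasure ((volume : Measure R3).restrict (Metric.ball (0 : R3) R)) :=
    ⟨by rw [Measure.restrict_apply_univ]; exact measure_ball_lt_top⟩
  exact ((Lp.memLp u).restrict _).integrable (by norm_num)

theorem integrable_cutin (R : ℝ) (u : L2) : Integrable (cutin R u) :=
  ((integrable_indicator_iff measurableSet_ball).2 (integrableOn_ball R u)).congr
    (coeFn_cutin R u).symm

theorem ae_eq_lowpass_add_highpass (R : ℝ) (u : L2) :
    ∀ᵐ x, u x = lowpass R u x + highpass R u x := by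
  have h : u = 𝓕⁻ (cutin R (𝓕 u)) + highpass R u := by
    rw [highpass, ← FourierTransform.fourierInv_add, cutin_add_cutoff,
      FourierTransform.fourierInv_fourier_eq]
  have hl : 𝓕⁻ (cutin R (𝓕 u) : R3 → ℂ) = lowpass R u := by
    ext x
    rw [lowpass, Real.fourierInv_eq, Real.fourierInv_eq]
    refine integral_congr_ae ?_
    filter_upwards [coeFn_cutin R (𝓕 u : L2)] with y hy
    rw [hy]
  have h1 := Lp.coeFn_add (𝓕⁻ (cutin R (𝓕 u))) (highpass R u)
  rw [← h] at h1
  filter_upwards [h1, fourierInv_ae_eq _ (integrable_cutin R (𝓕 u))] with x h2 h3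
  rw [h2, Pi.add_apply, h3, hl]

theorem norm_sq_eq_integral (u : L2) : ‖u‖ ^ 2 = ∫ x, ‖u x‖ ^ 2 := by
  have := L2.inner_def (𝕜 := ℂ) u u
  rw [inner_self_eq_norm_sq_to_K] at this
  simp_rw [inner_self_eq_norm_sq_to_K] at this
  have h2 : ((‖u‖ ^ 2 : ℝ) : ℂ) = ((∫ x, ‖u x‖ ^ 2 : ℝ) : ℂ) := by
    rw [← integral_complex_ofReal]
    push_cast
    exact this
  exact_mod_cast h2

theorem integrable_norm_sq (u : L2) : Integrable (fun x => ‖u x‖ ^ 2) :=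
  (memLp_two_iff_integrable_sq_norm (Lp.aestronglyMeasurable u)).1 (Lp.memLp u)

/-- The plane wave at `x`, restricted to the frequencies of size less than `R`. -/
def waveFun (R : ℝ) (x : R3) : R3 → ℂ :=
  (Metric.ball (0 : R3) R).indicator fun ξ => (Real.fourierChar (-(inner ℝ ξ x)) : ℂ)

theorem memLp_waveFun (R : ℝ) (x : R3) : MemLp (waveFun R x) 2 volume := by
  have hc : Continuous fun ξ : R3 => (Real.fourierChar (-(inner ℝ ξ x)) : ℂ) := by fun_prop
  refine (memLp_indicator_const 2 (measurableSet_ball (x := (0 : R3)) (ε := R)) (1 : ℂ)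
    (Or.inr measure_ball_lt_top.ne)).of_le
    (hc.aestronglyMeasurable.indicator measurableSet_ball) (Eventually.of_forall fun ξ => ?_)
  by_cases hb : ξ ∈ Metric.ball (0 : R3) R
  · simp only [waveFun, Set.indicator_of_mem hb]
    rw [Circle.norm_coe, norm_one]
  · simp only [waveFun, Set.indicator_of_notMem hb]
    simp

/-- `waveFun` as an element of `L²`. -/
def wave (R : ℝ) (x : R3) : L2 := (memLp_waveFun R x).toLp

theorem coeFn_wave (R : ℝ) (x : R3) : wave R x =ᵐ[volume] waveFun R x := MemLp.coeFn_toLp _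

/-- In this form a value of the low-frequency part is a bounded functional of `𝓕 u`: it obeys
Cauchy-Schwarz, and it passes to weak limits. -/
theorem lowpass_eq_inner (R : ℝ) (u : L2) (x : R3) :
    lowpass R u x = inner ℂ (wave R x) (𝓕 u : L2) := by
  rw [lowpass, Real.fourierInv_eq, L2.inner_def]
  refine integral_congr_ae ?_
  filter_upwards [coeFn_wave R x] with ξ hξ
  rw [hξ, waveFun]
  by_cases hb : ξ ∈ Metric.ball (0 : R3) R
  · simp [hb, Circle.smul_def, Real.fourierChar_apply, ← Complex.exp_conj, mul_comm,
      Complex.conj_ofNat]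
  · simp [hb]

theorem norm_wave_sq (R : ℝ) (x : R3) :
    ‖wave R x‖ ^ 2 = volume.real (Metric.ball (0 : R3) R) := by
  rw [norm_sq_eq_integral, ← integral_indicator_one measurableSet_ball]
  refine integral_congr_ae ?_
  filter_upwards [coeFn_wave R x] with ξ hξ
  rw [hξ, waveFun]
  by_cases hb : ξ ∈ Metric.ball (0 : R3) R
  · simp [hb, Circle.norm_coe]
  · simp [hb]

/-- Bernstein's inequality: Cauchy-Schwarz against a plane wave cut to the ball of radius R, whose
squared norm is the volume of that ball, of order R³. -/
theorem norm_lowpass_le {R : ℝ} (hR : 0 ≤ R) (u : L2) (x : R3) :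
    ‖lowpass R u x‖ ≤ √(volume.real (Metric.ball (0 : R3) 1)) * R ^ (3 / 2 : ℝ) * ‖u‖ := by
  rw [lowpass_eq_inner]
  refine (norm_inner_le_norm _ _).trans ?_
  rw [Lp.norm_fourier_eq]
  refine mul_le_mul_of_nonneg_right ?_ (norm_nonneg _)
  refine le_of_sq_le_sq ?_ (by positivity)
  rw [norm_wave_sq, mul_pow, Real.sq_sqrt measureReal_nonneg, Measure.real,
    Measure.addHaar_ball _ _ hR, ← Real.rpow_mul_natCast hR]
  have : R ^ ((3 / 2 : ℝ) * (2 : ℕ)) = R ^ 3 := by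
    rw [← Real.rpow_natCast]
    norm_num
  rw [this, ENNReal.toReal_mul, ENNReal.toReal_ofReal (by positivity), mul_comm,
    finrank_euclideanSpace_fin, Measure.real]

/-! ### Translations and dilations on the Fourier side. -/

theorem coeFn_translate (τ : R3) (u : L2) :
    translate τ u =ᵐ[volume] fun x => u (x + τ) :=
  Lp.coeFn_compMeasurePreserving u (measurePreserving_add_right volume τ)

theorem memLp_modulate (τ : R3) (u : L2) :
    MemLp (fun ξ => (Real.fourierChar (inner ℝ ξ τ) : ℂ) * u ξ) 2 volume := by
  have hc : Continuous fun ξ : R3 => (Real.fourierChar (inner ℝ ξ τ) : ℂ) := by fun_prop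
  refine (Lp.memLp u).of_le (hc.aestronglyMeasurable.mul (Lp.aestronglyMeasurable u))
    (Eventually.of_forall fun ξ => ?_)
  rw [norm_mul, Circle.norm_coe, one_mul]

/-- Multiplication by the character `ξ ↦ exp (2 π i τ · ξ)`. -/
def modulate (τ : R3) (u : L2) : L2 := (memLp_modulate τ u).toLp

theorem coeFn_modulate (τ : R3) (u : L2) :
    modulate τ u =ᵐ[volume] fun ξ => (Real.fourierChar (inner ℝ ξ τ) : ℂ) * u ξ :=
  MemLp.coeFn_toLp _

/-- The n-th derivative of t ↦ exp(2πit) is bounded by (2π)^n. Temperate growth keeps a Schwartz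
test function Schwartz after multiplication by the character, which is what `fourier_translate`
needs. -/
theorem hasTemperateGrowth_fourierChar (τ : R3) :
    (fun ξ : R3 => (Real.fourierChar (inner ℝ ξ τ) : ℂ)).HasTemperateGrowth := by
  have h : (fun t : ℝ => (Real.fourierChar t : ℂ)).HasTemperateGrowth := by
    have he : (fun t : ℝ => (Real.fourierChar t : ℂ))
        = fun t : ℝ => Complex.exp ((2 * Real.pi * Complex.I) * t) := by
      ext t
      rw [Real.fourierChar_apply]
      congr 1
      push_cast
      ring
    have hi : ∀ n : ℕ, iteratedDeriv n (fun t : ℝ => Complex.exp ((2 * Real.pi * Complex.I) * t))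
        = fun t : ℝ => (2 * Real.pi * Complex.I) ^ n
          * Complex.exp ((2 * Real.pi * Complex.I) * t) := by
      intro n
      induction n with
      | zero => simp
      | succ n ih =>
        rw [iteratedDeriv_succ, ih]
        ext t
        have h1 : HasDerivAt (fun t : ℝ => Complex.exp ((2 * Real.pi * Complex.I) * t))
            (Complex.exp ((2 * Real.pi * Complex.I) * t) * (2 * Real.pi * Complex.I)) t := by
          have h2 : HasDerivAt (fun t : ℝ => (2 * Real.pi * Complex.I) * (t : ℂ))
              (2 * Real.pi * Complex.I) t := by
            simpa using (Complex.ofRealCLM.hasDerivAt (x := t)).const_mul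
              (2 * Real.pi * Complex.I)
          exact h2.cexp
        rw [(h1.const_mul _).deriv]
        ring
    rw [he]
    refine ⟨?_, fun n => ⟨0, (2 * Real.pi) ^ n, fun t => ?_⟩⟩
    · exact (contDiff_const.mul Complex.ofRealCLM.contDiff).cexp
    rw [norm_iteratedFDeriv_eq_norm_iteratedDeriv, hi, norm_mul, Complex.norm_exp]
    simp [abs_of_pos Real.pi_pos]
  exact h.comp (Function.hasTemperateGrowth_inner_left τ)

theorem fourier_translate (τ : R3) (u : L2) :
    (𝓕 (translate τ u) : L2) = modulate τ (𝓕 u) := by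
  refine ext_of_integral_schwartz fun φ => ?_
  set ψ : 𝓢(R3, ℂ) := SchwartzMap.smulLeftCLM ℂ
    (fun ξ : R3 => (Real.fourierChar (inner ℝ ξ τ) : ℂ)) φ with hψ
  have hψa : ∀ ξ, ψ ξ = (Real.fourierChar (inner ℝ ξ τ) : ℂ) * φ ξ := fun ξ => by
    rw [hψ, SchwartzMap.smulLeftCLM_apply_apply (hasTemperateGrowth_fourierChar τ), smul_eq_mul]
  have h1 : ∫ x, φ x * (modulate τ (𝓕 u)) x = ∫ x, (𝓕 ψ) x * u x := by
    rw [← integral_schwartz_mul_fourier]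
    refine integral_congr_ae ?_
    filter_upwards [coeFn_modulate τ (𝓕 u)] with x hx
    rw [hx, hψa]
    ring
  have h2 : ∀ x, (𝓕 ψ) (x + τ) = (𝓕 φ) x := fun x => by
    rw [SchwartzMap.fourier_coe, SchwartzMap.fourier_coe, Real.fourier_eq, Real.fourier_eq]
    refine integral_congr_ae (Eventually.of_forall fun ξ => ?_)
    simp only [hψa, Circle.smul_def, smul_eq_mul, ← mul_assoc, ← Circle.coe_mul,
      ← AddChar.map_add_eq_mul]
    congr 4
    rw [inner_add_right]
    ring
  refine Eq.trans ?_ ((integral_add_right_eq_self (fun x => (𝓕 ψ) x * u x) τ).trans h1.symm)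
  rw [integral_schwartz_mul_fourier]
  refine integral_congr_ae ?_
  filter_upwards [coeFn_translate τ u] with x hx
  rw [hx, h2]

theorem norm_fourier_translate (τ : R3) (u : L2) :
    ∀ᵐ ξ, ‖(𝓕 (translate τ u) : L2) ξ‖ = ‖(𝓕 u : L2) ξ‖ := by
  rw [fourier_translate]
  filter_upwards [coeFn_modulate τ (𝓕 u)] with ξ hξ
  rw [hξ, norm_mul, Circle.norm_coe, one_mul]

theorem quasiMeasurePreserving_smul {c : ℝ} (hc : c ≠ 0) :
    Measure.QuasiMeasurePreserving (fun x : R3 => c • x) volume volume := by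
  refine ⟨by fun_prop, ?_⟩
  rw [Measure.map_addHaar_smul _ hc]
  exact Measure.smul_absolutelyContinuous

theorem memLp_dil (c : ℝ) (hc : 0 < c) (u : L2) :
    MemLp (fun x => ((c ^ (3 / 2 : ℝ) : ℝ) : ℂ) * u (c • x)) 2 volume := by
  have hm : AEStronglyMeasurable (fun x => u (c • x)) volume :=
    (Lp.aestronglyMeasurable u).comp_quasiMeasurePreserving (quasiMeasurePreserving_smul hc.ne')
  refine MemLp.const_mul ?_ _
  exact (memLp_two_iff_integrable_sq_norm hm).2 ((integrable_norm_sq u).comp_smul hc.ne')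

/-- The `L²`-normalised dilate `c^{3/2} u(c ·)`. -/
def dil (c : ℝ) (hc : 0 < c) (u : L2) : L2 := (memLp_dil c hc u).toLp

theorem coeFn_dil (c : ℝ) (hc : 0 < c) (u : L2) :
    dil c hc u =ᵐ[volume] fun x => ((c ^ (3 / 2 : ℝ) : ℝ) : ℂ) * u (c • x) := MemLp.coeFn_toLp _

theorem integral_comp_dil {E : Type*} [NormedAddCommGroup E] [NormedSpace ℝ E] (f : R3 → E)
    {c : ℝ} (hc : 0 < c) : ∫ x, f (c • x) = (c ^ 3)⁻¹ • ∫ x, f x := by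
  rw [Measure.integral_comp_smul, finrank_euclideanSpace_fin, abs_of_pos (by positivity)]

theorem integral_eq_of_comp_dil {E : Type*} [NormedAddCommGroup E] [NormedSpace ℝ E] {F : R3 → E}
    (f : R3 → E) {c : ℝ} (hc : 0 < c) (h : F =ᵐ[volume] fun x => f (c • x)) :
    ∫ x, F x = (c ^ 3)⁻¹ • ∫ x, f x := by
  rw [integral_congr_ae h, integral_comp_dil f hc]

theorem fourier_dil (c : ℝ) (hc : 0 < c) (u : L2) :
    (𝓕 (dil c hc u) : L2) = dil c⁻¹ (inv_pos.2 hc) (𝓕 u) := by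
  refine ext_of_integral_schwartz fun φ => ?_
  have hc' : (c : ℂ) ≠ 0 := by exact_mod_cast hc.ne'
  set ψ : 𝓢(R3, ℂ) := SchwartzMap.compCLMOfContinuousLinearEquiv ℂ
    (ContinuousLinearEquiv.smulLeft (Units.mk0 c hc.ne') : R3 ≃L[ℝ] R3) φ with hψ
  have hψa : ∀ ξ, ψ ξ = φ (c • ξ) := fun ξ => rfl
  have hr : (c⁻¹) ^ (3 / 2 : ℝ) * c ^ 3 = c ^ (3 / 2 : ℝ) := by
    rw [Real.inv_rpow hc.le, ← Real.rpow_neg hc.le, ← Real.rpow_natCast, ← Real.rpow_add hc]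
    norm_num
  have h1 : ∫ x, φ x * (dil c⁻¹ (inv_pos.2 hc) (𝓕 u)) x
      = ((c ^ (3 / 2 : ℝ) : ℝ) : ℂ) * ∫ x, (𝓕 ψ) x * u x := by
    rw [← integral_schwartz_mul_fourier]
    have := integral_eq_of_comp_dil (F := fun x => φ x * (dil c⁻¹ (inv_pos.2 hc) (𝓕 u)) x)
      (fun y => (((c⁻¹) ^ (3 / 2 : ℝ) : ℝ) : ℂ) * (ψ y * (𝓕 u : L2) y)) (inv_pos.2 hc) (by
      filter_upwards [coeFn_dil c⁻¹ (inv_pos.2 hc) (𝓕 u)] with x hx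
      simp only [hx, hψa, smul_inv_smul₀ hc.ne']
      ring)
    rw [this, integral_const_mul, ← hr, inv_pow, inv_inv, Complex.real_smul]
    push_cast
    ring
  have h2 : ∀ x, (𝓕 ψ) (c • x) = (((c ^ 3)⁻¹ : ℝ) : ℂ) * (𝓕 φ) x := fun x => by
    rw [SchwartzMap.fourier_coe, SchwartzMap.fourier_coe, Real.fourier_eq, Real.fourier_eq]
    rw [← Complex.real_smul]
    refine Eq.trans ?_ (integral_comp_dil
      (fun y => Real.fourierChar (-inner ℝ y x) • φ y) hc)
    refine integral_congr_ae (Eventually.of_forall fun ξ => ?_)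
    simp only [hψa, inner_smul_left, inner_smul_right]
    simp
  rw [h1, integral_schwartz_mul_fourier]
  have h3 := integral_eq_of_comp_dil (F := fun x => (𝓕 φ) x * (dil c hc u) x)
    (fun y => ((c ^ (3 / 2 : ℝ) * c ^ 3 : ℝ) : ℂ) * ((𝓕 ψ) y * u y)) hc (by
    filter_upwards [coeFn_dil c hc u] with x hx
    simp only [hx, h2]
    push_cast
    field_simp)
  rw [h3, integral_const_mul, Complex.real_smul]
  push_cast
  field_simp

/-! ### The Gagliardo-Nirenberg inequality. -/

theorem norm_sq_fourier (u : L2) : ‖u‖ ^ 2 = ∫ ξ, ‖(𝓕 u : L2) ξ‖ ^ 2 := by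
  rw [← norm_sq_eq_integral, Lp.norm_fourier_eq]

theorem lintegral_norm_sq_highpass (R : ℝ) (u : L2) :
    ∫⁻ x, ENNReal.ofReal (‖highpass R u x‖ ^ 2)
      = ∫⁻ ξ in (Metric.ball 0 R)ᶜ, ENNReal.ofReal (‖(𝓕 u : L2) ξ‖ ^ 2) := by
  rw [← ofReal_integral_eq_lintegral_ofReal (integrable_norm_sq _)
    (Eventually.of_forall fun x => by positivity), ← norm_sq_eq_integral, norm_sq_fourier,
    fourier_highpass, ofReal_integral_eq_lintegral_ofReal (integrable_norm_sq _)
    (Eventually.of_forall fun x => by positivity), ← lintegral_indicator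
    measurableSet_ball.compl]
  refine lintegral_congr_ae ?_
  filter_upwards [coeFn_cutoff R (𝓕 u)] with ξ hξ
  rw [hξ]
  by_cases hb : ξ ∈ (Metric.ball (0 : R3) R)ᶜ
  · rw [Set.indicator_of_mem hb, Set.indicator_of_mem hb]
  · rw [Set.indicator_of_notMem hb, Set.indicator_of_notMem hb]
    simp

/-- The square root of the volume of the unit ball. -/
def ballConst : ℝ := √(volume.real (Metric.ball (0 : R3) 1))

theorem ballConst_pos : 0 < ballConst :=
  Real.sqrt_pos.2 (ENNReal.toReal_pos (Metric.measure_ball_pos _ _ one_pos).ne'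
    measure_ball_lt_top.ne)

/-- Where |u| > t and the low-frequency part is at most t/2, the high-frequency part is at least
t/2. Chebyshev and Plancherel then bound the measure by the high frequencies alone, and the
indicator records which frequencies count at height t. -/
theorem measure_superlevel_le {u : L2} (hu : 0 < ‖u‖) {t : ℝ} (ht : 0 < t) :
    volume {x | t < ‖u x‖} ≤ ENNReal.ofReal (4 / t ^ 2) *
      ∫⁻ ξ, ENNReal.ofReal (‖(𝓕 u : L2) ξ‖ ^ 2) *
        {z : ℝ × R3 | z.1 ≤ 2 * ballConst * ‖u‖ * ‖z.2‖ ^ (3 / 2 : ℝ)}.indicator 1 (t, ξ) := by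
  have hA : 0 < 2 * ballConst * ‖u‖ := by have := ballConst_pos; positivity
  set A := 2 * ballConst * ‖u‖ with hAdef
  -- The largest cut-off at which Bernstein's inequality still bounds the low-frequency part by t/2.
  set R : ℝ := (t / A) ^ (2 / 3 : ℝ) with hR
  have hR0 : 0 ≤ R := by positivity
  have hR32 : R ^ (3 / 2 : ℝ) = t / A := by
    rw [hR, ← Real.rpow_mul (by positivity)]
    norm_num
  have hlow : ∀ x, ‖lowpass R u x‖ ≤ t / 2 := fun x => by
    refine (norm_lowpass_le hR0 u x).trans_eq ?_
    rw [hR32]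
    change ballConst * (t / A) * ‖u‖ = t / 2
    have : t / 2 = A * (t / A) / 2 := by field_simp
    rw [this]
    nth_rewrite 2 [hAdef]
    ring
  have h1 : volume {x | t < ‖u x‖} ≤
      volume {x | ENNReal.ofReal (t ^ 2 / 4) ≤ ENNReal.ofReal (‖highpass R u x‖ ^ 2)} := by
    refine measure_mono_ae ?_
    filter_upwards [ae_eq_lowpass_add_highpass R u] with x hx hxt
    have hxt' : t < ‖u x‖ := hxt
    refine ENNReal.ofReal_le_ofReal ?_
    have : t / 2 ≤ ‖highpass R u x‖ := by
      rw [hx] at hxt'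
      linarith [norm_add_le (lowpass R u x) (highpass R u x), hlow x]
    calc t ^ 2 / 4 = (t / 2) ^ 2 := by ring
      _ ≤ _ := by gcongr
  refine h1.trans ((meas_ge_le_lintegral_div
    ((Lp.aestronglyMeasurable _).aemeasurable.norm.pow_const 2).ennreal_ofReal
    (by simpa using by positivity) ENNReal.ofReal_ne_top).trans_eq ?_)
  rw [lintegral_norm_sq_highpass, ENNReal.div_eq_inv_mul, ← ENNReal.ofReal_inv_of_pos
    (by positivity), inv_div, ← lintegral_indicator measurableSet_ball.compl]
  congr 1
  refine lintegral_congr fun ξ => ?_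
  have hiff : ξ ∈ (Metric.ball (0 : R3) R)ᶜ ↔ t ≤ A * ‖ξ‖ ^ (3 / 2 : ℝ) := by
    rw [Set.mem_compl_iff, mem_ball_zero_iff, not_lt, ← Real.rpow_le_rpow_iff hR0 (norm_nonneg _)
      (by norm_num : (0 : ℝ) < 3 / 2), hR32, div_le_iff₀ hA, mul_comm]
  by_cases hb : ξ ∈ (Metric.ball (0 : R3) R)ᶜ
  · rw [Set.indicator_of_mem hb, Set.indicator_of_mem (by exact hiff.1 hb)]
    simp
  · rw [Set.indicator_of_notMem hb, Set.indicator_of_notMem (by exact fun h => hb (hiff.2 h))]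
    simp

theorem lintegral_rpow_Ioc {q b : ℝ} (hq : -1 < q) (hb : 0 ≤ b) :
    ∫⁻ t in Set.Ioc 0 b, ENNReal.ofReal (t ^ q) = ENNReal.ofReal (b ^ (q + 1) / (q + 1)) := by
  rw [← ofReal_integral_eq_lintegral_ofReal, ← intervalIntegral.integral_of_le hb,
    integral_rpow (Or.inl hq), Real.zero_rpow (by linarith), sub_zero]
  · exact (intervalIntegrable_iff_integrableOn_Ioc_of_le hb).1
      (intervalIntegral.intervalIntegrable_rpow' hq)
  · filter_upwards [ae_restrict_mem measurableSet_Ioc] with t ht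
    exact Real.rpow_nonneg ht.1.le _

/-- The constant in the Gagliardo-Nirenberg inequality. -/
def gnConst (p : ℝ) : ℝ := p * (4 * (2 * ballConst) ^ (p - 2) / (p - 2))

theorem gnConst_pos {p : ℝ} (hp : 2 < p) : 0 < gnConst p := by
  have := ballConst_pos
  have : 0 < p - 2 := by linarith
  unfold gnConst
  positivity

/-- Layer-cake formula with a cut-off depending on the height t. After exchanging the integrals,
each frequency ξ is weighted by ∫ t^(p-3) dt over 0 < t ≤ A|ξ|^{3/2}, which produces |ξ|^(3(p-2)/2)
and converges because p > 2. -/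
theorem gagliardo_nirenberg_lintegral {p : ℝ} (hp : 2 < p) (u : L2) :
    ∫⁻ x, ENNReal.ofReal (‖u x‖ ^ p) ≤ ENNReal.ofReal (gnConst p * ‖u‖ ^ (p - 2)) *
      ∫⁻ ξ, ENNReal.ofReal (‖ξ‖ ^ (3 * (p - 2) / 2) * ‖(𝓕 u : L2) ξ‖ ^ 2) := by
  rcases (norm_nonneg u).eq_or_lt with hu | hu
  · have hu0 : u = 0 := norm_eq_zero.1 hu.symm
    have : ∫⁻ x, ENNReal.ofReal (‖u x‖ ^ p) = 0 := by
      rw [lintegral_eq_zero_iff' ((Lp.aestronglyMeasurable u).aemeasurable.norm.pow_const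
        p).ennreal_ofReal]
      have h0 : u =ᵐ[volume] 0 := hu0 ▸ Lp.coeFn_zero ℂ 2 volume
      filter_upwards [h0] with x hx
      simp [hx, Real.zero_rpow (by linarith : p ≠ 0)]
    rw [this]
    exact zero_le
  have hp0 : 0 < p - 2 := by linarith
  have hc := ballConst_pos
  set A := 2 * ballConst * ‖u‖ with hAdef
  have hA : 0 < A := by positivity
  set S : Set (ℝ × R3) := {z : ℝ × R3 | z.1 ≤ A * ‖z.2‖ ^ (3 / 2 : ℝ)} with hS
  have hSm : MeasurableSet S := by
    refine measurableSet_le (f := fun z : ℝ × R3 => z.1) measurable_fst ?_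
    exact (measurable_snd.norm.pow_const _).const_mul _
  have hum : AEMeasurable (fun ξ => ENNReal.ofReal (‖(𝓕 u : L2) ξ‖ ^ 2)) volume :=
    ((Lp.aestronglyMeasurable (𝓕 u : L2)).aemeasurable.norm.pow_const 2).ennreal_ofReal
  rw [lintegral_rpow_eq_lintegral_meas_lt_mul volume
    (Eventually.of_forall fun x => norm_nonneg (u x))
    (Lp.aestronglyMeasurable u).aemeasurable.norm (by linarith)]
  calc ENNReal.ofReal p * ∫⁻ t in Set.Ioi 0, volume {x | t < ‖u x‖} * ENNReal.ofReal (t ^ (p - 1))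
      ≤ ENNReal.ofReal p * ∫⁻ t in Set.Ioi (0 : ℝ), ∫⁻ ξ, ENNReal.ofReal (4 * t ^ (p - 3)) *
        (ENNReal.ofReal (‖(𝓕 u : L2) ξ‖ ^ 2) * S.indicator 1 (t, ξ)) := by
        gcongr ENNReal.ofReal p * ?_
        refine setLIntegral_mono' (s := Set.Ioi (0 : ℝ)) measurableSet_Ioi fun t ht => ?_
        have ht' : 0 < t := ht
        rw [lintegral_const_mul' _ _ ENNReal.ofReal_ne_top]
        refine (mul_le_mul_left (measure_superlevel_le hu ht) _).trans_eq ?_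
        rw [mul_right_comm, ← ENNReal.ofReal_mul (by positivity)]
        congr 2
        have : t ^ (p - 1) = t ^ (p - 3) * t ^ 2 := by
          rw [← Real.rpow_natCast, ← Real.rpow_add ht']
          norm_num
          ring_nf
        rw [this]
        field_simp
    _ = ENNReal.ofReal p * ∫⁻ ξ, ∫⁻ t in Set.Ioi (0 : ℝ), ENNReal.ofReal (4 * t ^ (p - 3)) *
        (ENNReal.ofReal (‖(𝓕 u : L2) ξ‖ ^ 2) * S.indicator 1 (t, ξ)) := by
        rw [lintegral_lintegral_swap]
        refine AEMeasurable.mul ?_ (AEMeasurable.mul ?_ ?_)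
        · exact (Measurable.ennreal_ofReal
            ((measurable_fst.pow_const _).const_mul _)).aemeasurable
        · exact hum.comp_snd
        · exact (measurable_one.indicator hSm).aemeasurable
    _ = ENNReal.ofReal p * ∫⁻ ξ, ENNReal.ofReal (4 * A ^ (p - 2) / (p - 2)) *
          ENNReal.ofReal (‖ξ‖ ^ (3 * (p - 2) / 2) * ‖(𝓕 u : L2) ξ‖ ^ 2) := by
        congr 1
        refine lintegral_congr fun ξ => ?_
        have hb : 0 ≤ A * ‖ξ‖ ^ (3 / 2 : ℝ) := by positivity
        have h1 : ∀ t : ℝ, ENNReal.ofReal (4 * t ^ (p - 3)) *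
            (ENNReal.ofReal (‖(𝓕 u : L2) ξ‖ ^ 2) * S.indicator 1 (t, ξ))
            = ENNReal.ofReal (4 * ‖(𝓕 u : L2) ξ‖ ^ 2) *
              (Set.Iic (A * ‖ξ‖ ^ (3 / 2 : ℝ))).indicator
                (fun t => ENNReal.ofReal (t ^ (p - 3))) t := fun t => by
          rw [ENNReal.ofReal_mul (by norm_num), ENNReal.ofReal_mul (by norm_num)]
          by_cases ht : t ≤ A * ‖ξ‖ ^ (3 / 2 : ℝ)
          · rw [Set.indicator_of_mem (by exact ht), Set.indicator_of_mem (by exact ht)]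
            simp only [Pi.one_apply]
            ring
          · rw [Set.indicator_of_notMem (by exact ht), Set.indicator_of_notMem (by exact ht)]
            simp
        simp_rw [h1]
        rw [lintegral_const_mul' _ _ ENNReal.ofReal_ne_top, lintegral_indicator (measurableSet_Iic (a := A * ‖ξ‖ ^ (3 / 2 : ℝ))),
          Measure.restrict_restrict measurableSet_Iic, Set.inter_comm, Set.Ioi_inter_Iic,
          lintegral_rpow_Ioc (by linarith) hb, ← ENNReal.ofReal_mul (by positivity),
          ← ENNReal.ofReal_mul (by positivity)]
        congr 1
        rw [show p - 3 + 1 = p - 2 by ring, Real.mul_rpow hA.le (by positivity),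
          ← Real.rpow_mul (norm_nonneg _), show 3 / 2 * (p - 2) = 3 * (p - 2) / 2 by ring]
        ring
    _ = _ := by
        rw [lintegral_const_mul' _ _ ENNReal.ofReal_ne_top, ← mul_assoc,
          ← ENNReal.ofReal_mul (by linarith)]
        congr 2
        rw [gnConst, hAdef, Real.mul_rpow (by positivity) hu.le]
        ring

/-- The real-valued form, with a free integrable majorant `w`. Different majorants give the bounds
by the Sobolev norm, by the kinetic energy, and for the high-frequency part. -/
theorem gagliardo_nirenberg_of_weight {p : ℝ} (hp : 2 < p) (u : L2) {w : R3 → ℝ}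
    (hw : ∀ᵐ ξ, ‖ξ‖ ^ (3 * (p - 2) / 2) * ‖(𝓕 u : L2) ξ‖ ^ 2 ≤ w ξ) (hi : Integrable w) :
    Integrable (fun x => ‖u x‖ ^ p) ∧
      powerIntegral p u ≤ gnConst p * ‖u‖ ^ (p - 2) * ∫ ξ, w ξ := by
  have hw0 : 0 ≤ᵐ[volume] w := by
    filter_upwards [hw] with ξ hξ
    exact le_trans (by positivity) hξ
  have hG := gnConst_pos hp
  have h1 : ∫⁻ x, ENNReal.ofReal (‖u x‖ ^ p)
      ≤ ENNReal.ofReal (gnConst p * ‖u‖ ^ (p - 2) * ∫ ξ, w ξ) := by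
    refine (gagliardo_nirenberg_lintegral hp u).trans ?_
    rw [ENNReal.ofReal_mul (p := gnConst p * ‖u‖ ^ (p - 2)) (by positivity), ofReal_integral_eq_lintegral_ofReal hi hw0]
    refine mul_le_mul_right (lintegral_mono_ae ?_) _
    filter_upwards [hw] with ξ hξ
    exact ENNReal.ofReal_le_ofReal hξ
  have hm : AEStronglyMeasurable (fun x => ‖u x‖ ^ p) volume :=
    ((Lp.aestronglyMeasurable u).aemeasurable.norm.pow_const p).aestronglyMeasurable
  have hn : 0 ≤ᵐ[volume] fun x => ‖u x‖ ^ p := Eventually.of_forall fun x => by positivity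
  have hint : Integrable (fun x => ‖u x‖ ^ p) :=
    ⟨hm, (hasFiniteIntegral_iff_ofReal hn).2 (h1.trans_lt ENNReal.ofReal_lt_top)⟩
  refine ⟨hint, ?_⟩
  rw [← ofReal_integral_eq_lintegral_ofReal hint hn] at h1
  exact (ENNReal.ofReal_le_ofReal_iff (mul_nonneg (by positivity)
    (integral_nonneg_of_ae hw0))).1 h1

/-! ### The symbol √(1+|ξ|²), the kinetic energy and bounds for the power integral. -/

theorem sobolevNorm_sq (s : ℝ) (u : L2) :
    sobolevNorm s u ^ 2 = ∫ ξ : R3, (1 + ‖ξ‖ ^ 2) ^ s * ‖(𝓕 u : L2) ξ‖ ^ 2 :=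
  Real.sq_sqrt (integral_nonneg fun ξ => by positivity)

/-- The kinetic energy, with the contribution of the mass removed. -/
def kinetic (u : L2) : ℝ := (sobolevNorm (1 / 2) u ^ 2 - ‖u‖ ^ 2) / 2

theorem rpow_half_eq_sqrt (ξ : R3) : (1 + ‖ξ‖ ^ 2) ^ (1 / 2 : ℝ) = √(1 + ‖ξ‖ ^ 2) :=
  (Real.sqrt_eq_rpow _).symm

theorem one_le_symbol (ξ : R3) : 1 ≤ (1 + ‖ξ‖ ^ 2) ^ (1 / 2 : ℝ) := by
  rw [rpow_half_eq_sqrt]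
  exact Real.one_le_sqrt.2 (by nlinarith [norm_nonneg ξ])

theorem norm_le_symbol (ξ : R3) : ‖ξ‖ ≤ (1 + ‖ξ‖ ^ 2) ^ (1 / 2 : ℝ) := by
  rw [rpow_half_eq_sqrt]
  exact Real.le_sqrt_of_sq_le (by linarith)

theorem symbol_sub_one_mul (ξ : R3) :
    ((1 + ‖ξ‖ ^ 2) ^ (1 / 2 : ℝ) - 1) * ((1 + ‖ξ‖ ^ 2) ^ (1 / 2 : ℝ) + 1) = ‖ξ‖ ^ 2 := by
  rw [rpow_half_eq_sqrt]
  have := Real.sq_sqrt (show 0 ≤ 1 + ‖ξ‖ ^ 2 by positivity)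
  linarith

theorem symbol_le_one_add (ξ : R3) : (1 + ‖ξ‖ ^ 2) ^ (1 / 2 : ℝ) ≤ 1 + ‖ξ‖ := by
  rw [rpow_half_eq_sqrt]
  exact Real.sqrt_le_iff.2 ⟨by positivity, by nlinarith [norm_nonneg ξ]⟩

theorem symbol_sub_one_le (ξ : R3) : (1 + ‖ξ‖ ^ 2) ^ (1 / 2 : ℝ) - 1 ≤ ‖ξ‖ ^ 2 / 2 := by
  nlinarith [symbol_sub_one_mul ξ, one_le_symbol ξ]

theorem integrable_symbol {u : L2} (hu : MemHHalf u) :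
    Integrable (fun ξ : R3 => (1 + ‖ξ‖ ^ 2) ^ (1 / 2 : ℝ) * ‖(𝓕 u : L2) ξ‖ ^ 2) :=
  (memHHalf_iff_integrable u).1 hu

theorem kinetic_eq {u : L2} (hu : MemHHalf u) :
    kinetic u = ∫ ξ : R3, ((1 + ‖ξ‖ ^ 2) ^ (1 / 2 : ℝ) - 1) / 2 * ‖(𝓕 u : L2) ξ‖ ^ 2 := by
  rw [kinetic, sobolevNorm_sq, norm_sq_fourier, ← integral_sub (integrable_symbol hu)
    (integrable_norm_sq _), ← integral_div]
  congr 1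
  ext ξ
  ring

theorem integrable_kinetic {u : L2} (hu : MemHHalf u) :
    Integrable fun ξ : R3 => ((1 + ‖ξ‖ ^ 2) ^ (1 / 2 : ℝ) - 1) / 2 * ‖(𝓕 u : L2) ξ‖ ^ 2 := by
  refine (((integrable_symbol hu).sub (integrable_norm_sq (𝓕 u))).div_const 2).congr
    (Eventually.of_forall fun ξ => ?_)
  simp only [Pi.sub_apply]
  ring

theorem kinetic_nonneg {u : L2} (hu : MemHHalf u) : 0 ≤ kinetic u := by
  rw [kinetic_eq hu]
  refine integral_nonneg fun ξ => ?_
  have := one_le_symbol ξ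
  exact mul_nonneg (by linarith) (by positivity)

theorem rpow_le_add_symbol {s κ : ℝ} (hs : 0 < s) (hs' : s ≤ 1) (hκ : 0 < κ) (ξ : R3) :
    ‖ξ‖ ^ s ≤ κ ^ s + κ ^ (s - 1) * (1 + ‖ξ‖ ^ 2) ^ (1 / 2 : ℝ) := by
  have h1 := one_le_symbol ξ
  rcases le_total ‖ξ‖ κ with h | h
  · have : ‖ξ‖ ^ s ≤ κ ^ s := Real.rpow_le_rpow (norm_nonneg _) h hs.le
    have : 0 ≤ κ ^ (s - 1) * (1 + ‖ξ‖ ^ 2) ^ (1 / 2 : ℝ) := by positivity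
    linarith
  · have hξ : 0 < ‖ξ‖ := hκ.trans_le h
    have h2 : ‖ξ‖ ^ s = ‖ξ‖ ^ (s - 1) * ‖ξ‖ := by
      rw [← Real.rpow_add_one hξ.ne', sub_add_cancel]
    have h3 : ‖ξ‖ ^ (s - 1) ≤ κ ^ (s - 1) := Real.rpow_le_rpow_of_nonpos hκ h (by linarith)
    have h4 : ‖ξ‖ ^ (s - 1) * ‖ξ‖ ≤ κ ^ (s - 1) * (1 + ‖ξ‖ ^ 2) ^ (1 / 2 : ℝ) :=
      mul_le_mul h3 (norm_le_symbol ξ) hξ.le (by positivity)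
    have : 0 ≤ κ ^ s := by positivity
    linarith

/-- With j = √(1+|ξ|²), the relation (j-1)(j+1) = |ξ|² gives j-1 ≥ |ξ|²/3 for |ξ| ≤ 1 and j-1 ≥
|ξ|/3 for |ξ| ≥ 1. The three ranges |ξ| ≤ κ, κ ≤ |ξ| ≤ 1 and |ξ| ≥ 1 follow. The power κ^(s-2),
rather than κ^(s-1), reflects the quadratic behaviour of j-1 at low frequency. -/
theorem rpow_le_add_kinetic {s κ : ℝ} (hs : 0 < s) (hs' : s ≤ 1) (hκ : 0 < κ) (hκ' : κ ≤ 1)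
    (ξ : R3) :
    ‖ξ‖ ^ s ≤ κ ^ s + 6 * κ ^ (s - 2) * (((1 + ‖ξ‖ ^ 2) ^ (1 / 2 : ℝ) - 1) / 2) := by
  have h1 := one_le_symbol ξ
  have h5 := symbol_sub_one_mul ξ
  have h6 := symbol_le_one_add ξ
  set j := (1 + ‖ξ‖ ^ 2) ^ (1 / 2 : ℝ) with hj
  have h0 : 0 ≤ κ ^ s := by positivity
  have h00 : 0 < κ ^ (s - 2) := by positivity
  rcases le_total ‖ξ‖ κ with h | h
  · have : ‖ξ‖ ^ s ≤ κ ^ s := Real.rpow_le_rpow (norm_nonneg _) h hs.le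
    have : 0 ≤ 6 * κ ^ (s - 2) * ((j - 1) / 2) := mul_nonneg (by positivity) (by linarith)
    linarith
  · have hξ : 0 < ‖ξ‖ := hκ.trans_le h
    have key : ‖ξ‖ ^ s ≤ κ ^ (s - 2) * (3 * (j - 1)) := by
      rcases le_total ‖ξ‖ 1 with h7 | h7
      · have h2 : ‖ξ‖ ^ s = ‖ξ‖ ^ (s - 2) * ‖ξ‖ ^ 2 := by
          rw [← Real.rpow_natCast, ← Real.rpow_add hξ]
          norm_num
        have h3 : ‖ξ‖ ^ (s - 2) ≤ κ ^ (s - 2) := Real.rpow_le_rpow_of_nonpos hκ h (by linarith)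
        rw [h2]
        exact mul_le_mul h3 (by nlinarith) (by positivity) (by positivity)
      · have h2 : ‖ξ‖ ^ s ≤ ‖ξ‖ := by
          simpa using Real.rpow_le_rpow_of_exponent_le h7 hs'
        have h3 : 1 ≤ κ ^ (s - 2) := Real.one_le_rpow_of_pos_of_le_one_of_nonpos hκ hκ'
          (by linarith)
        have h4 : ‖ξ‖ ≤ 3 * (j - 1) := by nlinarith
        nlinarith
    linarith

theorem integrable_rpow {p : ℝ} (hp : 2 < p) (hp' : p ≤ 8 / 3) {u : L2} (hu : MemHHalf u) :
    Integrable (fun x => ‖u x‖ ^ p) := by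
  refine (gagliardo_nirenberg_of_weight hp u (w := fun ξ => (1 : ℝ) ^ (3 * (p - 2) / 2) *
    ‖(𝓕 u : L2) ξ‖ ^ 2 + (1 : ℝ) ^ (3 * (p - 2) / 2 - 1) * ((1 + ‖ξ‖ ^ 2) ^ (1 / 2 : ℝ) *
    ‖(𝓕 u : L2) ξ‖ ^ 2)) (Eventually.of_forall fun ξ => ?_)
    (((integrable_norm_sq _).const_mul _).add ((integrable_symbol hu).const_mul _))).1
  have := mul_le_mul_of_nonneg_right (rpow_le_add_symbol (s := 3 * (p - 2) / 2) (by linarith)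
    (by linarith) one_pos ξ) (sq_nonneg ‖(𝓕 u : L2) ξ‖)
  linarith

theorem powerIntegral_le_sobolev {p : ℝ} (hp : 2 < p) (hp' : p ≤ 8 / 3) {u : L2}
    (hu : MemHHalf u) {κ : ℝ} (hκ : 0 < κ) :
    powerIntegral p u ≤ gnConst p * ‖u‖ ^ (p - 2) * (κ ^ (3 * (p - 2) / 2) * ‖u‖ ^ 2
      + κ ^ (3 * (p - 2) / 2 - 1) * sobolevNorm (1 / 2) u ^ 2) := by
  have h := (gagliardo_nirenberg_of_weight hp u (w := fun ξ => κ ^ (3 * (p - 2) / 2) *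
    ‖(𝓕 u : L2) ξ‖ ^ 2 + κ ^ (3 * (p - 2) / 2 - 1) * ((1 + ‖ξ‖ ^ 2) ^ (1 / 2 : ℝ) *
    ‖(𝓕 u : L2) ξ‖ ^ 2)) (Eventually.of_forall fun ξ => ?_)
    (((integrable_norm_sq _).const_mul _).add ((integrable_symbol hu).const_mul _))).2
  · rwa [integral_add ((integrable_norm_sq _).const_mul _) ((integrable_symbol hu).const_mul _),
      integral_const_mul, integral_const_mul, ← norm_sq_fourier, ← sobolevNorm_sq] at h
  · have := mul_le_mul_of_nonneg_right (rpow_le_add_symbol (s := 3 * (p - 2) / 2) (by linarith)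
      (by linarith) hκ ξ) (sq_nonneg ‖(𝓕 u : L2) ξ‖)
    linarith

theorem powerIntegral_le_kinetic {p : ℝ} (hp : 2 < p) (hp' : p ≤ 8 / 3) {u : L2}
    (hu : MemHHalf u) {κ : ℝ} (hκ : 0 < κ) (hκ' : κ ≤ 1) :
    powerIntegral p u ≤ gnConst p * ‖u‖ ^ (p - 2) * (κ ^ (3 * (p - 2) / 2) * ‖u‖ ^ 2
      + 6 * κ ^ (3 * (p - 2) / 2 - 2) * kinetic u) := by
  have h := (gagliardo_nirenberg_of_weight hp u (w := fun ξ => κ ^ (3 * (p - 2) / 2) *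
    ‖(𝓕 u : L2) ξ‖ ^ 2 + 6 * κ ^ (3 * (p - 2) / 2 - 2) * (((1 + ‖ξ‖ ^ 2) ^ (1 / 2 : ℝ) - 1) / 2 *
    ‖(𝓕 u : L2) ξ‖ ^ 2)) (Eventually.of_forall fun ξ => ?_)
    (((integrable_norm_sq _).const_mul _).add ((integrable_kinetic hu).const_mul _))).2
  · rwa [integral_add ((integrable_norm_sq _).const_mul _) ((integrable_kinetic hu).const_mul _),
      integral_const_mul, integral_const_mul, ← norm_sq_fourier, ← kinetic_eq hu] at h
  · have := mul_le_mul_of_nonneg_right (rpow_le_add_kinetic (s := 3 * (p - 2) / 2) (by linarith)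
      (by linarith) hκ hκ' ξ) (sq_nonneg ‖(𝓕 u : L2) ξ‖)
    linarith

theorem norm_highpass_le (R : ℝ) (u : L2) : ‖highpass R u‖ ≤ ‖u‖ := by
  refine le_of_sq_le_sq ?_ (norm_nonneg _)
  rw [norm_sq_fourier, norm_sq_fourier, fourier_highpass]
  refine integral_mono_ae (integrable_norm_sq _) (integrable_norm_sq _) ?_
  filter_upwards [coeFn_cutoff R (𝓕 u)] with ξ hξ
  rw [hξ]
  gcongr
  exact norm_indicator_le_norm_self _ _

/-- For |ξ| ≥ R, |ξ|^s ≤ R^(s-1)|ξ|. When p < 8/3 the exponent s-1 is negative, so high frequencies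
contribute little to the power integral, uniformly on bounded sets of H^{1/2}. -/
theorem powerIntegral_highpass_le {p : ℝ} (hp : 2 < p) (hp' : p ≤ 8 / 3) {u : L2}
    (hu : MemHHalf u) {R : ℝ} (hR : 0 < R) :
    Integrable (fun x => ‖highpass R u x‖ ^ p) ∧
    powerIntegral p (highpass R u) ≤ gnConst p * ‖u‖ ^ (p - 2) *
      (R ^ (3 * (p - 2) / 2 - 1) * sobolevNorm (1 / 2) u ^ 2) := by
  have h := gagliardo_nirenberg_of_weight hp (highpass R u)
    (w := fun ξ => R ^ (3 * (p - 2) / 2 - 1) * ((1 + ‖ξ‖ ^ 2) ^ (1 / 2 : ℝ) *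
    ‖(𝓕 u : L2) ξ‖ ^ 2)) ?_ ((integrable_symbol hu).const_mul _)
  · refine ⟨h.1, h.2.trans ?_⟩
    rw [integral_const_mul, ← sobolevNorm_sq]
    have := gnConst_pos hp
    gcongr
    exact norm_highpass_le R u
  · filter_upwards [coeFn_cutoff R (𝓕 u)] with ξ hξ
    rw [fourier_highpass, hξ]
    by_cases hb : ξ ∈ (Metric.ball (0 : R3) R)ᶜ
    · rw [Set.indicator_of_mem hb, ← mul_assoc]
      refine mul_le_mul_of_nonneg_right ?_ (by positivity)
      have hR' : R ≤ ‖ξ‖ := by simpa using hb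
      have hξ0 : 0 < ‖ξ‖ := hR.trans_le hR'
      have h2 : ‖ξ‖ ^ (3 * (p - 2) / 2) = ‖ξ‖ ^ (3 * (p - 2) / 2 - 1) * ‖ξ‖ := by
        rw [← Real.rpow_add_one hξ0.ne', sub_add_cancel]
      rw [h2]
      exact mul_le_mul (Real.rpow_le_rpow_of_nonpos hR hR' (by linarith)) (norm_le_symbol ξ)
        hξ0.le (by positivity)
    · rw [Set.indicator_of_notMem hb]
      simp
      positivity

/-! ### Bounds for the Coulomb energy. -/

/-- The square of the Coulomb kernel, restricted to a ball. -/
def kernelSq (δ : ℝ) : R3 → ℝ := (Metric.ball (0 : R3) δ).indicator fun z => (‖z‖ ^ 2)⁻¹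

theorem kernelSq_nonneg (δ : ℝ) (z : R3) : 0 ≤ kernelSq δ z :=
  Set.indicator_nonneg (fun _ _ => by positivity) _

theorem integrable_kernelSq (δ : ℝ) : Integrable (kernelSq δ) := by
  refine (integrable_indicator_iff measurableSet_ball).2
    (integrableOn_ball_of_norm_le_rpow (C := 1) (α := 2) ?_ ?_ ?_ ?_)
  · simp
  · norm_num
  · refine Eventually.of_forall fun z => ?_
    rw [Real.rpow_neg (norm_nonneg _), one_mul]
    norm_num
  · exact (measurable_norm.pow_const 2).inv.aestronglyMeasurable

/-- The integral of the square of the Coulomb kernel over the unit ball. -/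
def kernelConst : ℝ := ∫ z, kernelSq 1 z

theorem kernelConst_nonneg : 0 ≤ kernelConst := integral_nonneg (kernelSq_nonneg 1)

theorem integral_kernelSq {δ : ℝ} (hδ : 0 < δ) : ∫ z, kernelSq δ z = δ * kernelConst := by
  rw [integral_eq_of_comp_dil (F := kernelSq δ) (fun z => (δ ^ 2)⁻¹ * kernelSq 1 z)
    (inv_pos.2 hδ), integral_const_mul, ← kernelConst, smul_eq_mul, inv_pow, inv_inv]
  · field_simp
  · refine Eventually.of_forall fun z => ?_
    simp only [kernelSq]
    by_cases hz : z ∈ Metric.ball (0 : R3) δ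
    · have hz' : δ⁻¹ • z ∈ Metric.ball (0 : R3) 1 := by
        rw [mem_ball_zero_iff] at hz ⊢
        rw [norm_smul, Real.norm_eq_abs, abs_of_pos (inv_pos.2 hδ), inv_mul_lt_iff₀ hδ, mul_one]
        exact hz
      rw [Set.indicator_of_mem hz, Set.indicator_of_mem hz', norm_smul, Real.norm_eq_abs,
        abs_of_pos (inv_pos.2 hδ), mul_pow, mul_inv, inv_pow, inv_inv,
        inv_mul_cancel_left₀ (by positivity)]
    · have hz' : δ⁻¹ • z ∉ Metric.ball (0 : R3) 1 := by
        rw [mem_ball_zero_iff] at hz ⊢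
        rw [norm_smul, Real.norm_eq_abs, abs_of_pos (inv_pos.2 hδ), inv_mul_lt_iff₀ hδ, mul_one]
        exact hz
      rw [Set.indicator_of_notMem hz, Set.indicator_of_notMem hz', mul_zero]

/-- The shear (x, y) ↦ (x, x-y) is a measure-preserving involution and turns the integrand into a
product. -/
theorem integrable_mul_comp_sub {f k : R3 → ℝ} (hf : Integrable f) (hk : Integrable k) :
    Integrable (fun z : R3 × R3 => f z.1 * k (z.1 - z.2)) ∧
      ∫ z : R3 × R3, f z.1 * k (z.1 - z.2) = (∫ x, f x) * ∫ x, k x := by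
  have hmp : MeasurePreserving (fun z : R3 × R3 => (z.1, z.1 - z.2)) (volume.prod volume)
      (volume.prod volume) := by
    have h1 := measurePreserving_prod_neg_add (volume : Measure R3) (volume : Measure R3)
    have h2 := (MeasurePreserving.id (volume : Measure R3)).prod
      (Measure.measurePreserving_neg (volume : Measure R3))
    convert! h2.comp h1 using 1
    ext z : 1
    simp [Prod.map, sub_eq_add_neg, add_comm]
  have he : MeasurableEmbedding (fun z : R3 × R3 => (z.1, z.1 - z.2)) := by
    refine (MeasurableEquiv.measurableEmbedding
      ⟨⟨fun z : R3 × R3 => (z.1, z.1 - z.2), fun z => (z.1, z.1 - z.2), fun z => by simp,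
        fun z => by simp⟩, ?_, ?_⟩)
    · exact measurable_fst.prodMk (measurable_fst.sub measurable_snd)
    · exact measurable_fst.prodMk (measurable_fst.sub measurable_snd)
  exact ⟨(hmp.integrable_comp_emb he).2 (hf.mul_prod hk),
    (hmp.integral_comp he (fun z : R3 × R3 => f z.1 * k z.2)).trans (integral_prod_mul f k)⟩

theorem integrable_mul_comp_sub' {f k : R3 → ℝ} (hf : Integrable f) (hk : Integrable k)
    (hsymm : ∀ z, k (-z) = k z) :
    Integrable (fun z : R3 × R3 => f z.2 * k (z.1 - z.2)) ∧
      ∫ z : R3 × R3, f z.2 * k (z.1 - z.2) = (∫ x, f x) * ∫ x, k x := by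
  have h := integrable_mul_comp_sub hf hk
  have he : (fun z : R3 × R3 => f z.2 * k (z.1 - z.2))
      = (fun z : R3 × R3 => f z.1 * k (z.1 - z.2)) ∘ Prod.swap := by
    ext z
    simp only [Function.comp_apply, Prod.fst_swap, Prod.snd_swap]
    rw [← hsymm, neg_sub]
  constructor
  · rw [he]
    exact h.1.swap
  · rw [← h.2, he]
    exact integral_prod_swap (μ := (volume : Measure R3)) (ν := (volume : Measure R3))
      (fun z : R3 × R3 => f z.1 * k (z.1 - z.2))

/-- Outside the ball of radius δ the kernel is at most 1/δ. Inside, with A = a^{1/3}, B = b^{1/3}, k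
= 1/|z|, the term A³B³k is bounded by two completed squares, one comparing ηA²B² with ABk and one
comparing A² with B². -/
theorem coulomb_kernel_pointwise {a b δ η : ℝ} (ha : 0 ≤ a) (hb : 0 ≤ b) (hδ : 0 < δ)
    (hη : 0 < η) (z : R3) :
    a * b / ‖z‖ ≤ δ⁻¹ * (a * b) + (η / 2 * (a ^ (4 / 3 : ℝ) * b ^ (4 / 3 : ℝ))
      + 1 / (4 * η) * (a ^ (4 / 3 : ℝ) * kernelSq δ z + b ^ (4 / 3 : ℝ) * kernelSq δ z)) := by
  have hk := kernelSq_nonneg δ z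
  by_cases hz : z ∈ Metric.ball (0 : R3) δ
  · have hkz : kernelSq δ z = (‖z‖⁻¹) ^ 2 := by
      rw [kernelSq, Set.indicator_of_mem hz, inv_pow]
    have pw : ∀ t : ℝ, 0 ≤ t → t = (t ^ (1 / 3 : ℝ)) ^ 3 ∧
        t ^ (4 / 3 : ℝ) = (t ^ (1 / 3 : ℝ)) ^ 4 := fun t ht => by
      constructor
      · rw [← Real.rpow_natCast, ← Real.rpow_mul ht]
        norm_num
      · rw [← Real.rpow_natCast, ← Real.rpow_mul ht]
        norm_num
    rw [(pw a ha).2, (pw b hb).2, hkz]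
    have hab : 0 ≤ δ⁻¹ * (a * b) := by positivity
    refine le_trans ?_ (le_add_of_nonneg_left hab)
    rw [div_eq_mul_inv]
    nth_rewrite 1 [(pw a ha).1]
    nth_rewrite 1 [(pw b hb).1]
    set A := a ^ (1 / 3 : ℝ)
    set B := b ^ (1 / 3 : ℝ)
    set k := ‖z‖⁻¹
    have h1 : η / 2 * (A ^ 4 * B ^ 4) + 1 / (4 * η) * (A ^ 4 * k ^ 2 + B ^ 4 * k ^ 2)
        - A ^ 3 * B ^ 3 * k = 1 / (2 * η) * ((η * A ^ 2 * B ^ 2 - A * B * k) ^ 2)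
          + 1 / (4 * η) * (k ^ 2 * (A ^ 2 - B ^ 2) ^ 2) := by
      field_simp
      ring
    have h2 : 0 ≤ 1 / (2 * η) * ((η * A ^ 2 * B ^ 2 - A * B * k) ^ 2)
          + 1 / (4 * η) * (k ^ 2 * (A ^ 2 - B ^ 2) ^ 2) := by positivity
    linarith
  · have hz' : δ ≤ ‖z‖ := by simpa using hz
    have h1 : a * b / ‖z‖ ≤ δ⁻¹ * (a * b) := by
      rw [div_eq_inv_mul]
      gcongr
    have h2 : 0 ≤ η / 2 * (a ^ (4 / 3 : ℝ) * b ^ (4 / 3 : ℝ))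
      + 1 / (4 * η) * (a ^ (4 / 3 : ℝ) * kernelSq δ z + b ^ (4 / 3 : ℝ) * kernelSq δ z) := by
      positivity
    linarith

/-- Plays the role of the Hardy-Littlewood-Sobolev inequality, for densities in L¹ ∩ L^{4/3}. The
free parameters serve twice: tuned to the mass they give the size ρ²κ, and taken small they make the
mixed terms vanish in the limit. -/
theorem coulomb_bound {f g : R3 → ℝ} (hf0 : ∀ x, 0 ≤ f x) (hg0 : ∀ x, 0 ≤ g x)
    (hf : Integrable f) (hg : Integrable g) (hf' : Integrable fun x => f x ^ (4 / 3 : ℝ))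
    (hg' : Integrable fun x => g x ^ (4 / 3 : ℝ)) :
    Integrable (fun z : R3 × R3 => f z.1 * g z.2 / ‖z.1 - z.2‖) ∧
    ∀ δ η : ℝ, 0 < δ → 0 < η → ∫ z : R3 × R3, f z.1 * g z.2 / ‖z.1 - z.2‖ ≤
      δ⁻¹ * ((∫ x, f x) * ∫ x, g x) +
      (η / 2 * ((∫ x, f x ^ (4 / 3 : ℝ)) * ∫ x, g x ^ (4 / 3 : ℝ)) +
      1 / (4 * η) * ((∫ x, f x ^ (4 / 3 : ℝ)) * (δ * kernelConst)
        + (∫ x, g x ^ (4 / 3 : ℝ)) * (δ * kernelConst))) := by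
  have hsymm : ∀ δ z, kernelSq δ (-z) = kernelSq δ z := fun δ z => by
    classical simp [kernelSq, Set.indicator_apply]
  have hmaj : ∀ δ η : ℝ, Integrable fun z : R3 × R3 => δ⁻¹ * (f z.1 * g z.2) +
      (η / 2 * (f z.1 ^ (4 / 3 : ℝ) * g z.2 ^ (4 / 3 : ℝ)) +
      1 / (4 * η) * (f z.1 ^ (4 / 3 : ℝ) * kernelSq δ (z.1 - z.2)
        + g z.2 ^ (4 / 3 : ℝ) * kernelSq δ (z.1 - z.2))) := fun δ η =>
    ((hf.mul_prod hg).const_mul _).add (((hf'.mul_prod hg').const_mul _).add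
      (((integrable_mul_comp_sub hf' (integrable_kernelSq δ)).1.add
        (integrable_mul_comp_sub' hg' (integrable_kernelSq δ) (hsymm δ)).1).const_mul _))
  have hint : Integrable (fun z : R3 × R3 => f z.1 * g z.2 / ‖z.1 - z.2‖) := by
    refine (hmaj 1 1).mono' ?_ (Eventually.of_forall fun z => ?_)
    · refine AEStronglyMeasurable.mul (hf.mul_prod hg).aestronglyMeasurable ?_
      exact (Measurable.aestronglyMeasurable (by fun_prop))
    · rw [Real.norm_eq_abs, abs_of_nonneg
        (div_nonneg (mul_nonneg (hf0 _) (hg0 _)) (norm_nonneg _))]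
      exact coulomb_kernel_pointwise (hf0 _) (hg0 _) one_pos one_pos _
  refine ⟨hint, fun δ η hδ hη => ?_⟩
  refine (integral_mono hint (hmaj δ η)
    fun z => coulomb_kernel_pointwise (hf0 _) (hg0 _) hδ hη _).trans_eq ?_
  have i1 := (hf.mul_prod hg).const_mul δ⁻¹
  have i2 := (hf'.mul_prod hg').const_mul (η / 2)
  have i3 := integrable_mul_comp_sub hf' (integrable_kernelSq δ)
  have i4 := integrable_mul_comp_sub' hg' (integrable_kernelSq δ) (hsymm δ)
  have e1 := integral_add i1 (i2.add ((i3.1.add i4.1).const_mul (1 / (4 * η))))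
  have e2 := integral_add i2 ((i3.1.add i4.1).const_mul (1 / (4 * η)))
  have e3 := integral_add i3.1 i4.1
  refine e1.trans ?_
  refine congrArg₂ _ ?_ (e2.trans (congrArg₂ _ ?_ ?_))
  · rw [integral_const_mul]
    congr 1
    exact integral_prod_mul f g
  · rw [integral_const_mul]
    congr 1
    exact integral_prod_mul (fun x => f x ^ (4 / 3 : ℝ)) (fun x => g x ^ (4 / 3 : ℝ))
  · refine (integral_const_mul _ _).trans ?_
    congr 1
    refine e3.trans ?_
    rw [i3.2, i4.2, integral_kernelSq hδ]

theorem sq_rpow_four_thirds {t : ℝ} (ht : 0 ≤ t) : (t ^ 2) ^ (4 / 3 : ℝ) = t ^ (8 / 3 : ℝ) := by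
  rw [← Real.rpow_natCast, ← Real.rpow_mul ht]
  norm_num

theorem integrable_density {u : L2} (hu : MemHHalf u) :
    Integrable fun x => (‖u x‖ ^ 2) ^ (4 / 3 : ℝ) := by
  simp_rw [sq_rpow_four_thirds (norm_nonneg _)]
  exact integrable_rpow (by norm_num) le_rfl hu

theorem integrable_coulombIntegrand {u : L2} (hu : MemHHalf u) :
    Integrable (coulombIntegrand u) :=
  (coulomb_bound (fun x => sq_nonneg ‖u x‖) (fun x => sq_nonneg ‖u x‖) (integrable_norm_sq u)
    (integrable_norm_sq u) (integrable_density hu) (integrable_density hu)).1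

theorem coulomb_nonneg (u : L2) : 0 ≤ coulomb u :=
  integral_nonneg fun z => by unfold coulombIntegrand; positivity

theorem coulomb_le {u : L2} (hu : MemHHalf u) {δ η : ℝ} (hδ : 0 < δ) (hη : 0 < η) :
    coulomb u ≤ δ⁻¹ * ‖u‖ ^ 4 + η / 2 * powerIntegral (8 / 3) u ^ 2
      + 1 / (2 * η) * δ * kernelConst * powerIntegral (8 / 3) u := by
  have h := (coulomb_bound (fun x => sq_nonneg ‖u x‖) (fun x => sq_nonneg ‖u x‖)
    (integrable_norm_sq u) (integrable_norm_sq u) (integrable_density hu)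
    (integrable_density hu)).2 δ η hδ hη
  simp_rw [sq_rpow_four_thirds (norm_nonneg _)] at h
  rw [← norm_sq_eq_integral, ← powerIntegral] at h
  refine (show coulomb u ≤ _ from h).trans_eq ?_
  field_simp
  ring

/-! ### Each term of the energy under multiples, translations and dilations. -/

instance isAddHaarMeasure_volume_prod : (volume : Measure (R3 × R3)).IsAddHaarMeasure :=
  inferInstanceAs ((volume : Measure R3).prod volume).IsAddHaarMeasure

theorem coulombIntegrand_ae_eq {v : L2} {f : R3 → ℝ} (h : ∀ᵐ x, ‖v x‖ ^ 2 = f x) :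
    coulombIntegrand v =ᵐ[volume] fun z => f z.1 * f z.2 / ‖z.1 - z.2‖ := by
  filter_upwards [(Measure.quasiMeasurePreserving_fst (μ := (volume : Measure R3))
    (ν := (volume : Measure R3))).ae h, (Measure.quasiMeasurePreserving_snd
    (μ := (volume : Measure R3)) (ν := (volume : Measure R3))).ae h] with z h1 h2
  rw [coulombIntegrand, h1, h2]

theorem coulomb_eq_of_ae {v : L2} {f : R3 → ℝ} (h : ∀ᵐ x, ‖v x‖ ^ 2 = f x) :
    coulomb v = ∫ z : R3 × R3, f z.1 * f z.2 / ‖z.1 - z.2‖ :=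
  integral_congr_ae (coulombIntegrand_ae_eq h)

theorem memHHalf_smul {u : L2} (hu : MemHHalf u) (c : ℂ) : MemHHalf (c • u) := by
  rw [memHHalf_iff_integrable] at hu ⊢
  rw [FourierTransform.fourier_smul]
  refine (hu.const_mul (‖c‖ ^ 2)).congr ?_
  filter_upwards [Lp.coeFn_smul c (𝓕 u : L2)] with ξ hξ
  rw [hξ, Pi.smul_apply, norm_smul]
  ring

theorem sobolevNorm_smul_sq (s : ℝ) (u : L2) (c : ℂ) :
    sobolevNorm s (c • u) ^ 2 = ‖c‖ ^ 2 * sobolevNorm s u ^ 2 := by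
  rw [sobolevNorm_sq, sobolevNorm_sq, ← integral_const_mul, FourierTransform.fourier_smul]
  refine integral_congr_ae ?_
  filter_upwards [Lp.coeFn_smul c (𝓕 u : L2)] with ξ hξ
  rw [hξ, Pi.smul_apply, norm_smul]
  ring

theorem kinetic_smul (u : L2) (c : ℂ) : kinetic (c • u) = ‖c‖ ^ 2 * kinetic u := by
  rw [kinetic, sobolevNorm_smul_sq, norm_smul, kinetic]
  ring

theorem coulomb_smul (u : L2) (c : ℂ) : coulomb (c • u) = ‖c‖ ^ 4 * coulomb u := by
  rw [coulomb_eq_of_ae (f := fun x => ‖c‖ ^ 2 * ‖u x‖ ^ 2), coulomb, ← integral_const_mul]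
  · congr 1
    ext z
    rw [coulombIntegrand]
    ring
  · filter_upwards [Lp.coeFn_smul c u] with x hx
    rw [hx, Pi.smul_apply, norm_smul]
    ring

theorem powerIntegral_smul (p : ℝ) (u : L2) (c : ℂ) :
    powerIntegral p (c • u) = ‖c‖ ^ p * powerIntegral p u := by
  rw [powerIntegral, powerIntegral, ← integral_const_mul]
  refine integral_congr_ae ?_
  filter_upwards [Lp.coeFn_smul c u] with x hx
  rw [hx, Pi.smul_apply, norm_smul, Real.mul_rpow (norm_nonneg _) (norm_nonneg _)]

theorem memHHalf_translate {u : L2} (hu : MemHHalf u) (τ : R3) : MemHHalf (translate τ u) := by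
  rw [memHHalf_iff_integrable] at hu ⊢
  refine hu.congr ?_
  filter_upwards [norm_fourier_translate τ u] with ξ hξ
  rw [hξ]

theorem sobolevNorm_translate (s : ℝ) (τ : R3) (u : L2) :
    sobolevNorm s (translate τ u) = sobolevNorm s u := by
  rw [sobolevNorm, sobolevNorm]
  congr 1
  refine integral_congr_ae ?_
  filter_upwards [norm_fourier_translate τ u] with ξ hξ
  rw [hξ]

theorem norm_translate (τ : R3) (u : L2) : ‖translate τ u‖ = ‖u‖ :=
  Lp.norm_compMeasurePreserving _ _

theorem powerIntegral_translate (p : ℝ) (τ : R3) (u : L2) :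
    powerIntegral p (translate τ u) = powerIntegral p u := by
  rw [powerIntegral, powerIntegral, ← integral_add_right_eq_self (fun x => ‖u x‖ ^ p) τ]
  refine integral_congr_ae ?_
  filter_upwards [coeFn_translate τ u] with x hx
  rw [hx]

theorem coulomb_translate (τ : R3) (u : L2) : coulomb (translate τ u) = coulomb u := by
  rw [coulomb_eq_of_ae (f := fun x => ‖u (x + τ)‖ ^ 2), coulomb,
    ← integral_add_right_eq_self (coulombIntegrand u) ((τ, τ) : R3 × R3)]
  · congr 1
    ext z
    simp [coulombIntegrand]
  · filter_upwards [coeFn_translate τ u] with x hx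
    rw [hx]

theorem kinetic_translate (τ : R3) (u : L2) : kinetic (translate τ u) = kinetic u := by
  rw [kinetic, sobolevNorm_translate, norm_translate, kinetic]

theorem norm_sq_dil_ae (c : ℝ) (hc : 0 < c) (u : L2) :
    ∀ᵐ x, ‖dil c hc u x‖ ^ 2 = c ^ 3 * ‖u (c • x)‖ ^ 2 := by
  filter_upwards [coeFn_dil c hc u] with x hx
  rw [hx, norm_mul, Complex.norm_real, Real.norm_eq_abs, abs_of_nonneg (by positivity), mul_pow,
    ← Real.rpow_mul_natCast hc.le]
  congr 1
  rw [← Real.rpow_natCast]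
  norm_num

theorem norm_dil_sq (c : ℝ) (hc : 0 < c) (u : L2) : ‖dil c hc u‖ ^ 2 = ‖u‖ ^ 2 := by
  rw [norm_sq_eq_integral, integral_eq_of_comp_dil (fun x => c ^ 3 * ‖u x‖ ^ 2) hc
    (norm_sq_dil_ae c hc u), integral_const_mul, ← norm_sq_eq_integral, smul_eq_mul,
    inv_mul_cancel_left₀ (by positivity)]

theorem powerIntegral_dil (p : ℝ) (c : ℝ) (hc : 0 < c) (u : L2) :
    powerIntegral p (dil c hc u) = c ^ (3 * (p - 2) / 2) * powerIntegral p u := by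
  rw [powerIntegral, integral_eq_of_comp_dil (fun x => c ^ (3 / 2 * p) * ‖u x‖ ^ p) hc,
    integral_const_mul, ← powerIntegral, smul_eq_mul, ← mul_assoc]
  · congr 1
    rw [← Real.rpow_natCast, ← Real.rpow_neg hc.le, ← Real.rpow_add hc]
    congr 1
    push_cast
    ring
  · filter_upwards [coeFn_dil c hc u] with x hx
    rw [hx, norm_mul, Complex.norm_real, Real.norm_eq_abs, abs_of_nonneg (by positivity),
      Real.mul_rpow (by positivity) (norm_nonneg _), ← Real.rpow_mul hc.le]

theorem coulomb_dil (c : ℝ) (hc : 0 < c) (u : L2) :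
    coulomb (dil c hc u) = c * coulomb u := by
  rw [coulomb_eq_of_ae (norm_sq_dil_ae c hc u)]
  have h := Measure.integral_comp_smul (volume : Measure (R3 × R3))
    (fun z => c ^ 7 * coulombIntegrand u z) c
  -- Six of the seven powers of c come from the two densities and one from the kernel. The change of
  -- variables on the six-dimensional product removes six.
  have h2 : ∫ z : R3 × R3, c ^ 3 * ‖u (c • z.1)‖ ^ 2 * (c ^ 3 * ‖u (c • z.2)‖ ^ 2) / ‖z.1 - z.2‖
      = ∫ z : R3 × R3, c ^ 7 * coulombIntegrand u (c • z) := by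
    congr 1
    ext z
    rw [coulombIntegrand, Prod.smul_fst, Prod.smul_snd, ← smul_sub, norm_smul, Real.norm_eq_abs,
      abs_of_pos hc]
    rcases eq_or_ne ‖z.1 - z.2‖ 0 with h0 | h0
    · simp [h0]
    · field_simp
  have h3 : Module.finrank ℝ (R3 × R3) = 6 := by
    rw [Module.finrank_prod, finrank_euclideanSpace_fin]
  rw [h2, h, h3, integral_const_mul, ← coulomb, abs_of_pos (by positivity), smul_eq_mul]
  field_simp

theorem integrand_dil_ae (s : ℝ) (c : ℝ) (hc : 0 < c) (u : L2) :
    (fun ξ : R3 => (1 + ‖ξ‖ ^ 2) ^ s * ‖(𝓕 (dil c hc u) : L2) ξ‖ ^ 2) =ᵐ[volume] fun ξ =>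
      (fun η : R3 => c⁻¹ ^ 3 * ((1 + (c * ‖η‖) ^ 2) ^ s * ‖(𝓕 u : L2) η‖ ^ 2)) (c⁻¹ • ξ) := by
  rw [fourier_dil]
  filter_upwards [norm_sq_dil_ae c⁻¹ (inv_pos.2 hc) (𝓕 u)] with ξ hξ
  rw [hξ, norm_smul, Real.norm_eq_abs, abs_of_pos (inv_pos.2 hc), mul_inv_cancel_left₀ hc.ne']
  ring

theorem sobolevNorm_dil_sq (s : ℝ) (c : ℝ) (hc : 0 < c) (u : L2) :
    sobolevNorm s (dil c hc u) ^ 2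
      = ∫ ξ : R3, (1 + (c * ‖ξ‖) ^ 2) ^ s * ‖(𝓕 u : L2) ξ‖ ^ 2 := by
  rw [sobolevNorm_sq, integral_eq_of_comp_dil
    (fun η : R3 => c⁻¹ ^ 3 * ((1 + (c * ‖η‖) ^ 2) ^ s * ‖(𝓕 u : L2) η‖ ^ 2))
    (inv_pos.2 hc) (integrand_dil_ae s c hc u),
    integral_const_mul, smul_eq_mul, inv_mul_cancel_left₀ (by positivity)]

theorem symbol_dil_le {c : ℝ} (hc : 0 ≤ c) (ξ : R3) :
    (1 + (c * ‖ξ‖) ^ 2) ^ (1 / 2 : ℝ) ≤ (1 + c) * (1 + ‖ξ‖ ^ 2) ^ (1 / 2 : ℝ) := by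
  rw [← Real.sqrt_eq_rpow, ← Real.sqrt_eq_rpow]
  refine Real.sqrt_le_iff.2 ⟨by positivity, ?_⟩
  rw [mul_pow, mul_pow, Real.sq_sqrt (by positivity)]
  nlinarith [sq_nonneg ‖ξ‖, mul_nonneg hc (sq_nonneg ‖ξ‖), sq_nonneg c]

theorem integrable_symbol_dil {u : L2} (hu : MemHHalf u) {c : ℝ} (hc : 0 ≤ c) :
    Integrable fun ξ : R3 => (1 + (c * ‖ξ‖) ^ 2) ^ (1 / 2 : ℝ) * ‖(𝓕 u : L2) ξ‖ ^ 2 := by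
  refine ((integrable_symbol hu).const_mul (1 + c)).mono' ?_ (Eventually.of_forall fun ξ => ?_)
  · refine AEStronglyMeasurable.mul (Measurable.aestronglyMeasurable (by fun_prop))
      (integrable_norm_sq _).aestronglyMeasurable
  · rw [Real.norm_eq_abs, abs_of_nonneg (by positivity), ← mul_assoc]
    exact mul_le_mul_of_nonneg_right (symbol_dil_le hc ξ) (by positivity)

theorem memHHalf_dil {u : L2} (hu : MemHHalf u) (c : ℝ) (hc : 0 < c) :
    MemHHalf (dil c hc u) := by
  rw [memHHalf_iff_integrable]
  refine Integrable.congr ?_ (integrand_dil_ae (1 / 2) c hc u).symm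
  exact ((integrable_symbol_dil hu hc.le).const_mul (c⁻¹ ^ 3)).comp_smul (inv_pos.2 hc).ne'

/-! ### The reduced energy and its coercivity. -/

/-- The energy, with the contribution of the mass removed. -/
def reducedEnergy (p α β : ℝ) (u : L2) : ℝ :=
  kinetic u + α * coulomb u - β * powerIntegral p u

theorem energy_eq (p α β : ℝ) (u : L2) :
    energy p α β u = reducedEnergy p α β u + ‖u‖ ^ 2 / 2 := by
  rw [energy, reducedEnergy, kinetic]
  ring

theorem mem_massSphere {ρ : ℝ} {u : L2} : u ∈ massSphere ρ ↔ MemHHalf u ∧ ‖u‖ ^ 2 = ρ := by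
  rw [norm_sq_eq_integral]
  rfl

theorem powerIntegral_nonneg (p : ℝ) (u : L2) : 0 ≤ powerIntegral p u :=
  integral_nonneg fun x => by positivity

theorem exists_mul_rpow_neg_le {s : ℝ} (hs : s < 0) {c ε : ℝ} (hε : 0 < ε) (κ₀ : ℝ) :
    ∃ κ : ℝ, 0 < κ ∧ κ₀ ≤ κ ∧ c * κ ^ s ≤ ε := by
  have h : Tendsto (fun κ : ℝ => c * κ ^ s) atTop (𝓝 (c * 0)) := by
    have := tendsto_rpow_neg_atTop (neg_pos.2 hs)
    rw [neg_neg] at this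
    exact this.const_mul c
  rw [mul_zero] at h
  obtain ⟨κ, h1, h2, h3⟩ := ((eventually_gt_atTop 0).and ((eventually_ge_atTop κ₀).and
    (h.eventually (gt_mem_nhds hε)))).exists
  exact ⟨κ, h1, h2, h3.le⟩

theorem norm_rpow_eq {ρ : ℝ} {u : L2} (hu : ‖u‖ ^ 2 = ρ) (q : ℝ) : ‖u‖ ^ q = ρ ^ (q / 2) := by
  rw [← hu, ← Real.rpow_natCast, ← Real.rpow_mul (norm_nonneg _)]
  congr 1
  push_cast
  ring

theorem coercive {p α β : ℝ} (hp : 2 < p) (hp' : p < 8 / 3) (hα : 0 < α) (hβ : 0 < β) (ρ : ℝ) :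
    ∃ K : ℝ, ∀ u : L2, MemHHalf u → ‖u‖ ^ 2 = ρ →
      sobolevNorm (1 / 2) u ^ 2 / 4 ≤ reducedEnergy p α β u + K := by
  -- For κ large, the Sobolev part of βP costs only a quarter of the squared norm, of which the
  -- kinetic term supplies a half.
  obtain ⟨κ, hκ, -, hκ'⟩ := exists_mul_rpow_neg_le (s := 3 * (p - 2) / 2 - 1) (by linarith)
    (c := β * (gnConst p * ρ ^ ((p - 2) / 2))) (ε := 1 / 4) (by norm_num) 0
  refine ⟨β * (gnConst p * ρ ^ ((p - 2) / 2)) * (κ ^ (3 * (p - 2) / 2) * ρ) + ρ / 2,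
    fun u hu hρ => ?_⟩
  have h := mul_le_mul_of_nonneg_left (powerIntegral_le_sobolev hp hp'.le hu hκ) hβ.le
  rw [norm_rpow_eq hρ, hρ] at h
  have h2 := mul_le_mul_of_nonneg_right hκ' (sq_nonneg (sobolevNorm (1 / 2) u))
  have h3 := mul_nonneg hα.le (coulomb_nonneg u)
  rw [reducedEnergy, kinetic, hρ]
  linarith

/-- The infimum of the reduced energy on the sphere of mass `ρ`. -/
def minReduced (p α β ρ : ℝ) : ℝ := sInf (reducedEnergy p α β '' massSphere ρ)

theorem bddBelow_reducedEnergy {p α β : ℝ} (hp : 2 < p) (hp' : p < 8 / 3) (hα : 0 < α)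
    (hβ : 0 < β) (ρ : ℝ) : BddBelow (reducedEnergy p α β '' massSphere ρ) := by
  obtain ⟨K, hK⟩ := coercive hp hp' hα hβ ρ
  refine ⟨-K, ?_⟩
  rintro _ ⟨u, hu, rfl⟩
  obtain ⟨hu1, hu2⟩ := mem_massSphere.1 hu
  have := hK u hu1 hu2
  have := sq_nonneg (sobolevNorm (1 / 2) u)
  linarith

theorem minReduced_le {p α β ρ : ℝ} (hp : 2 < p) (hp' : p < 8 / 3) (hα : 0 < α) (hβ : 0 < β)
    {u : L2} (hu : u ∈ massSphere ρ) : minReduced p α β ρ ≤ reducedEnergy p α β u :=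
  csInf_le (bddBelow_reducedEnergy hp hp' hα hβ ρ) ⟨u, hu, rfl⟩

theorem powerIntegral_pos {p : ℝ} (hp : 2 < p) (hp' : p ≤ 8 / 3) {u : L2} (hu : MemHHalf u)
    (h0 : u ≠ 0) : 0 < powerIntegral p u := by
  refine (powerIntegral_nonneg p u).lt_of_ne fun h => h0 ?_
  rw [powerIntegral, eq_comm, integral_eq_zero_iff_of_nonneg
    (fun x => by positivity) (integrable_rpow hp hp' hu)] at h
  rw [Lp.eq_zero_iff_ae_eq_zero]
  filter_upwards [h] with x hx
  have := (Real.rpow_eq_zero (norm_nonneg (u x)) (by linarith : p ≠ 0)).1 hx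
  simpa using this

/-! ### Small masses: trial functions, a priori bounds and strict subhomogeneity. -/

/-- A normalised function with frequencies in the unit ball. -/
theorem exists_bandlimited : ∃ w : L2, MemHHalf w ∧ ‖w‖ = 1 ∧
    ∀ (c : ℝ) (hc : 0 < c), kinetic (dil c hc w) ≤ c ^ 2 / 4 := by
  -- The plane wave at the origin is constant, so this is the indicator of the unit ball.
  set g : L2 := wave 1 0 with hg
  have hg0 : ‖g‖ ≠ 0 := by
    intro h
    have := norm_wave_sq 1 0
    rw [← hg, h] at this
    have h2 : 0 < volume.real (Metric.ball (0 : R3) 1) :=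
      ENNReal.toReal_pos (Metric.measure_ball_pos _ _ one_pos).ne' measure_ball_lt_top.ne
    rw [← this] at h2
    norm_num at h2
  set G : L2 := ((‖g‖⁻¹ : ℝ) : ℂ) • g with hG
  have hGn : ‖G‖ = 1 := by
    rw [hG, norm_smul, Complex.norm_real, norm_inv, norm_norm, inv_mul_cancel₀ hg0]
  have hsupp : ∀ᵐ ξ, 1 ≤ ‖ξ‖ → G ξ = 0 := by
    filter_upwards [Lp.coeFn_smul ((‖g‖⁻¹ : ℝ) : ℂ) g, coeFn_wave 1 0] with ξ h1 h2 h3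
    rw [h1, Pi.smul_apply, h2, waveFun, Set.indicator_of_notMem (by simpa using h3), smul_zero]
  have hF : (𝓕 (𝓕⁻ G : L2) : L2) = G := FourierTransform.fourier_fourierInv_eq _
  have hH : MemHHalf (𝓕⁻ G : L2) := by
    rw [memHHalf_iff_integrable, hF]
    refine ((integrable_norm_sq G).const_mul 2).mono' ?_ ?_
    · exact AEStronglyMeasurable.mul (Measurable.aestronglyMeasurable (by fun_prop))
        (integrable_norm_sq _).aestronglyMeasurable
    · filter_upwards [hsupp] with ξ hξ
      rw [Real.norm_eq_abs, abs_of_nonneg (by positivity)]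
      rcases le_or_gt 1 ‖ξ‖ with h | h
      · simp [hξ h]
      · refine mul_le_mul_of_nonneg_right ?_ (by positivity)
        linarith [symbol_le_one_add ξ]
  have hn : ‖(𝓕⁻ G : L2)‖ = 1 := by
    rw [← Lp.norm_fourier_eq, hF, hGn]
  refine ⟨𝓕⁻ G, hH, hn, fun c hc => ?_⟩
  have h1 : sobolevNorm (1 / 2) (dil c hc (𝓕⁻ G)) ^ 2 ≤ (1 + c ^ 2 / 2) := by
    rw [sobolevNorm_dil_sq, hF]
    have h2 : 1 + c ^ 2 / 2 = ∫ ξ, (1 + c ^ 2 / 2) * ‖G ξ‖ ^ 2 := by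
      rw [integral_const_mul, ← norm_sq_eq_integral, hGn]
      ring
    rw [h2]
    have hi := integrable_symbol_dil hH hc.le
    rw [hF] at hi
    refine integral_mono_ae hi ((integrable_norm_sq _).const_mul _) ?_
    filter_upwards [hsupp] with ξ hξ
    rcases le_or_gt 1 ‖ξ‖ with h | h
    · simp [hξ h]
    · refine mul_le_mul_of_nonneg_right ?_ (by positivity)
      have h3 := symbol_sub_one_le (c • ξ)
      rw [norm_smul, Real.norm_eq_abs, abs_of_pos hc] at h3
      have h4 : (c * ‖ξ‖) ^ 2 ≤ c ^ 2 := by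
        rw [mul_pow]
        exact mul_le_of_le_one_right (sq_nonneg c) (pow_le_one₀ (norm_nonneg ξ) h.le)
      linarith
  rw [kinetic, norm_dil_sq, hn]
  linarith

/-- The frequency scale at which a ground state of small mass `ρ` lives. -/
def scale (p ρ : ℝ) : ℝ := ρ ^ ((p - 2) / (10 - 3 * p))

theorem scale_pos {p ρ : ℝ} (hρ : 0 < ρ) : 0 < scale p ρ := Real.rpow_pos_of_pos hρ _

/-- The exponent in `scale` is the solution of this equation: at that frequency the
Gagliardo-Nirenberg bound for P is comparable with T, whatever the mass. -/
theorem scale_spec {p ρ : ℝ} (hp' : p < 8 / 3) (hρ : 0 < ρ) :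
    ρ ^ ((p - 2) / 2) * scale p ρ ^ (3 * (p - 2) / 2 - 2) = 1 := by
  rw [scale, ← Real.rpow_mul hρ.le, ← Real.rpow_add hρ]
  have : (p - 2) / 2 + (p - 2) / (10 - 3 * p) * (3 * (p - 2) / 2 - 2) = 0 := by
    rw [show 3 * (p - 2) / 2 - 2 = -((10 - 3 * p) / 2) by ring]
    have h := div_mul_cancel₀ (p - 2) (show 10 - 3 * p ≠ 0 by linarith)
    linear_combination (-(1 / 2)) * h
  rw [this, Real.rpow_zero]

theorem scale_spec' {p ρ : ℝ} (hp' : p < 8 / 3) (hρ : 0 < ρ) :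
    ρ ^ ((p - 2) / 2) * scale p ρ ^ (3 * (p - 2) / 2) = scale p ρ ^ 2 := by
  have h := scale_spec hp' hρ
  have hs := scale_pos (p := p) hρ
  have h2 : scale p ρ ^ (3 * (p - 2) / 2) = scale p ρ ^ (3 * (p - 2) / 2 - 2) * scale p ρ ^ 2 := by
    rw [← Real.rpow_natCast, ← Real.rpow_add hs]
    norm_num
  rw [h2, ← mul_assoc, h, one_mul]

theorem le_scale {p ρ : ℝ} (hp : 2 < p) (hp' : p < 8 / 3) (hρ : 0 < ρ) (hρ' : ρ ≤ 1) :
    ρ ≤ scale p ρ := by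
  have h : (p - 2) / (10 - 3 * p) ≤ 1 := by
    rw [div_le_one (by linarith)]
    linarith
  simpa [scale] using Real.rpow_le_rpow_of_exponent_ge hρ hρ' h

theorem scale_le_one {p ρ : ℝ} (hp : 2 < p) (hp' : p < 8 / 3) (hρ : 0 < ρ) (hρ' : ρ ≤ 1) :
    scale p ρ ≤ 1 :=
  Real.rpow_le_one hρ.le hρ' (div_nonneg (by linarith) (by linarith))

theorem exists_small_rpow {s : ℝ} (hs : 0 < s) (c : ℝ) {ε : ℝ} (hε : 0 < ε) :
    ∃ r : ℝ, 0 < r ∧ r ≤ 1 ∧ ∀ t, 0 < t → t ≤ r → c * t ^ s ≤ ε := by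
  have h : Tendsto (fun t : ℝ => c * t ^ s) (𝓝[>] 0) (𝓝 (c * 0 ^ s)) :=
    ((Real.continuousAt_rpow_const 0 s (Or.inr hs.le)).tendsto.const_mul c).mono_left
      nhdsWithin_le_nhds
  rw [Real.zero_rpow hs.ne', mul_zero] at h
  have h2 := (h.eventually (gt_mem_nhds hε))
  rw [eventually_nhdsWithin_iff, Metric.eventually_nhds_iff] at h2
  obtain ⟨r, hr, h3⟩ := h2
  refine ⟨min (r / 2) 1, by positivity, min_le_right _ _, fun t ht htr => ?_⟩
  refine (h3 ?_ ht).le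
  rw [Real.dist_eq, sub_zero, abs_of_pos ht]
  linarith [min_le_left (r / 2) 1]

/-- The trial function is √ρ times a band-limited function dilated to frequency ηκ. In units of ρκ²,
T and D cost at most a multiple of η, using ρ ≤ κ for D, while P gains a multiple of η^s. As s < 1,
a small fixed η makes the gain dominate. -/
theorem exists_reducedEnergy_le {p α β : ℝ} (hp : 2 < p) (hp' : p < 8 / 3) (hα : 0 < α)
    (hβ : 0 < β) : ∃ c : ℝ, 0 < c ∧ ∀ ρ : ℝ, 0 < ρ → ρ ≤ 1 → ∃ u ∈ massSphere ρ,
      reducedEnergy p α β u ≤ -(c * (ρ * scale p ρ ^ 2)) := by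
  obtain ⟨w, hw, hwn, hwk⟩ := exists_bandlimited
  have hP : 0 < powerIntegral p w := powerIntegral_pos hp hp'.le hw (by
    rintro rfl
    simp at hwn)
  obtain ⟨η, hη, hη1, hηs⟩ := exists_small_rpow (s := 1 - 3 * (p - 2) / 2) (by linarith)
    (1 / 4 + α * coulomb w) (ε := β * powerIntegral p w / 2) (by positivity)
  refine ⟨β * η ^ (3 * (p - 2) / 2) * powerIntegral p w / 2, by positivity, fun ρ hρ hρ1 => ?_⟩
  have hκ := scale_pos (p := p) hρ
  have hκ2 := scale_spec' hp' hρ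
  have hρκ := le_scale hp hp' hρ hρ1
  set κ := scale p ρ with hκdef
  have hηκ : 0 < η * κ := by positivity
  refine ⟨((√ρ : ℝ) : ℂ) • dil (η * κ) hηκ w, mem_massSphere.2 ⟨memHHalf_smul
    (memHHalf_dil hw _ _) _, ?_⟩, ?_⟩
  · rw [norm_smul, mul_pow, norm_dil_sq, hwn, Complex.norm_real, Real.norm_eq_abs,
      abs_of_nonneg (Real.sqrt_nonneg _), Real.sq_sqrt hρ.le]
    norm_num
  · have h4 : √ρ ^ 4 = ρ ^ 2 := by
      rw [show √ρ ^ 4 = (√ρ ^ 2) ^ 2 by ring, Real.sq_sqrt hρ.le]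
    have hpp : √ρ ^ p = ρ * ρ ^ ((p - 2) / 2) := by
      rw [Real.sqrt_eq_rpow, ← Real.rpow_mul hρ.le, ← Real.rpow_one_add' hρ.le (by linarith)]
      congr 1
      ring
    rw [reducedEnergy, kinetic_smul, coulomb_smul, powerIntegral_smul, coulomb_dil,
      powerIntegral_dil, Complex.norm_real, Real.norm_eq_abs, abs_of_nonneg (Real.sqrt_nonneg _),
      Real.sq_sqrt hρ.le, h4, hpp, Real.mul_rpow hη.le hκ.le]
    have e1 : ρ * kinetic (dil (η * κ) hηκ w) ≤ ρ * ((η * κ) ^ 2 / 4) :=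
      mul_le_mul_of_nonneg_left (hwk _ _) hρ.le
    have e2 : α * (ρ ^ 2 * (η * κ * coulomb w)) ≤ α * coulomb w * η * (ρ * κ ^ 2) := by
      have : ρ ^ 2 * κ ≤ ρ * κ ^ 2 := by nlinarith [mul_pos hρ hκ]
      have h5 : 0 ≤ α * coulomb w * η := by have := coulomb_nonneg w; positivity
      nlinarith [mul_le_mul_of_nonneg_left this h5]
    have e3 : ρ * ρ ^ ((p - 2) / 2) * (η ^ (3 * (p - 2) / 2) * κ ^ (3 * (p - 2) / 2)
        * powerIntegral p w) = η ^ (3 * (p - 2) / 2) * powerIntegral p w * (ρ * κ ^ 2) := by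
      rw [← hκ2]
      ring
    have e4 : (1 / 4 + α * coulomb w) * η ≤
        β * η ^ (3 * (p - 2) / 2) * powerIntegral p w / 2 := by
      have h6 : η = η ^ (1 - 3 * (p - 2) / 2) * η ^ (3 * (p - 2) / 2) := by
        rw [← Real.rpow_add hη]
        norm_num
      have h7 := mul_le_mul_of_nonneg_right (hηs η hη le_rfl)
        (Real.rpow_nonneg hη.le (3 * (p - 2) / 2))
      rw [mul_assoc, ← h6] at h7
      linarith
    have e5 : η ^ 2 ≤ η := by nlinarith
    have e6 : 0 ≤ ρ * κ ^ 2 := by positivity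
    have e7 := mul_le_mul_of_nonneg_right e4 e6
    have e8 := mul_le_mul_of_nonneg_right e5 e6
    rw [e3]
    linarith

/-- Nonpositive reduced energy means T ≤ βP. Gagliardo-Nirenberg split at frequency ηκ bounds βP by
half of T plus a multiple of ρκ². -/
theorem kinetic_le_of_nonpos {p α β : ℝ} (hp : 2 < p) (hp' : p < 8 / 3) (hα : 0 < α)
    (hβ : 0 < β) : ∃ K r : ℝ, 0 ≤ K ∧ 0 < r ∧ r ≤ 1 ∧ ∀ ρ : ℝ, 0 < ρ → ρ ≤ r →
      ∀ u ∈ massSphere ρ, reducedEnergy p α β u ≤ 0 → kinetic u ≤ K * (ρ * scale p ρ ^ 2) := by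
  have hG := gnConst_pos hp
  obtain ⟨η, hη, -, hη2⟩ := exists_mul_rpow_neg_le (s := 3 * (p - 2) / 2 - 2) (by linarith)
    (c := β * gnConst p * 6) (ε := 1 / 2) (by norm_num) 0
  -- Small mass guarantees ηκ ≤ 1, the range in which `powerIntegral_le_kinetic` is valid.
  obtain ⟨r, hr, hr1, hr2⟩ := exists_small_rpow (s := (p - 2) / (10 - 3 * p))
    (div_pos (by linarith) (by linarith)) η one_pos
  refine ⟨2 * (β * gnConst p * η ^ (3 * (p - 2) / 2)), r, by positivity, hr, hr1,
    fun ρ hρ hρr u hu hJ => ?_⟩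
  obtain ⟨hu1, hu2⟩ := mem_massSphere.1 hu
  have hκ := scale_pos (p := p) hρ
  have hκ1 := scale_spec hp' hρ
  have hκ2 := scale_spec' hp' hρ
  have hκr : η * scale p ρ ≤ 1 := hr2 ρ hρ hρr
  set κ := scale p ρ with hκdef
  have h := mul_le_mul_of_nonneg_left
    (powerIntegral_le_kinetic hp hp'.le hu1 (mul_pos hη hκ) hκr) hβ.le
  rw [norm_rpow_eq hu2, hu2, Real.mul_rpow hη.le hκ.le, Real.mul_rpow hη.le hκ.le] at h
  have e1 : β * (gnConst p * ρ ^ ((p - 2) / 2) * (η ^ (3 * (p - 2) / 2) * κ ^ (3 * (p - 2) / 2)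
      * ρ + 6 * (η ^ (3 * (p - 2) / 2 - 2) * κ ^ (3 * (p - 2) / 2 - 2)) * kinetic u))
      = β * gnConst p * η ^ (3 * (p - 2) / 2) * (ρ * κ ^ 2) +
        β * gnConst p * 6 * η ^ (3 * (p - 2) / 2 - 2) * kinetic u := by
    rw [← hκ2]
    linear_combination (β * gnConst p * 6 * η ^ (3 * (p - 2) / 2 - 2) * kinetic u) * hκ1
  rw [e1] at h
  have e2 := mul_le_mul_of_nonneg_right hη2 (kinetic_nonneg hu1)
  have e3 := mul_nonneg hα.le (coulomb_nonneg u)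
  rw [reducedEnergy] at hJ
  linarith

/-- The kinetic bound and the endpoint Gagliardo-Nirenberg inequality give ∫|u|^{8/3} ≤ Mρ^{4/3}κ,
which enters the Coulomb bound. -/
theorem coulomb_le_of_nonpos {p α β : ℝ} (hp : 2 < p) (hp' : p < 8 / 3) (hα : 0 < α)
    (hβ : 0 < β) : ∃ K r : ℝ, 0 ≤ K ∧ 0 < r ∧ r ≤ 1 ∧ ∀ ρ : ℝ, 0 < ρ → ρ ≤ r →
      ∀ u ∈ massSphere ρ, reducedEnergy p α β u ≤ 0 → coulomb u ≤ K * (ρ ^ 2 * scale p ρ) := by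
  obtain ⟨K, r, hK, hr, hr1, hkin⟩ := kinetic_le_of_nonpos hp hp' hα hβ
  have hG := gnConst_pos (p := 8 / 3) (by norm_num)
  have hC := kernelConst_nonneg
  set M := gnConst (8 / 3) * (1 + 6 * K) with hM
  have hM0 : 0 ≤ M := by positivity
  refine ⟨1 + M ^ 2 / 2 + kernelConst * M / 2, r, by positivity, hr, hr1,
    fun ρ hρ hρr u hu hJ => ?_⟩
  have hT := hkin ρ hρ hρr u hu hJ
  obtain ⟨hu1, hu2⟩ := mem_massSphere.1 hu
  have hκ := scale_pos (p := p) hρ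
  have hκ1 := scale_le_one hp hp' hρ (hρr.trans hr1)
  set κ := scale p ρ with hκdef
  have hA := powerIntegral_le_kinetic (p := 8 / 3) (by norm_num) le_rfl hu1 hκ hκ1
  rw [norm_rpow_eq hu2, hu2] at hA
  norm_num at hA
  rw [Real.rpow_neg_one] at hA
  have hA' : powerIntegral (8 / 3) u ≤ M * (ρ ^ (1 / 3 : ℝ) * ρ * κ) := by
    refine hA.trans ?_
    have h1 : κ * ρ + 6 * κ⁻¹ * kinetic u ≤ (1 + 6 * K) * (ρ * κ) := by
      have h2 : 6 * κ⁻¹ * kinetic u ≤ 6 * κ⁻¹ * (K * (ρ * κ ^ 2)) := by gcongr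
      have h3 : 6 * κ⁻¹ * (K * (ρ * κ ^ 2)) = 6 * K * (ρ * κ) := by field_simp
      linarith
    calc gnConst (8 / 3) * ρ ^ (1 / 3 : ℝ) * (κ * ρ + 6 * κ⁻¹ * kinetic u)
        ≤ gnConst (8 / 3) * ρ ^ (1 / 3 : ℝ) * ((1 + 6 * K) * (ρ * κ)) := by gcongr
      _ = _ := by rw [hM]; ring
  have hA0 := powerIntegral_nonneg (8 / 3) u
  set A := powerIntegral (8 / 3) u
  set t := ρ ^ (1 / 3 : ℝ) with ht
  have ht0 : 0 < t := by positivity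
  have ht3 : t ^ 3 = ρ := by
    rw [ht, ← Real.rpow_natCast, ← Real.rpow_mul hρ.le]
    norm_num
  -- With δ = 1/κ and η = ρ^{-2/3}/κ all three terms of `coulomb_le` have the order ρ²κ.
  have hη : 0 < (t ^ 2 * κ)⁻¹ := by positivity
  have h := coulomb_le hu1 (inv_pos.2 hκ) hη
  rw [show ‖u‖ ^ 4 = (‖u‖ ^ 2) ^ 2 by ring, hu2, inv_inv] at h
  have e2 : (t ^ 2 * κ)⁻¹ / 2 * A ^ 2 ≤ M ^ 2 / 2 * (ρ ^ 2 * κ) := by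
    calc (t ^ 2 * κ)⁻¹ / 2 * A ^ 2 ≤ (t ^ 2 * κ)⁻¹ / 2 * (M * (t * ρ * κ)) ^ 2 := by gcongr
      _ = _ := by field_simp
  have e3 : 1 / (2 * (t ^ 2 * κ)⁻¹) * κ⁻¹ * kernelConst * A
      ≤ kernelConst * M / 2 * (ρ ^ 2 * κ) := by
    calc 1 / (2 * (t ^ 2 * κ)⁻¹) * κ⁻¹ * kernelConst * A
        ≤ 1 / (2 * (t ^ 2 * κ)⁻¹) * κ⁻¹ * kernelConst * (M * (t * ρ * κ)) := by gcongr
      _ = kernelConst * M / 2 * (t ^ 3 * ρ * κ) := by field_simp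
      _ = _ := by rw [ht3]; ring
  linarith

/-- For small masses the Coulomb energy is negligible for functions of low energy. -/
theorem exists_small_mass {p α β : ℝ} (hp : 2 < p) (hp' : p < 8 / 3) (hα : 0 < α)
    (hβ : 0 < β) : ∃ ρ₁ : ℝ, 0 < ρ₁ ∧ ∀ ρ : ℝ, 0 < ρ → ρ < ρ₁ → ∃ d : ℝ, 0 < d ∧
      minReduced p α β ρ ≤ -(2 * d) ∧ ∀ u ∈ massSphere ρ, reducedEnergy p α β u ≤ -d →
        d ≤ β * powerIntegral p u ∧
        α * coulomb u ≤ (p - 2) / 8 * (β * powerIntegral p u) := by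
  obtain ⟨c, hc, hup⟩ := exists_reducedEnergy_le hp hp' hα hβ
  obtain ⟨K, r, hK, hr, hr1, hcou⟩ := coulomb_le_of_nonpos hp hp' hα hβ
  -- The power of ρ here is the ratio ρ/κ between the sizes of D and P; its exponent is positive
  -- because p < 3.
  obtain ⟨r', hr', hr1', hr2⟩ := exists_small_rpow (s := 1 - (p - 2) / (10 - 3 * p))
    (by
      have : (p - 2) / (10 - 3 * p) < 1 := by
        rw [div_lt_one (by linarith)]
        linarith
      linarith) (α * K) (ε := (p - 2) / 8 * (c / 2))
      (mul_pos (by linarith) (by linarith))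
  refine ⟨min r r', lt_min hr hr', fun ρ hρ hρm => ?_⟩
  have hρr : ρ ≤ r := hρm.le.trans (min_le_left _ _)
  have hρr' : ρ ≤ r' := hρm.le.trans (min_le_right _ _)
  have hκ := scale_pos (p := p) hρ
  refine ⟨c / 2 * (ρ * scale p ρ ^ 2), by positivity, ?_, fun u hu hJ => ?_⟩
  · obtain ⟨u, hu, hJ⟩ := hup ρ hρ (hρr.trans hr1)
    refine (minReduced_le hp hp' hα hβ hu).trans (hJ.trans_eq ?_)
    ring
  · have hd : 0 < c / 2 * (ρ * scale p ρ ^ 2) := by positivity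
    have h1 := hcou ρ hρ hρr u hu (by linarith)
    obtain ⟨hu1, hu2⟩ := mem_massSphere.1 hu
    have h2 : c / 2 * (ρ * scale p ρ ^ 2) ≤ β * powerIntegral p u := by
      rw [reducedEnergy] at hJ
      have := kinetic_nonneg hu1
      have := mul_nonneg hα.le (coulomb_nonneg u)
      linarith
    refine ⟨h2, ?_⟩
    have h3 : ρ = ρ ^ (1 - (p - 2) / (10 - 3 * p)) * scale p ρ := by
      rw [scale, ← Real.rpow_add hρ]
      norm_num
    have h4 : ρ ^ 2 * scale p ρ = ρ ^ (1 - (p - 2) / (10 - 3 * p)) * (ρ * scale p ρ ^ 2) := by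
      nth_rewrite 1 [pow_two, h3]
      ring
    have h5 := mul_le_mul_of_nonneg_right (hr2 ρ hρ hρr')
      (show 0 ≤ ρ * scale p ρ ^ 2 by positivity)
    have h6 := mul_le_mul_of_nonneg_left h1 hα.le
    rw [h4] at h6
    have h7 := mul_le_mul_of_nonneg_left h2 (show 0 ≤ (p - 2) / 8 by linarith)
    linarith

theorem smul_mem_massSphere {ρ θ : ℝ} (hθ : 0 ≤ θ) {u : L2} (hu : u ∈ massSphere ρ) :
    ((√θ : ℝ) : ℂ) • u ∈ massSphere (θ * ρ) := by
  obtain ⟨hu1, hu2⟩ := mem_massSphere.1 hu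
  refine mem_massSphere.2 ⟨memHHalf_smul hu1 _, ?_⟩
  rw [norm_smul, mul_pow, hu2, Complex.norm_real, Real.norm_eq_abs,
    abs_of_nonneg (Real.sqrt_nonneg _), Real.sq_sqrt hθ]

/-- From log θ ≥ 1 - 1/θ ≥ (θ-1)/2 for 1 ≤ θ ≤ 2, and e^x ≥ 1 + x. -/
theorem one_add_le_rpow {a θ : ℝ} (ha : 0 ≤ a) (hθ : 1 ≤ θ) (hθ' : θ ≤ 2) :
    1 + a / 4 * (θ - 1) ≤ θ ^ (a / 2) := by
  have h0 : 0 < θ := by linarith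
  have h1 : θ ^ (a / 2) = Real.exp (Real.log θ * (a / 2)) := Real.rpow_def_of_pos h0 _
  have h2 := Real.add_one_le_exp (Real.log θ * (a / 2))
  have h3 := Real.one_sub_inv_le_log_of_pos h0
  have h4 : (θ - 1) / 2 ≤ 1 - θ⁻¹ := by
    have : 1 - θ⁻¹ = (θ - 1) / θ := by field_simp
    rw [this]
    exact div_le_div_of_nonneg_left (by linarith) h0 hθ'
  rw [h1]
  nlinarith

theorem massSphere_nonempty {ρ : ℝ} (hρ : 0 ≤ ρ) : (massSphere ρ).Nonempty := by
  obtain ⟨w, hw, hwn, -⟩ := exists_bandlimited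
  have : w ∈ massSphere 1 := mem_massSphere.2 ⟨hw, by rw [hwn]; norm_num⟩
  have h := smul_mem_massSphere hρ this
  rw [mul_one] at h
  exact ⟨_, h⟩

theorem exists_reducedEnergy_lt {p α β ρ : ℝ} (hρ : 0 ≤ ρ) {e : ℝ}
    (he : minReduced p α β ρ < e) : ∃ u ∈ massSphere ρ, reducedEnergy p α β u < e := by
  obtain ⟨_, ⟨u, hu, rfl⟩, h⟩ := exists_lt_of_csInf_lt ((massSphere_nonempty hρ).image _) he
  exact ⟨u, hu, h⟩

/-- Multiplying a near-minimizer by √θ changes J by a factor θ, plus θ(θ-1)αD, minus θ(θ^((p-2)/2) -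
1)βP. For θ ≤ 2 the last bracket is at least (p-2)(θ-1)/4, twice what D can cost when the mass is
small. -/
theorem exists_strict_subhomogeneous {p α β : ℝ} (hp : 2 < p) (hp' : p < 8 / 3) (hα : 0 < α)
    (hβ : 0 < β) : ∃ ρ₁ : ℝ, 0 < ρ₁ ∧ (∀ ρ, 0 < ρ → ρ < ρ₁ → minReduced p α β ρ < 0) ∧
      ∀ ρ s : ℝ, 0 < s → s < ρ → ρ < ρ₁ →
        minReduced p α β ρ < ρ / s * minReduced p α β s := by
  obtain ⟨ρ₁, hρ₁, H⟩ := exists_small_mass hp hp' hα hβ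
  have hstep : ∀ ρ θ : ℝ, 0 < ρ → ρ < ρ₁ → 1 < θ → θ ≤ 2 →
      minReduced p α β (θ * ρ) < θ * minReduced p α β ρ := by
    intro ρ θ hρ hρ' hθ hθ'
    obtain ⟨d, hd, hm, hu⟩ := H ρ hρ hρ'
    have hX : 0 < θ * (θ - 1) * ((p - 2) / 8) * d := by
      have : 0 < θ - 1 := by linarith
      have : 0 < p - 2 := by linarith
      positivity
    have hθ0 : 0 < θ := by linarith
    -- The tolerance is the guaranteed net gain divided by θ, so that strictness survives although
    -- no minimizer is available yet.
    obtain ⟨u, hu1, hu2⟩ := exists_reducedEnergy_lt (p := p) (α := α) (β := β) hρ.le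
      (e := min (-d) (minReduced p α β ρ + θ * (θ - 1) * ((p - 2) / 8) * d / θ))
      (lt_min (by linarith) (by have := div_pos hX hθ0; linarith))
    obtain ⟨h1, h2⟩ := hu u hu1 (hu2.le.trans (min_le_left _ _))
    have h3 := hu2.trans_le (min_le_right _ _)
    refine (minReduced_le hp hp' hα hβ (smul_mem_massSphere hθ0.le hu1)).trans_lt ?_
    have h4 : √θ ^ 4 = θ ^ 2 := by
      rw [show √θ ^ 4 = (√θ ^ 2) ^ 2 by ring, Real.sq_sqrt hθ0.le]
    have hpp : √θ ^ p = θ * θ ^ ((p - 2) / 2) := by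
      rw [Real.sqrt_eq_rpow, ← Real.rpow_mul hθ0.le, ← Real.rpow_one_add' hθ0.le (by linarith)]
      congr 1
      ring
    have h5 : reducedEnergy p α β (((√θ : ℝ) : ℂ) • u) = θ * reducedEnergy p α β u
        + (θ * (θ - 1) * (α * coulomb u)
          - θ * (θ ^ ((p - 2) / 2) - 1) * (β * powerIntegral p u)) := by
      rw [reducedEnergy, reducedEnergy, kinetic_smul, coulomb_smul, powerIntegral_smul,
        Complex.norm_real, Real.norm_eq_abs, abs_of_nonneg (Real.sqrt_nonneg _),
        Real.sq_sqrt hθ0.le, h4, hpp]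
      ring
    have h6 := one_add_le_rpow (a := p - 2) (by linarith) hθ.le hθ'
    have h7 : θ * reducedEnergy p α β u
        < θ * minReduced p α β ρ + θ * (θ - 1) * ((p - 2) / 8) * d := by
      have := mul_lt_mul_of_pos_left h3 hθ0
      rwa [mul_add, mul_div_cancel₀ _ hθ0.ne'] at this
    have h8 : θ * (θ - 1) * (α * coulomb u)
        ≤ θ * (θ - 1) * ((p - 2) / 8 * (β * powerIntegral p u)) :=
      mul_le_mul_of_nonneg_left h2 (mul_nonneg hθ0.le (by linarith))
    have h9 : θ * ((p - 2) / 4 * (θ - 1)) * (β * powerIntegral p u)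
        ≤ θ * (θ ^ ((p - 2) / 2) - 1) * (β * powerIntegral p u) := by
      refine mul_le_mul_of_nonneg_right (mul_le_mul_of_nonneg_left (by linarith) hθ0.le) ?_
      linarith
    have h10 : θ * (θ - 1) * ((p - 2) / 8) * d
        ≤ θ * (θ - 1) * ((p - 2) / 8) * (β * powerIntegral p u) :=
      mul_le_mul_of_nonneg_left h1 (mul_nonneg (mul_nonneg hθ0.le (by linarith)) (by linarith))
    rw [h5]
    linarith
  refine ⟨ρ₁, hρ₁, fun ρ hρ hρ' => ?_, ?_⟩
  · obtain ⟨d, hd, hm, -⟩ := H ρ hρ hρ'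
    linarith
  -- A single step reaches only ratios up to 2; larger ratios are covered by repeated doubling of
  -- `s`.
  · have hchain : ∀ n : ℕ, ∀ ρ s : ℝ, 0 < s → s < ρ → ρ < ρ₁ → ρ ≤ 2 ^ n * s →
        minReduced p α β ρ < ρ / s * minReduced p α β s := by
      intro n
      induction n with
      | zero =>
        intro ρ s hs hsρ _ hn
        simp only [pow_zero, one_mul] at hn
        linarith
      | succ n ih =>
        intro ρ s hs hsρ hρ hn
        rcases le_or_gt ρ (2 * s) with h | h
        · have := hstep s (ρ / s) hs (hsρ.trans hρ) ((one_lt_div hs).2 hsρ)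
            ((div_le_iff₀ hs).2 h)
          rwa [div_mul_cancel₀ _ hs.ne'] at this
        · have h1 := ih ρ (2 * s) (by linarith) h hρ (hn.trans_eq (by ring))
          have h2 := hstep s 2 hs (hsρ.trans hρ) (by norm_num) le_rfl
          have h3 : 0 < ρ / (2 * s) := div_pos (by linarith) (by linarith)
          have h4 := mul_lt_mul_of_pos_left h2 h3
          refine (h1.trans h4).trans_eq ?_
          field_simp
    intro ρ s hs hsρ hρ
    obtain ⟨n, hn⟩ := pow_unbounded_of_one_lt (ρ / s) (by norm_num : (1 : ℝ) < 2)
    exact hchain n ρ s hs hsρ hρ ((div_le_iff₀ hs).1 hn.le)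

/-! ### Dilations and the Pohozaev-type identity. -/

theorem energy_le_of_isMinimizer {p α β ρ : ℝ} {u v : L2} (hv : IsMinimizer p α β ρ v)
    (hu : u ∈ massSphere ρ) : energy p α β v ≤ energy p α β u := by
  have h : (energy p α β v : EReal) ≤ (energy p α β u : EReal) := by
    rw [hv.2]
    exact iInf₂_le u hu
  exact_mod_cast h

theorem hasDerivAt_symbol_dil (r c : ℝ) :
    HasDerivAt (fun c : ℝ => (1 + (c * r) ^ 2) ^ (1 / 2 : ℝ))
      (c * r ^ 2 * (1 + (c * r) ^ 2) ^ (-(1 / 2) : ℝ)) c := by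
  have h1 : HasDerivAt (fun c : ℝ => 1 + (c * r) ^ 2) (2 * (c * r) * r) c := by
    have := (((hasDerivAt_id c).mul_const r).pow 2).const_add 1
    simpa using this
  have h2 := h1.rpow_const (p := 1 / 2) (Or.inl (by positivity))
  refine h2.congr_deriv ?_
  rw [show (1 / 2 : ℝ) - 1 = -(1 / 2) by norm_num]
  ring

theorem abs_deriv_symbol_dil_le {r : ℝ} (hr : 0 ≤ r) (c : ℝ) :
    |c * r ^ 2 * (1 + (c * r) ^ 2) ^ (-(1 / 2) : ℝ)| ≤ r := by
  have h0 : 0 < (1 + (c * r) ^ 2) ^ (1 / 2 : ℝ) := by positivity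
  have h1 : |c * r| ≤ (1 + (c * r) ^ 2) ^ (1 / 2 : ℝ) := by
    rw [← Real.sqrt_eq_rpow]
    exact Real.abs_le_sqrt (by linarith)
  rw [abs_mul, Real.rpow_neg (by positivity), abs_of_pos (inv_pos.2 h0), ← div_eq_mul_inv,
    div_le_iff₀ h0, show c * r ^ 2 = r * (c * r) by ring, abs_mul, abs_of_nonneg hr]
  exact mul_le_mul_of_nonneg_left h1 hr

theorem integrable_symbol_neg (u : L2) :
    Integrable fun ξ : R3 => (1 + ‖ξ‖ ^ 2) ^ (-(1 / 2) : ℝ) * ‖(𝓕 u : L2) ξ‖ ^ 2 := by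
  refine (integrable_norm_sq (𝓕 u)).mono' ?_ (Eventually.of_forall fun ξ => ?_)
  · exact AEStronglyMeasurable.mul (Measurable.aestronglyMeasurable (by fun_prop))
      (integrable_norm_sq _).aestronglyMeasurable
  · rw [Real.norm_eq_abs, abs_of_nonneg (by positivity)]
    refine mul_le_of_le_one_left (by positivity) ?_
    exact Real.rpow_le_one_of_one_le_of_nonpos (by simp) (by norm_num)

theorem hasDerivAt_sobolevNorm_dil {v : L2} (hv : MemHHalf v) :
    HasDerivAt (fun c : ℝ => ∫ ξ : R3, (1 + (c * ‖ξ‖) ^ 2) ^ (1 / 2 : ℝ) * ‖(𝓕 v : L2) ξ‖ ^ 2)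
      (sobolevNorm (1 / 2) v ^ 2 - sobolevNorm (-(1 / 2)) v ^ 2) 1 := by
  have hq := (integrable_norm_sq (𝓕 v : L2)).aestronglyMeasurable
  have h := (hasDerivAt_integral_of_dominated_loc_of_deriv_le (μ := (volume : Measure R3))
    (F := fun (c : ℝ) (ξ : R3) => (1 + (c * ‖ξ‖) ^ 2) ^ (1 / 2 : ℝ) * ‖(𝓕 v : L2) ξ‖ ^ 2)
    (F' := fun (c : ℝ) (ξ : R3) =>
      c * ‖ξ‖ ^ 2 * (1 + (c * ‖ξ‖) ^ 2) ^ (-(1 / 2) : ℝ) * ‖(𝓕 v : L2) ξ‖ ^ 2)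
    (bound := fun ξ => (1 + ‖ξ‖ ^ 2) ^ (1 / 2 : ℝ) * ‖(𝓕 v : L2) ξ‖ ^ 2)
    (x₀ := 1) univ_mem
    (Eventually.of_forall fun c =>
      AEStronglyMeasurable.mul (Measurable.aestronglyMeasurable (by fun_prop)) hq)
    (integrable_symbol_dil hv zero_le_one)
    (AEStronglyMeasurable.mul (Measurable.aestronglyMeasurable (by fun_prop)) hq)
    (Eventually.of_forall fun ξ c _ => by
      rw [norm_mul, Real.norm_eq_abs, Real.norm_eq_abs, abs_of_nonneg (sq_nonneg ‖(𝓕 v : L2) ξ‖)]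
      exact mul_le_mul_of_nonneg_right ((abs_deriv_symbol_dil_le (norm_nonneg ξ) c).trans
        (norm_le_symbol ξ)) (sq_nonneg _))
    (integrable_symbol hv)
    (Eventually.of_forall fun ξ c _ => (hasDerivAt_symbol_dil ‖ξ‖ c).mul_const _)).2
  refine h.congr_deriv ?_
  rw [sobolevNorm_sq, sobolevNorm_sq, ← integral_sub (integrable_symbol hv)
    (integrable_symbol_neg v)]
  congr 1
  ext ξ
  -- At c = 1 the derivative of the symbol is |ξ|²/√(1+|ξ|²) = √(1+|ξ|²) - 1/√(1+|ξ|²), which is the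
  -- source of the H^{-1/2} norm.
  have h1 : (1 + ‖ξ‖ ^ 2) ^ (1 / 2 : ℝ)
      = (1 + ‖ξ‖ ^ 2) * (1 + ‖ξ‖ ^ 2) ^ (-(1 / 2) : ℝ) := by
    rw [← Real.rpow_one_add' (by positivity) (by norm_num)]
    norm_num
  rw [h1, one_mul, one_mul]
  ring

/-- Along mass-preserving dilations D scales like c and P like c^(3(p-2)/2). A minimizer makes c = 1
a critical point of the energy. -/
theorem pohozaev {p α β ρ : ℝ} {v : L2} (hv : IsMinimizer p α β ρ v) :
    1 / 2 * sobolevNorm (1 / 2) v ^ 2 - 1 / 2 * sobolevNorm (-(1 / 2)) v ^ 2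
      + α * coulomb v - β * ((3 * p - 6) / 2) * powerIntegral p v = 0 := by
  obtain ⟨hv1, hv2⟩ := mem_massSphere.1 hv.1
  set g : ℝ → ℝ := fun c =>
    1 / 2 * (∫ ξ : R3, (1 + (c * ‖ξ‖) ^ 2) ^ (1 / 2 : ℝ) * ‖(𝓕 v : L2) ξ‖ ^ 2)
      + α * (c * coulomb v) - β * (c ^ (3 * (p - 2) / 2) * powerIntegral p v) with hg
  have hge : ∀ (c : ℝ) (hc : 0 < c), g c = energy p α β (dil c hc v) := fun c hc => by
    rw [energy, sobolevNorm_dil_sq, coulomb_dil, powerIntegral_dil]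
  have hg1 : g 1 = energy p α β v := by
    rw [hg, energy, sobolevNorm_sq]
    simp
  have hmin : IsLocalMin g 1 := by
    filter_upwards [lt_mem_nhds (zero_lt_one' ℝ)] with c hc
    rw [hg1, hge c hc]
    exact energy_le_of_isMinimizer hv
      (mem_massSphere.2 ⟨memHHalf_dil hv1 c hc, by rw [norm_dil_sq, hv2]⟩)
  have hd : HasDerivAt g (1 / 2 * (sobolevNorm (1 / 2) v ^ 2 - sobolevNorm (-(1 / 2)) v ^ 2)
      + α * (1 * coulomb v)
      - β * (3 * (p - 2) / 2 * 1 ^ (3 * (p - 2) / 2 - 1) * powerIntegral p v)) 1 := by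
    refine HasDerivAt.sub (HasDerivAt.add ((hasDerivAt_sobolevNorm_dil hv1).const_mul _) ?_) ?_
    · exact ((hasDerivAt_id (1 : ℝ)).mul_const _).const_mul _
    · exact ((Real.hasDerivAt_rpow_const (Or.inl one_ne_zero)).mul_const _).const_mul _
  have h0 := hmin.hasDerivAt_eq_zero hd
  rw [Real.one_rpow] at h0
  linarith

/-! ### Weak limits in H^{1/2}. -/

theorem tendsto_zero_of_forall_eventually_lt {f : ℕ → ℝ} (h0 : ∀ n, 0 ≤ f n)
    (h : ∀ ε : ℝ, 0 < ε → ∀ᶠ n in atTop, f n < ε) : Tendsto f atTop (𝓝 0) := by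
  refine Metric.tendsto_nhds.2 fun ε hε => ?_
  filter_upwards [h ε hε] with n hn
  rwa [Real.dist_eq, sub_zero, abs_of_nonneg (h0 n)]

theorem fourier_sub (u v : L2) : (𝓕 (u - v) : L2) = 𝓕 u - 𝓕 v :=
  (Lp.fourierTransformₗᵢ R3 ℂ).map_sub u v

/-- Sequential Banach-Alaoglu in the dual of a separable Hilbert space, carried back by the Riesz
isometry. The conjugation accounts for its antilinearity. -/
theorem exists_weakly_convergent_subseq (f : ℕ → L2) (M : ℝ) (hM : ∀ n, ‖f n‖ ≤ M) :
    ∃ (φ : ℕ → ℕ) (g : L2), StrictMono φ ∧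
      ∀ h : L2, Tendsto (fun n => inner ℂ h (f (φ n))) atTop (𝓝 (inner ℂ h g)) := by
  have : Fact ((2 : ENNReal) ≠ ⊤) := ⟨ENNReal.ofNat_ne_top⟩
  have : SecondCountableTopology L2 := Lp.SecondCountableTopology
  have hc := WeakDual.isSeqCompact_closedBall ℂ L2 (0 : StrongDual ℂ L2) M
  obtain ⟨a, -, φ, hφ, ha⟩ := hc (x := fun n =>
    StrongDual.toWeakDual (InnerProductSpace.toDual ℂ L2 (f n))) (fun n => by
      simpa using hM n)
  refine ⟨φ, (InnerProductSpace.toDual ℂ L2).symm (WeakDual.toStrongDual a), hφ, fun h => ?_⟩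
  have h1 := ((WeakDual.eval_continuous h).tendsto a).comp ha
  have h2 := (Complex.continuous_conj.tendsto _).comp h1
  have h3 : inner ℂ h ((InnerProductSpace.toDual ℂ L2).symm (WeakDual.toStrongDual a))
      = (starRingEnd ℂ) (a h) := by
    rw [← inner_conj_symm, InnerProductSpace.toDual_symm_apply]
    rfl
  rw [h3]
  refine h2.congr fun n => ?_
  simp only [Function.comp_apply]
  rw [← inner_conj_symm h]
  rfl

theorem tendsto_norm_sq_sub {f : ℕ → L2} {g : L2}
    (h : Tendsto (fun n => inner ℂ g (f n)) atTop (𝓝 (inner ℂ g g))) :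
    Tendsto (fun n => ‖f n‖ ^ 2 - ‖f n - g‖ ^ 2) atTop (𝓝 (‖g‖ ^ 2)) := by
  have h1 : ∀ n, ‖f n‖ ^ 2 - ‖f n - g‖ ^ 2 = 2 * (inner ℂ g (f n)).re - ‖g‖ ^ 2 := fun n => by
    have := norm_sub_sq (𝕜 := ℂ) (f n) g
    rw [this, ← inner_conj_symm, RCLike.conj_re]
    simp only [RCLike.re_to_complex]
    ring
  simp_rw [h1]
  have h2 := (((Complex.continuous_re.tendsto _).comp h).const_mul 2).sub_const (‖g‖ ^ 2)
  have h3 : 2 * (inner ℂ g g : ℂ).re - ‖g‖ ^ 2 = ‖g‖ ^ 2 := by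
    have h4 : (inner ℂ g g : ℂ).re = ‖g‖ ^ 2 := inner_self_eq_norm_sq (𝕜 := ℂ) g
    rw [h4]
    ring
  rwa [h3] at h2

theorem memLp_lift {u : L2} (hu : MemHHalf u) :
    MemLp (fun ξ : R3 => (((1 + ‖ξ‖ ^ 2) ^ (1 / 4 : ℝ) : ℝ) : ℂ) * (𝓕 u : L2) ξ) 2 volume := by
  rw [memLp_two_iff_integrable_sq_norm]
  · refine (integrable_symbol hu).congr (Eventually.of_forall fun ξ => ?_)
    simp only
    rw [norm_mul, mul_pow, Complex.norm_real, Real.norm_eq_abs, abs_of_nonneg (by positivity),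
      ← Real.rpow_mul_natCast (by positivity)]
    norm_num
  · exact (Measurable.aestronglyMeasurable (by fun_prop)).mul (Lp.aestronglyMeasurable _)

/-- The isometry from `H^{1/2}` to `L²`. -/
def lift (u : L2) (hu : MemHHalf u) : L2 := (memLp_lift hu).toLp

theorem coeFn_lift {u : L2} (hu : MemHHalf u) : lift u hu =ᵐ[volume]
    fun ξ : R3 => (((1 + ‖ξ‖ ^ 2) ^ (1 / 4 : ℝ) : ℝ) : ℂ) * (𝓕 u : L2) ξ := MemLp.coeFn_toLp _

theorem norm_lift_sq {u : L2} (hu : MemHHalf u) :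
    ‖lift u hu‖ ^ 2 = sobolevNorm (1 / 2) u ^ 2 := by
  rw [norm_sq_eq_integral, sobolevNorm_sq]
  refine integral_congr_ae ?_
  filter_upwards [coeFn_lift hu] with ξ hξ
  rw [hξ, norm_mul, mul_pow, Complex.norm_real, Real.norm_eq_abs, abs_of_nonneg (by positivity),
    ← Real.rpow_mul_natCast (by positivity)]
  norm_num

theorem memHHalf_sub {u v : L2} (hu : MemHHalf u) (hv : MemHHalf v) : MemHHalf (u - v) := by
  have h := TemperedDistribution.MemSobolev.sub hu hv
  have h2 : (u : 𝓢'(R3, ℂ)) - (v : 𝓢'(R3, ℂ)) = ((u - v : L2) : 𝓢'(R3, ℂ)) :=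
    ((Lp.toTemperedDistributionCLM ℂ (volume : Measure R3) 2).map_sub u v).symm
  rwa [h2] at h

theorem lift_sub {u v : L2} (hu : MemHHalf u) (hv : MemHHalf v) :
    lift (u - v) (memHHalf_sub hu hv) = lift u hu - lift v hv := by
  apply Lp.ext
  have h0 : (𝓕 (u - v) : L2) = 𝓕 u - 𝓕 v := fourier_sub u v
  filter_upwards [coeFn_lift hu, coeFn_lift hv, coeFn_lift (memHHalf_sub hu hv),
    Lp.coeFn_sub (lift u hu) (lift v hv), Lp.coeFn_sub (𝓕 u : L2) (𝓕 v)] with ξ h1 h2 h3 h4 h5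
  rw [h3, h4, Pi.sub_apply, h1, h2, h0, h5, Pi.sub_apply]
  ring

theorem memLp_lower (f : L2) :
    MemLp (fun ξ : R3 => (((1 + ‖ξ‖ ^ 2) ^ (-(1 / 4) : ℝ) : ℝ) : ℂ) * f ξ) 2 volume := by
  refine (Lp.memLp f).of_le ((Measurable.aestronglyMeasurable (by fun_prop)).mul
    (Lp.aestronglyMeasurable _)) (Eventually.of_forall fun ξ => ?_)
  rw [norm_mul, Complex.norm_real, Real.norm_eq_abs, abs_of_nonneg (by positivity)]
  refine mul_le_of_le_one_left (by positivity) ?_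
  exact Real.rpow_le_one_of_one_le_of_nonpos (by simp) (by norm_num)

/-- Multiplication by the inverse square root of the symbol. -/
def lower (f : L2) : L2 := (memLp_lower f).toLp

theorem coeFn_lower (f : L2) : lower f =ᵐ[volume]
    fun ξ : R3 => (((1 + ‖ξ‖ ^ 2) ^ (-(1 / 4) : ℝ) : ℝ) : ℂ) * f ξ := MemLp.coeFn_toLp _

theorem symbol_mul_inv (ξ : R3) : (((1 + ‖ξ‖ ^ 2) ^ (1 / 4 : ℝ) : ℝ) : ℂ) *
    (((1 + ‖ξ‖ ^ 2) ^ (-(1 / 4) : ℝ) : ℝ) : ℂ) = 1 := by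
  norm_cast
  rw [← Real.rpow_add (by positivity)]
  norm_num

theorem memHHalf_fourierInv_lower (f : L2) : MemHHalf (𝓕⁻ (lower f) : L2) := by
  rw [memHHalf_iff_integrable,
    show (𝓕 (𝓕⁻ (lower f) : L2) : L2) = lower f from FourierTransform.fourier_fourierInv_eq _]
  refine (integrable_norm_sq f).congr ?_
  filter_upwards [coeFn_lower f] with ξ hξ
  rw [hξ, norm_mul, mul_pow, ← mul_assoc, Complex.norm_real, Real.norm_eq_abs,
    abs_of_nonneg (by positivity), ← Real.rpow_mul_natCast (by positivity),
    ← Real.rpow_add (by positivity)]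
  norm_num

theorem lift_fourierInv_lower (f : L2) :
    lift (𝓕⁻ (lower f)) (memHHalf_fourierInv_lower f) = f := by
  apply Lp.ext
  have h0 : (𝓕 (𝓕⁻ (lower f) : L2) : L2) = lower f := FourierTransform.fourier_fourierInv_eq _
  filter_upwards [coeFn_lift (memHHalf_fourierInv_lower f), coeFn_lower f] with ξ h1 h2
  rw [h1, h0, h2, ← mul_assoc, symbol_mul_inv, one_mul]

theorem inner_fourier_eq_inner_lower {u : L2} (hu : MemHHalf u) (g : L2) :
    inner ℂ g (𝓕 u : L2) = inner ℂ (lower g) (lift u hu) := by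
  rw [L2.inner_def, L2.inner_def]
  refine integral_congr_ae ?_
  filter_upwards [coeFn_lift hu, coeFn_lower g] with ξ h1 h2
  rw [h1, h2]
  simp only [RCLike.inner_apply, map_mul, Complex.conj_ofReal]
  have := symbol_mul_inv ξ
  linear_combination (-(𝓕 u : L2) ξ * (starRingEnd ℂ) (g ξ)) * this

/-- The weak limit is taken after the isometry `lift`, so the squared H^{1/2} norm splits by
orthogonality. Since `lower` is bounded and self-adjoint, the Fourier transforms also converge
weakly in `L²`, and the mass splits too. -/
theorem exists_weak_limit (u : ℕ → L2) (hu : ∀ n, MemHHalf (u n)) (M : ℝ)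
    (hM : ∀ n, sobolevNorm (1 / 2) (u n) ^ 2 ≤ M) :
    ∃ (φ : ℕ → ℕ) (w : L2), StrictMono φ ∧ MemHHalf w ∧
      (∀ g : L2, Tendsto (fun n => inner ℂ g (𝓕 (u (φ n)) : L2)) atTop
        (𝓝 (inner ℂ g (𝓕 w : L2)))) ∧
      Tendsto (fun n => ‖u (φ n)‖ ^ 2 - ‖u (φ n) - w‖ ^ 2) atTop (𝓝 (‖w‖ ^ 2)) ∧
      Tendsto (fun n => sobolevNorm (1 / 2) (u (φ n)) ^ 2
        - sobolevNorm (1 / 2) (u (φ n) - w) ^ 2) atTop (𝓝 (sobolevNorm (1 / 2) w ^ 2)) := by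
  obtain ⟨φ, f, hφ, hf⟩ := exists_weakly_convergent_subseq (fun n => lift (u n) (hu n)) (√M)
    (fun n => Real.le_sqrt_of_sq_le ((norm_lift_sq (hu n)).trans_le (hM n)))
  set w : L2 := 𝓕⁻ (lower f) with hw
  have hwH : MemHHalf w := memHHalf_fourierInv_lower f
  have hwf : lift w hwH = f := lift_fourierInv_lower f
  have hweak : ∀ g : L2, Tendsto (fun n => inner ℂ g (𝓕 (u (φ n)) : L2)) atTop
      (𝓝 (inner ℂ g (𝓕 w : L2))) := fun g => by
    rw [inner_fourier_eq_inner_lower hwH, hwf]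
    exact (hf (lower g)).congr fun n => (inner_fourier_eq_inner_lower (hu (φ n)) g).symm
  refine ⟨φ, w, hφ, hwH, hweak, ?_, ?_⟩
  · have h := tendsto_norm_sq_sub (hweak (𝓕 w))
    refine (h.congr fun n => ?_).trans_eq ?_
    · rw [← fourier_sub, Lp.norm_fourier_eq, Lp.norm_fourier_eq]
    · rw [Lp.norm_fourier_eq]
  · have h := tendsto_norm_sq_sub (hf f)
    refine (h.congr fun n => ?_).trans_eq ?_
    · rw [norm_lift_sq, ← norm_lift_sq (memHHalf_sub (hu (φ n)) hwH), lift_sub (hu (φ n)) hwH, hwf]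
    · rw [← hwf, norm_lift_sq]

/-! ### Local compactness and almost everywhere convergence. -/

theorem norm_highpass_sq_le {u : L2} (hu : MemHHalf u) {R : ℝ} (hR : 0 < R) :
    ‖highpass R u‖ ^ 2 ≤ R⁻¹ * sobolevNorm (1 / 2) u ^ 2 := by
  rw [norm_sq_fourier, fourier_highpass, sobolevNorm_sq, ← integral_const_mul]
  refine integral_mono_ae (integrable_norm_sq _) ((integrable_symbol hu).const_mul _) ?_
  filter_upwards [coeFn_cutoff R (𝓕 u)] with ξ hξ
  rw [hξ]
  by_cases hb : ξ ∈ (Metric.ball (0 : R3) R)ᶜ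
  · rw [Set.indicator_of_mem hb, ← mul_assoc]
    refine le_mul_of_one_le_left (by positivity) ?_
    have hR' : R ≤ ‖ξ‖ := by simpa using hb
    rw [← div_eq_inv_mul, one_le_div hR]
    exact hR'.trans (norm_le_symbol ξ)
  · rw [Set.indicator_of_notMem hb]
    simp
    positivity

theorem continuous_lowpass (R : ℝ) (u : L2) : Continuous (lowpass R u) := by
  have := VectorFourier.fourierIntegral_continuous (L := -innerₗ R3) Real.continuous_fourierChar
    continuous_neg_innerₗ ((integrable_indicator_iff measurableSet_ball).2
      (integrableOn_ball R (𝓕 u : L2)))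
  exact this

theorem integrable_weight : Integrable fun x : R3 => (1 + ‖x‖) ^ (-4 : ℝ) :=
  integrable_one_add_norm (by simp; norm_num)

/-- Local compactness: a bounded sequence of `H^{1/2}` converging weakly to zero converges to zero
in a weighted `L²` space. -/
theorem tendsto_weighted_norm_sq {v : ℕ → L2} (hv : ∀ n, MemHHalf (v n)) {M : ℝ}
    (hM : ∀ n, sobolevNorm (1 / 2) (v n) ^ 2 ≤ M)
    (hweak : ∀ g : L2, Tendsto (fun n => inner ℂ g (𝓕 (v n) : L2)) atTop (𝓝 0)) :
    Tendsto (fun n => ∫ x, (1 + ‖x‖) ^ (-4 : ℝ) * ‖v n x‖ ^ 2) atTop (𝓝 0) := by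
  have hM0 : 0 ≤ M := (sq_nonneg _).trans (hM 0)
  have hq0 : ∀ x : R3, 0 ≤ (1 + ‖x‖) ^ (-4 : ℝ) := fun x => by positivity
  have hq1 : ∀ x : R3, (1 + ‖x‖) ^ (-4 : ℝ) ≤ 1 := fun x =>
    Real.rpow_le_one_of_one_le_of_nonpos (by simp) (by norm_num)
  have hqm : AEStronglyMeasurable (fun x : R3 => (1 + ‖x‖) ^ (-4 : ℝ)) volume :=
    integrable_weight.aestronglyMeasurable
  have hint : ∀ u : L2, Integrable fun x => (1 + ‖x‖) ^ (-4 : ℝ) * ‖u x‖ ^ 2 := fun u => by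
    refine (integrable_norm_sq u).mono' (hqm.mul (integrable_norm_sq u).aestronglyMeasurable)
      (Eventually.of_forall fun x => ?_)
    rw [Real.norm_eq_abs, abs_of_nonneg (mul_nonneg (hq0 x) (sq_nonneg _))]
    exact mul_le_of_le_one_left (sq_nonneg _) (hq1 x)
  have hvn : ∀ n, ‖v n‖ ^ 2 ≤ M := fun n => by
    have := kinetic_nonneg (hv n)
    rw [kinetic] at this
    linarith [hM n]
  -- At each point the low-frequency part is an inner product with a fixed `wave`, so weak
  -- convergence sends it to 0. Bernstein's inequality and the integrable weight allow dominated
  -- convergence.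
  have hlow : ∀ R : ℝ, 0 ≤ R → (∀ n, Integrable fun x =>
      (1 + ‖x‖) ^ (-4 : ℝ) * ‖lowpass R (v n) x‖ ^ 2) ∧
      Tendsto (fun n => ∫ x, (1 + ‖x‖) ^ (-4 : ℝ) * ‖lowpass R (v n) x‖ ^ 2) atTop (𝓝 0) := by
    intro R hR
    have hb : ∀ n x, ‖(1 + ‖x‖) ^ (-4 : ℝ) * ‖lowpass R (v n) x‖ ^ 2‖ ≤
        (1 + ‖x‖) ^ (-4 : ℝ) * (ballConst * R ^ (3 / 2 : ℝ) * √M) ^ 2 := fun n x => by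
      rw [Real.norm_eq_abs, abs_of_nonneg (mul_nonneg (hq0 x) (sq_nonneg _))]
      refine mul_le_mul_of_nonneg_left ?_ (hq0 x)
      refine pow_le_pow_left₀ (norm_nonneg _) ((norm_lowpass_le hR (v n) x).trans ?_) 2
      have := ballConst_pos
      exact mul_le_mul_of_nonneg_left (Real.le_sqrt_of_sq_le (hvn n)) (by positivity)
    have hm : ∀ n, AEStronglyMeasurable (fun x =>
        (1 + ‖x‖) ^ (-4 : ℝ) * ‖lowpass R (v n) x‖ ^ 2) volume := fun n =>
      hqm.mul ((continuous_lowpass R (v n)).norm.pow 2).aestronglyMeasurable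
    refine ⟨fun n => (integrable_weight.mul_const _).mono' (hm n)
      (Eventually.of_forall (hb n)), ?_⟩
    have := tendsto_integral_of_dominated_convergence (f := fun _ => (0 : ℝ)) _ hm
      (integrable_weight.mul_const _) (fun n => Eventually.of_forall (hb n))
      (Eventually.of_forall fun x => by
        have h1 := (hweak (wave R x)).norm.pow 2
        simp_rw [← lowpass_eq_inner] at h1
        simpa using h1.const_mul ((1 + ‖x‖) ^ (-4 : ℝ)))
    simpa using this
  refine tendsto_zero_of_forall_eventually_lt (fun n => integral_nonneg fun x => mul_nonneg (hq0 x) (sq_nonneg _))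
    fun ε hε => ?_
  have hR : 0 < 4 * (M + 1) / ε := by positivity
  -- At this cut-off the high-frequency part has squared norm at most M/R ≤ ε/4, uniformly in n.
  set R := 4 * (M + 1) / ε with hRdef
  obtain ⟨hi, ht⟩ := hlow R hR.le
  filter_upwards [ht.eventually (gt_mem_nhds (show (0 : ℝ) < ε / 4 by positivity))] with n hn
  have h1 : ∫ x, (1 + ‖x‖) ^ (-4 : ℝ) * ‖v n x‖ ^ 2 ≤
      ∫ x, (2 * ((1 + ‖x‖) ^ (-4 : ℝ) * ‖lowpass R (v n) x‖ ^ 2)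
        + 2 * ‖highpass R (v n) x‖ ^ 2) := by
    refine integral_mono_ae (hint _) (((hi n).const_mul 2).add
      ((integrable_norm_sq _).const_mul 2)) ?_
    filter_upwards [ae_eq_lowpass_add_highpass R (v n)] with x hx
    have h2 : ‖v n x‖ ^ 2 ≤ 2 * ‖lowpass R (v n) x‖ ^ 2 + 2 * ‖highpass R (v n) x‖ ^ 2 := by
      rw [hx]
      have h3 := norm_add_le (lowpass R (v n) x) (highpass R (v n) x)
      have h4 := pow_le_pow_left₀ (norm_nonneg _) h3 2
      nlinarith [sq_nonneg (‖lowpass R (v n) x‖ - ‖highpass R (v n) x‖)]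
    have h5 := mul_le_mul_of_nonneg_left h2 (hq0 x)
    have h6 := mul_le_of_le_one_left (sq_nonneg ‖highpass R (v n) x‖) (hq1 x)
    linarith
  rw [integral_add ((hi n).const_mul 2) ((integrable_norm_sq _).const_mul 2), integral_const_mul,
    integral_const_mul, ← norm_sq_eq_integral] at h1
  have h7 : ‖highpass R (v n)‖ ^ 2 ≤ ε / 4 := by
    refine (norm_highpass_sq_le (hv n) hR).trans ?_
    rw [hRdef, inv_div, div_mul_eq_mul_div, div_le_div_iff₀ (by positivity) (by norm_num)]
    nlinarith [hM n]
  linarith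

theorem exists_ae_convergent_subseq {v : ℕ → L2} (hv : ∀ n, MemHHalf (v n)) {M : ℝ}
    (hM : ∀ n, sobolevNorm (1 / 2) (v n) ^ 2 ≤ M)
    (hweak : ∀ g : L2, Tendsto (fun n => inner ℂ g (𝓕 (v n) : L2)) atTop (𝓝 0)) :
    ∃ φ : ℕ → ℕ, StrictMono φ ∧ ∀ᵐ x, Tendsto (fun n => ‖v (φ n) x‖) atTop (𝓝 0) := by
  have hq0 : ∀ x : R3, 0 < (1 + ‖x‖) ^ (-4 : ℝ) := fun x => by positivity
  have ht := tendsto_weighted_norm_sq hv hM hweak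
  have hm : ∀ n, AEStronglyMeasurable (fun x => (1 + ‖x‖) ^ (-4 : ℝ) * ‖v n x‖ ^ 2) volume :=
    fun n => integrable_weight.aestronglyMeasurable.mul
      (integrable_norm_sq (v n)).aestronglyMeasurable
  have hL : Tendsto (fun n => eLpNorm ((fun x => (1 + ‖x‖) ^ (-4 : ℝ) * ‖v n x‖ ^ 2)
      - (fun _ => (0 : ℝ))) 1 volume) atTop (𝓝 0) := by
    have h1 : ∀ n, eLpNorm ((fun x => (1 + ‖x‖) ^ (-4 : ℝ) * ‖v n x‖ ^ 2)
        - (fun _ => (0 : ℝ))) 1 volume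
        = ENNReal.ofReal (∫ x, (1 + ‖x‖) ^ (-4 : ℝ) * ‖v n x‖ ^ 2) := fun n => by
      have hi : Integrable fun x => (1 + ‖x‖) ^ (-4 : ℝ) * ‖v n x‖ ^ 2 := by
        refine (integrable_norm_sq (v n)).mono' (hm n) (Eventually.of_forall fun x => ?_)
        rw [Real.norm_eq_abs, abs_of_nonneg (mul_nonneg (hq0 x).le (sq_nonneg _))]
        exact mul_le_of_le_one_left (sq_nonneg _)
          (Real.rpow_le_one_of_one_le_of_nonpos (by simp) (by norm_num))
      rw [eLpNorm_one_eq_lintegral_enorm, ofReal_integral_eq_lintegral_ofReal hi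
        (Eventually.of_forall fun x => mul_nonneg (hq0 x).le (sq_nonneg _))]
      refine lintegral_congr fun x => ?_
      simp only [Pi.sub_apply, sub_zero]
      exact Real.enorm_of_nonneg (mul_nonneg (hq0 x).le (sq_nonneg _))
    simp_rw [h1]
    simpa using ENNReal.tendsto_ofReal ht
  obtain ⟨φ, hφ, h⟩ := (tendstoInMeasure_of_tendsto_eLpNorm one_ne_zero hm
    aestronglyMeasurable_const hL).exists_seq_tendsto_ae
  refine ⟨φ, hφ, ?_⟩
  filter_upwards [h] with x hx
  have h2 := (hx.const_mul ((1 + ‖x‖) ^ (-4 : ℝ))⁻¹).sqrt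
  rw [mul_zero, Real.sqrt_zero] at h2
  refine h2.congr fun n => ?_
  rw [inv_mul_cancel_left₀ (hq0 x).ne', Real.sqrt_sq (norm_nonneg _)]

/-! ### Splitting of the power integral and of the Coulomb energy. -/

/-- Pick δ with (1+δ)^p < 1+ε and compare t with δs: either s+t ≤ (1+δ)s or s+t ≤ (1+1/δ)t. -/
theorem add_rpow_le_eps {p ε : ℝ} (hp : 0 < p) (hε : 0 < ε) :
    ∃ C : ℝ, 0 ≤ C ∧ ∀ s t : ℝ, 0 ≤ s → 0 ≤ t → (s + t) ^ p ≤ (1 + ε) * s ^ p + C * t ^ p := by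
  have hc : ContinuousAt (fun δ : ℝ => (1 + δ) ^ p) 0 :=
    (continuousAt_const.add continuousAt_id).rpow_const (Or.inr hp.le)
  have h1 := hc.tendsto.eventually (gt_mem_nhds (show (1 + 0 : ℝ) ^ p < 1 + ε by simp [hε]))
  obtain ⟨r, hr, hr'⟩ := Metric.eventually_nhds_iff.1 h1
  have hδ := hr' (y := r / 2) (by rw [Real.dist_eq, sub_zero, abs_of_pos (by positivity)]; linarith)
  set δ := r / 2 with hδdef
  have hδ0 : 0 < δ := by positivity
  refine ⟨(1 + δ⁻¹) ^ p, by positivity, fun s t hs ht => ?_⟩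
  rcases le_total t (δ * s) with h | h
  · have h2 : (s + t) ^ p ≤ ((1 + δ) * s) ^ p :=
      Real.rpow_le_rpow (by positivity) (by linarith) hp.le
    rw [Real.mul_rpow (by positivity) hs] at h2
    have h3 : (1 + δ) ^ p * s ^ p ≤ (1 + ε) * s ^ p :=
      mul_le_mul_of_nonneg_right hδ.le (by positivity)
    have h4 : 0 ≤ (1 + δ⁻¹) ^ p * t ^ p := by positivity
    linarith
  · have h2 : s ≤ δ⁻¹ * t := by
      rw [← div_eq_inv_mul, le_div_iff₀ hδ0]
      linarith
    have h3 : (s + t) ^ p ≤ ((1 + δ⁻¹) * t) ^ p :=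
      Real.rpow_le_rpow (by positivity) (by linarith) hp.le
    rw [Real.mul_rpow (by positivity) ht] at h3
    have h4 : 0 ≤ (1 + ε) * s ^ p := by positivity
    linarith

/-- If the positive parts are dominated by an integrable function and converge to zero, then
their integrals converge to zero. -/
theorem tendsto_integral_max_zero {f : ℕ → R3 → ℝ} {G : R3 → ℝ} (hG : Integrable G)
    (hG0 : ∀ᵐ x, 0 ≤ G x)
    (hf : ∀ n, AEStronglyMeasurable (f n) volume) (hfG : ∀ n, ∀ᵐ x, f n x ≤ G x)
    (h0 : ∀ᵐ x, Tendsto (fun n => f n x) atTop (𝓝 0)) :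
    (∀ n, Integrable fun x => max (f n x) 0) ∧
      Tendsto (fun n => ∫ x, max (f n x) 0) atTop (𝓝 0) := by
  have hm : ∀ n, AEStronglyMeasurable (fun x => max (f n x) 0) volume := fun n =>
    (hf n).sup aestronglyMeasurable_const
  have hb : ∀ n, ∀ᵐ x, ‖max (f n x) 0‖ ≤ G x := fun n => by
    filter_upwards [hfG n, hG0] with x h1 h2
    rw [Real.norm_eq_abs, abs_of_nonneg (le_max_right _ _)]
    exact max_le h1 h2
  refine ⟨fun n => hG.mono' (hm n) (hb n), ?_⟩
  have := tendsto_integral_of_dominated_convergence (f := fun _ => (0 : ℝ)) G hm hG hb (by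
    filter_upwards [h0] with x hx
    simpa using hx.max (tendsto_const_nhds (x := (0 : ℝ))))
  simpa using this

theorem norm_ae_le_add {u w : L2} :
    ∀ᵐ x, ‖u x‖ ≤ ‖(u - w) x‖ + ‖w x‖ ∧ |‖u x‖ - ‖w x‖| ≤ ‖(u - w) x‖ := by
  filter_upwards [Lp.coeFn_sub u w] with x hx
  rw [hx, Pi.sub_apply]
  refine ⟨?_, abs_norm_sub_norm_le _ _⟩
  simpa using norm_add_le (u x - w x) (w x)

theorem tendsto_norm_of_sub {u : ℕ → L2} {w : L2}
    (h : ∀ᵐ x, Tendsto (fun n => ‖(u n - w) x‖) atTop (𝓝 0)) :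
    ∀ᵐ x, Tendsto (fun n => ‖u n x‖) atTop (𝓝 ‖w x‖) := by
  have h1 : ∀ᵐ x, ∀ n, |‖u n x‖ - ‖w x‖| ≤ ‖(u n - w) x‖ :=
    ae_all_iff.2 fun n => by
      filter_upwards [norm_ae_le_add (u := u n) (w := w)] with x hx
      exact hx.2
  filter_upwards [h, h1] with x hx hx1
  rw [tendsto_iff_norm_sub_tendsto_zero]
  exact squeeze_zero (fun n => norm_nonneg _) hx1 hx

theorem aestronglyMeasurable_norm_rpow (p : ℝ) (u : L2) :
    AEStronglyMeasurable (fun x => ‖u x‖ ^ p) volume :=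
  ((Lp.aestronglyMeasurable u).aemeasurable.norm.pow_const p).aestronglyMeasurable

/-- The half of the Brezis-Lieb lemma needed for the term with negative sign. The positive part of
|u_n|^p - (1+ε')|u_n - w|^p - |w|^p is dominated by a multiple of |w|^p and tends to 0 almost
everywhere. -/
theorem eventually_powerIntegral_le {p : ℝ} (hp : 2 < p) (hp' : p ≤ 8 / 3) {u : ℕ → L2} {w : L2}
    (hu : ∀ n, MemHHalf (u n)) (hw : MemHHalf w) {M : ℝ}
    (hM : ∀ n, powerIntegral p (u n - w) ≤ M)
    (hae : ∀ᵐ x, Tendsto (fun n => ‖(u n - w) x‖) atTop (𝓝 0)) {ε : ℝ} (hε : 0 < ε) :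
    ∀ᶠ n in atTop, powerIntegral p (u n) ≤ powerIntegral p w + powerIntegral p (u n - w) + ε := by
  have hp0 : 0 < p := by linarith
  have hM0 : 0 ≤ M := (powerIntegral_nonneg p _).trans (hM 0)
  obtain ⟨C, hC, hCp⟩ := add_rpow_le_eps hp0 (show 0 < ε / (2 * (M + 1)) by positivity)
  set ε' := ε / (2 * (M + 1)) with hε'
  have hv : ∀ n, MemHHalf (u n - w) := fun n => memHHalf_sub (hu n) hw
  set f : ℕ → R3 → ℝ := fun n x => ‖u n x‖ ^ p - (1 + ε') * ‖(u n - w) x‖ ^ p - ‖w x‖ ^ p with hf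
  obtain ⟨hi, ht⟩ := tendsto_integral_max_zero (f := f) (G := fun x => C * ‖w x‖ ^ p)
    ((integrable_rpow hp hp' hw).const_mul C) (Eventually.of_forall fun x => by positivity)
    (fun n => ((aestronglyMeasurable_norm_rpow p _).sub
      ((aestronglyMeasurable_norm_rpow p _).const_mul _)).sub (aestronglyMeasurable_norm_rpow p _))
    (fun n => by
      filter_upwards [norm_ae_le_add (u := u n) (w := w)] with x hx
      have h1 := Real.rpow_le_rpow (norm_nonneg _) hx.1 hp0.le
      have h2 := hCp _ _ (norm_nonneg ((u n - w) x)) (norm_nonneg (w x))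
      have h3 : 0 ≤ ‖w x‖ ^ p := by positivity
      simp only [hf]
      linarith)
    (by
      filter_upwards [hae, tendsto_norm_of_sub hae] with x h1 h2
      have h3 := h2.rpow_const (p := p) (Or.inr hp0.le)
      have h4 := h1.rpow_const (p := p) (Or.inr hp0.le)
      rw [Real.zero_rpow hp0.ne'] at h4
      have h5 := (h3.sub (h4.const_mul (1 + ε'))).sub_const (‖w x‖ ^ p)
      rw [mul_zero, sub_zero, sub_self] at h5
      exact h5)
  filter_upwards [ht.eventually (gt_mem_nhds (show 0 < ε / 2 by positivity))] with n hn
  have i1 := integrable_rpow hp hp' hw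
  have i2 := (integrable_rpow hp hp' (hv n)).const_mul (1 + ε')
  have h1 : powerIntegral p (u n) ≤
      ∫ x, (max (f n x) 0 + ((1 + ε') * ‖(u n - w) x‖ ^ p + ‖w x‖ ^ p)) := by
    refine integral_mono (integrable_rpow hp hp' (hu n)) ((hi n).add (i2.add i1)) fun x => ?_
    have := le_max_left (f n x) 0
    simp only [hf] at this ⊢
    linarith
  have h2 : ∫ x, (max (f n x) 0 + ((1 + ε') * ‖(u n - w) x‖ ^ p + ‖w x‖ ^ p))
      = (∫ x, max (f n x) 0) + ((1 + ε') * powerIntegral p (u n - w) + powerIntegral p w) := by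
    refine (integral_add (hi n) (i2.add i1)).trans (congrArg₂ _ rfl ?_)
    exact (integral_add i2 i1).trans (congrArg₂ _ (integral_const_mul _ _) rfl)
  have h3 : ε' * powerIntegral p (u n - w) ≤ ε / 2 := by
    have : ε' * powerIntegral p (u n - w) ≤ ε' * (M + 1) := by
      have := hM n
      gcongr
      linarith
    refine this.trans_eq ?_
    rw [hε']
    field_simp
  linarith

theorem memLp_mul_integrable (v w : L2) : Integrable fun x => ‖w x‖ * ‖v x‖ := by
  refine ((integrable_norm_sq w).add (integrable_norm_sq v)).mono'
    ((Lp.aestronglyMeasurable w).norm.mul (Lp.aestronglyMeasurable v).norm)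
    (Eventually.of_forall fun x => ?_)
  rw [Real.norm_eq_abs, abs_of_nonneg (by positivity)]
  simp only [Pi.add_apply]
  nlinarith [sq_nonneg (‖w x‖ - ‖v x‖), sq_nonneg ‖w x‖, sq_nonneg ‖v x‖]

/-- The positive part of |w||v_n| - ε'|v_n|² is dominated by |w|²/(4ε') and tends to 0 almost
everywhere, while ε'‖v_n‖² is uniformly small. -/
theorem eventually_integral_mul_lt {v : ℕ → L2} (w : L2) {M : ℝ} (hM : ∀ n, ‖v n‖ ^ 2 ≤ M)
    (hae : ∀ᵐ x, Tendsto (fun n => ‖v n x‖) atTop (𝓝 0)) {ε : ℝ} (hε : 0 < ε) :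
    ∀ᶠ n in atTop, ∫ x, ‖w x‖ * ‖v n x‖ < ε := by
  have hM0 : 0 ≤ M := (sq_nonneg _).trans (hM 0)
  set ε' := ε / (2 * (M + 1)) with hε'
  have hε0 : 0 < ε' := by positivity
  obtain ⟨hi, ht⟩ := tendsto_integral_max_zero
    (f := fun n x => ‖w x‖ * ‖v n x‖ - ε' * ‖v n x‖ ^ 2)
    (G := fun x => 1 / (4 * ε') * ‖w x‖ ^ 2)
    ((integrable_norm_sq w).const_mul _) (Eventually.of_forall fun x => by positivity)
    (fun n => (memLp_mul_integrable (v n) w).aestronglyMeasurable.sub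
      ((integrable_norm_sq (v n)).aestronglyMeasurable.const_mul _))
    (fun n => Eventually.of_forall fun x => by
      have h1 : 1 / (4 * ε') * ‖w x‖ ^ 2 - (‖w x‖ * ‖v n x‖ - ε' * ‖v n x‖ ^ 2)
          = 1 / (4 * ε') * (‖w x‖ - 2 * ε' * ‖v n x‖) ^ 2 := by
        field_simp
        ring
      have h2 : 0 ≤ 1 / (4 * ε') * (‖w x‖ - 2 * ε' * ‖v n x‖) ^ 2 := by positivity
      linarith)
    (by
      filter_upwards [hae] with x hx
      simpa using (hx.const_mul ‖w x‖).sub ((hx.pow 2).const_mul ε'))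
  filter_upwards [ht.eventually (gt_mem_nhds (show 0 < ε / 2 by positivity))] with n hn
  have i2 := (integrable_norm_sq (v n)).const_mul ε'
  have h1 : ∫ x, ‖w x‖ * ‖v n x‖ ≤
      ∫ x, (max (‖w x‖ * ‖v n x‖ - ε' * ‖v n x‖ ^ 2) 0 + ε' * ‖v n x‖ ^ 2) := by
    refine integral_mono (memLp_mul_integrable (v n) w) ((hi n).add i2) fun x => ?_
    have := le_max_left (‖w x‖ * ‖v n x‖ - ε' * ‖v n x‖ ^ 2) 0
    simp only
    linarith
  rw [integral_add (hi n) i2, integral_const_mul, ← norm_sq_eq_integral] at h1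
  have h3 : ε' * ‖v n‖ ^ 2 < ε / 2 := by
    have h4 : ε' * ‖v n‖ ^ 2 < ε' * (M + 1) := by
      have := hM n
      exact mul_lt_mul_of_pos_left (by linarith) hε0
    refine h4.trans_eq ?_
    rw [hε']
    field_simp
  linarith

/-- Starts from |u| ≥ ||w| - |u-w|| and discards nonnegative products. Every error term kept has a
factor |w||u-w| in one variable, whose integral `eventually_integral_mul_lt` makes small. -/
theorem coulombIntegrand_ge (u w : L2) :
    ∀ᵐ z : R3 × R3, coulombIntegrand w z + coulombIntegrand (u - w) z
      - (2 * (‖w z.1‖ * ‖(u - w) z.1‖) * (‖w z.2‖ ^ 2 + ‖(u - w) z.2‖ ^ 2) / ‖z.1 - z.2‖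
        + (‖w z.1‖ ^ 2 + ‖(u - w) z.1‖ ^ 2) * (2 * (‖w z.2‖ * ‖(u - w) z.2‖)) / ‖z.1 - z.2‖)
      ≤ coulombIntegrand u z := by
  have h : ∀ᵐ x, (‖w x‖ - ‖(u - w) x‖) ^ 2 ≤ ‖u x‖ ^ 2 := by
    filter_upwards [Lp.coeFn_sub u w] with x hx
    rw [hx, Pi.sub_apply, norm_sub_rev]
    have h1 := abs_norm_sub_norm_le (w x) (w x - u x)
    rw [sub_sub_cancel] at h1
    exact sq_le_sq' (by linarith [(abs_le.1 h1).1]) (abs_le.1 h1).2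
  filter_upwards [(Measure.quasiMeasurePreserving_fst (μ := (volume : Measure R3))
    (ν := (volume : Measure R3))).ae h, (Measure.quasiMeasurePreserving_snd
    (μ := (volume : Measure R3)) (ν := (volume : Measure R3))).ae h] with z h1 h2
  simp only [coulombIntegrand, ← add_div, ← sub_div]
  refine div_le_div_of_nonneg_right ?_ (norm_nonneg _)
  refine le_trans ?_ (mul_le_mul h1 h2 (sq_nonneg _) (sq_nonneg _))
  have p1 := norm_nonneg (w z.1)
  have p2 := norm_nonneg (w z.2)
  have p3 := norm_nonneg ((u - w) z.1)
  have p4 := norm_nonneg ((u - w) z.2)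
  generalize ‖w z.1‖ = a at *
  generalize ‖w z.2‖ = b at *
  generalize ‖(u - w) z.1‖ = c at *
  generalize ‖(u - w) z.2‖ = d at *
  have e : (a - c) ^ 2 * (b - d) ^ 2 - (a ^ 2 * b ^ 2 + c ^ 2 * d ^ 2 -
      (2 * (a * c) * (b ^ 2 + d ^ 2) + (a ^ 2 + c ^ 2) * (2 * (b * d))))
      = a ^ 2 * d ^ 2 + c ^ 2 * b ^ 2 + 4 * (a * b * (c * d)) := by ring
  have e2 : 0 ≤ a ^ 2 * d ^ 2 + c ^ 2 * b ^ 2 + 4 * (a * b * (c * d)) := by positivity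
  linarith

theorem sq_add_sq_rpow_le {a b : ℝ} (ha : 0 ≤ a) (hb : 0 ≤ b) :
    (a ^ 2 + b ^ 2) ^ (4 / 3 : ℝ) ≤ 2 * (a ^ (8 / 3 : ℝ) + b ^ (8 / 3 : ℝ)) := by
  have h : (a ^ 2 + b ^ 2) ^ (4 / 3 : ℝ)
      ≤ 2 ^ ((4 / 3 : ℝ) - 1) * ((a ^ 2) ^ (4 / 3 : ℝ) + (b ^ 2) ^ (4 / 3 : ℝ)) := by
    lift a to NNReal using ha
    lift b to NNReal using hb
    have h0 := NNReal.coe_le_coe.2 (NNReal.rpow_add_le_mul_rpow_add_rpow (a ^ 2) (b ^ 2)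
      (by norm_num : (1 : ℝ) ≤ 4 / 3))
    simpa only [NNReal.coe_rpow, NNReal.coe_mul, NNReal.coe_add, NNReal.coe_pow,
      NNReal.coe_ofNat] using h0
  rw [sq_rpow_four_thirds ha, sq_rpow_four_thirds hb] at h
  refine h.trans (mul_le_mul_of_nonneg_right ?_ (by positivity))
  calc (2 : ℝ) ^ ((4 / 3 : ℝ) - 1) ≤ 2 ^ (1 : ℝ) :=
        Real.rpow_le_rpow_of_exponent_le (by norm_num) (by norm_num)
    _ = 2 := Real.rpow_one 2

/-- The errors are Coulomb interactions of r = 2|w||u_n - w| with a = |w|² + |u_n - w|². Their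
L^{4/3} integrals are only bounded, but the L¹ norm of r tends to 0, which suffices once η, then δ,
then n are chosen in that order. -/
theorem eventually_coulomb_ge {u : ℕ → L2} {w : L2} (hu : ∀ n, MemHHalf (u n)) (hw : MemHHalf w)
    {M : ℝ} (hM : ∀ n, ‖u n - w‖ ^ 2 ≤ M) (hM' : ∀ n, powerIntegral (8 / 3) (u n - w) ≤ M)
    (hae : ∀ᵐ x, Tendsto (fun n => ‖(u n - w) x‖) atTop (𝓝 0)) {ε : ℝ} (hε : 0 < ε) :
    ∀ᶠ n in atTop, coulomb w + coulomb (u n - w) - ε ≤ coulomb (u n) := by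
  have hM0 : 0 ≤ M := (sq_nonneg _).trans (hM 0)
  have hv : ∀ n, MemHHalf (u n - w) := fun n => memHHalf_sub (hu n) hw
  have hwP := integrable_rpow (p := 8 / 3) (by norm_num) le_rfl hw
  set B := 2 * (powerIntegral (8 / 3) w + M) with hB
  have hB0 : 0 ≤ B := by have := powerIntegral_nonneg (8 / 3) w; positivity
  set Q := ‖w‖ ^ 2 + M with hQ
  have hQ0 : 0 ≤ Q := by positivity
  have hK := kernelConst_nonneg
  obtain ⟨η, hη, hη'⟩ : ∃ η : ℝ, 0 < η ∧ η / 2 * (B * B) ≤ ε / 8 := by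
    refine ⟨ε / (4 * (B * B + 1)), by positivity, ?_⟩
    rw [div_div, div_mul_eq_mul_div, div_le_div_iff₀ (by positivity) (by norm_num)]
    nlinarith [mul_nonneg hB0 hB0]
  obtain ⟨δ, hδ, hδ'⟩ : ∃ δ : ℝ, 0 < δ ∧
      1 / (4 * η) * (B * (δ * kernelConst) + B * (δ * kernelConst)) ≤ ε / 8 := by
    have hX : 0 ≤ 1 / (4 * η) * (2 * B * kernelConst) := by positivity
    refine ⟨ε / (8 * (1 / (4 * η) * (2 * B * kernelConst) + 1)), by positivity, ?_⟩
    set X := 1 / (4 * η) * (2 * B * kernelConst) with hXdef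
    have : 1 / (4 * η) * (B * (ε / (8 * (X + 1)) * kernelConst)
        + B * (ε / (8 * (X + 1)) * kernelConst)) = X * ε / (8 * (X + 1)) := by
      rw [hXdef]
      ring
    rw [this, div_le_div_iff₀ (by positivity) (by norm_num)]
    nlinarith
  have hsmall : 0 < ε * δ / (16 * (Q + 1)) := by positivity
  filter_upwards [eventually_integral_mul_lt w hM hae hsmall] with n hn
  set r : R3 → ℝ := fun x => 2 * (‖w x‖ * ‖(u n - w) x‖) with hr
  set a : R3 → ℝ := fun x => ‖w x‖ ^ 2 + ‖(u n - w) x‖ ^ 2 with ha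
  have hr0 : ∀ x, 0 ≤ r x := fun x => by positivity
  have ha0 : ∀ x, 0 ≤ a x := fun x => by positivity
  have hra : ∀ x, r x ≤ a x := fun x => by
    simp only [hr, ha]
    nlinarith [sq_nonneg (‖w x‖ - ‖(u n - w) x‖)]
  have hri : Integrable r := (memLp_mul_integrable _ w).const_mul 2
  have hai : Integrable a := (integrable_norm_sq w).add (integrable_norm_sq _)
  have hvP := integrable_rpow (p := 8 / 3) (by norm_num) le_rfl (hv n)
  have hmaj : Integrable fun x => 2 * (‖w x‖ ^ (8 / 3 : ℝ) + ‖(u n - w) x‖ ^ (8 / 3 : ℝ)) :=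
    (hwP.add hvP).const_mul 2
  have haP : ∀ x, a x ^ (4 / 3 : ℝ)
      ≤ 2 * (‖w x‖ ^ (8 / 3 : ℝ) + ‖(u n - w) x‖ ^ (8 / 3 : ℝ)) := fun x =>
    sq_add_sq_rpow_le (norm_nonneg _) (norm_nonneg _)
  have hrP : ∀ x, r x ^ (4 / 3 : ℝ)
      ≤ 2 * (‖w x‖ ^ (8 / 3 : ℝ) + ‖(u n - w) x‖ ^ (8 / 3 : ℝ)) := fun x =>
    (Real.rpow_le_rpow (hr0 x) (hra x) (by norm_num)).trans (haP x)
  have hintB : ∫ x, 2 * (‖w x‖ ^ (8 / 3 : ℝ) + ‖(u n - w) x‖ ^ (8 / 3 : ℝ)) ≤ B := by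
    rw [integral_const_mul, integral_add hwP hvP, hB]
    have := hM' n
    rw [powerIntegral] at this ⊢
    linarith
  have hi4 : ∀ g : R3 → ℝ, Integrable g → (∀ x, 0 ≤ g x) → (∀ x, g x ^ (4 / 3 : ℝ)
      ≤ 2 * (‖w x‖ ^ (8 / 3 : ℝ) + ‖(u n - w) x‖ ^ (8 / 3 : ℝ))) →
      Integrable (fun x => g x ^ (4 / 3 : ℝ)) ∧ 0 ≤ ∫ x, g x ^ (4 / 3 : ℝ) ∧
        ∫ x, g x ^ (4 / 3 : ℝ) ≤ B := fun g hg hg0 hgP => by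
    have hgi : Integrable (fun x => g x ^ (4 / 3 : ℝ)) := by
      refine hmaj.mono' (hg.aestronglyMeasurable.aemeasurable.pow_const _).aestronglyMeasurable
        (Eventually.of_forall fun x => ?_)
      rw [Real.norm_eq_abs, abs_of_nonneg (Real.rpow_nonneg (hg0 x) _)]
      exact hgP x
    exact ⟨hgi, integral_nonneg fun x => Real.rpow_nonneg (hg0 x) _,
      (integral_mono hgi hmaj hgP).trans hintB⟩
  obtain ⟨hri4, hr40, hr4B⟩ := hi4 r hri hr0 hrP
  obtain ⟨hai4, ha40, ha4B⟩ := hi4 a hai ha0 haP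
  have hrint : ∫ x, r x ≤ ε * δ / (8 * (Q + 1)) := by
    have e1 : ∫ x, r x = 2 * ∫ x, ‖w x‖ * ‖(u n - w) x‖ := integral_const_mul _ _
    have e2 : ε * δ / (8 * (Q + 1)) = 2 * (ε * δ / (16 * (Q + 1))) := by
      field_simp
      norm_num
    rw [e1, e2]
    linarith
  have hrint0 : 0 ≤ ∫ x, r x := integral_nonneg hr0
  have haint : ∫ x, a x ≤ Q := by
    have e1 : ∫ x, a x = ‖w‖ ^ 2 + ‖u n - w‖ ^ 2 := by
      rw [norm_sq_eq_integral, norm_sq_eq_integral]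
      exact integral_add (integrable_norm_sq w) (integrable_norm_sq _)
    rw [e1, hQ]
    linarith [hM n]
  have haint0 : 0 ≤ ∫ x, a x := integral_nonneg ha0
  have hprod : δ⁻¹ * ((∫ x, r x) * ∫ x, a x) ≤ ε / 8 := by
    calc δ⁻¹ * ((∫ x, r x) * ∫ x, a x) ≤ δ⁻¹ * (ε * δ / (8 * (Q + 1)) * (Q + 1)) := by
          gcongr
          linarith
      _ = ε / 8 := by field_simp
  have hterm : ∀ A A' : ℝ, 0 ≤ A → A ≤ B → 0 ≤ A' → A' ≤ B →
      η / 2 * (A * A') + 1 / (4 * η) * (A * (δ * kernelConst) + A' * (δ * kernelConst))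
        ≤ ε / 4 := fun A A' h1 h2 h3 h4 => by
    have e1 : η / 2 * (A * A') ≤ η / 2 * (B * B) := by gcongr
    have e2 : 1 / (4 * η) * (A * (δ * kernelConst) + A' * (δ * kernelConst))
        ≤ 1 / (4 * η) * (B * (δ * kernelConst) + B * (δ * kernelConst)) := by gcongr
    linarith
  obtain ⟨j1, b1⟩ := coulomb_bound hr0 ha0 hri hai hri4 hai4
  obtain ⟨j2, b2⟩ := coulomb_bound ha0 hr0 hai hri hai4 hri4
  have c1 := b1 δ η hδ hη
  have c2 := b2 δ η hδ hη
  have d1 := hterm _ _ hr40 hr4B ha40 ha4B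
  have d2 := hterm _ _ ha40 ha4B hr40 hr4B
  rw [mul_comm (∫ x, a x) (∫ x, r x)] at c2
  have hfin := integral_mono_ae (((integrable_coulombIntegrand hw).add
    (integrable_coulombIntegrand (hv n))).sub (j1.add j2)) (integrable_coulombIntegrand (hu n))
    (coulombIntegrand_ge (u n) w)
  have k1 := integral_sub ((integrable_coulombIntegrand hw).add
    (integrable_coulombIntegrand (hv n))) (j1.add j2)
  have k2 := integral_add (integrable_coulombIntegrand hw) (integrable_coulombIntegrand (hv n))
  have k3 := integral_add j1 j2
  simp only [Pi.add_apply, Pi.sub_apply] at hfin k1 k2 k3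
  rw [k1, k2, k3] at hfin
  have hd : ∀ v : L2, ∫ z, coulombIntegrand v z = coulomb v := fun _ => rfl
  simp only [hd] at hfin
  linarith

/-! ### Non-vanishing. -/

theorem add_rpow_le_two_rpow_mul {p a b : ℝ} (hp : 0 ≤ p) (ha : 0 ≤ a) (hb : 0 ≤ b) :
    (a + b) ^ p ≤ 2 ^ p * (a ^ p + b ^ p) := by
  have h1 : (a + b) ^ p ≤ (2 * max a b) ^ p :=
    Real.rpow_le_rpow (by positivity) (by linarith [le_max_left a b, le_max_right a b]) hp
  have hm : 0 ≤ max a b := ha.trans (le_max_left _ _)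
  rw [Real.mul_rpow (by norm_num) hm] at h1
  refine h1.trans (mul_le_mul_of_nonneg_left ?_ (by positivity))
  have := Real.rpow_nonneg ha p
  have := Real.rpow_nonneg hb p
  rcases max_choice a b with h | h <;> rw [h] <;> linarith

/-- A function bounded in `H^{1/2}` whose `L^p` norm is not small has a low-frequency part that
is not uniformly small. -/
theorem exists_lowpass_ge {p : ℝ} (hp : 2 < p) (hp' : p < 8 / 3) (ρ : ℝ) {M c : ℝ}
    (hM : 0 ≤ M) (hc : 0 < c) : ∃ R ε : ℝ, 0 < R ∧ 0 < ε ∧ ∀ u : L2, MemHHalf u → ‖u‖ ^ 2 = ρ →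
      sobolevNorm (1 / 2) u ^ 2 ≤ M → c ≤ powerIntegral p u → ∃ x, ε ≤ ‖lowpass R u x‖ := by
  have hG := gnConst_pos hp
  -- R makes the high-frequency contribution to P at most c/4. Then ε does the same for a
  -- low-frequency part below ε, through |low|^p ≤ ε^(p-2)|low|² and a squared norm of at most 4ρ.
  obtain ⟨R, hR, -, hRc⟩ := exists_mul_rpow_neg_le (s := 3 * (p - 2) / 2 - 1) (by linarith)
    (c := 2 ^ p * (gnConst p * ρ ^ ((p - 2) / 2) * M)) (ε := c / 4) (by positivity) 0
  obtain ⟨ε, hε, -, hεc⟩ := exists_small_rpow (s := p - 2) (by linarith) (2 ^ p * (4 * ρ))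
    (ε := c / 4) (by positivity)
  have hεc' := hεc ε hε le_rfl
  refine ⟨R, ε, hR, hε, fun u hu hρ hN hP => ?_⟩
  by_contra! hlt
  obtain ⟨hhi, hh⟩ := powerIntegral_highpass_le hp hp'.le hu hR
  have hp0 : 0 < p := by linarith
  have i1 := (integrable_norm_sq u).const_mul 2
  have i2 := (integrable_norm_sq (highpass R u)).const_mul 2
  have hmain : powerIntegral p u ≤ ∫ x, 2 ^ p * (ε ^ (p - 2) * (2 * ‖u x‖ ^ 2
      + 2 * ‖highpass R u x‖ ^ 2) + ‖highpass R u x‖ ^ p) := by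
    refine integral_mono_ae (integrable_rpow hp hp'.le hu)
      ((((i1.add i2).const_mul _).add hhi).const_mul _) ?_
    filter_upwards [ae_eq_lowpass_add_highpass R u] with x hx
    have h1 : ‖u x‖ ≤ ‖lowpass R u x‖ + ‖highpass R u x‖ := by
      rw [hx]
      exact norm_add_le _ _
    have h2 : ‖lowpass R u x‖ ≤ ‖u x‖ + ‖highpass R u x‖ := by
      have : lowpass R u x = u x - highpass R u x := by rw [hx]; ring
      rw [this]
      exact norm_sub_le _ _
    have h3 := (Real.rpow_le_rpow (norm_nonneg _) h1 hp0.le).trans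
      (add_rpow_le_two_rpow_mul hp0.le (norm_nonneg _) (norm_nonneg _))
    refine h3.trans (mul_le_mul_of_nonneg_left (add_le_add_left ?_ _) (by positivity))
    have h4 : ‖lowpass R u x‖ ^ p = ‖lowpass R u x‖ ^ (p - 2) * ‖lowpass R u x‖ ^ 2 := by
      rcases (norm_nonneg (lowpass R u x)).eq_or_lt with h0 | h0
      · rw [← h0, Real.zero_rpow hp0.ne']
        simp
      · rw [← Real.rpow_natCast, ← Real.rpow_add h0]
        norm_num
    rw [h4]
    refine mul_le_mul (Real.rpow_le_rpow (norm_nonneg _) (hlt x).le (by linarith)) ?_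
      (by positivity) (by positivity)
    nlinarith [pow_le_pow_left₀ (norm_nonneg _) h2 2, sq_nonneg (‖u x‖ - ‖highpass R u x‖)]
  have e1 : ∫ x, 2 ^ p * (ε ^ (p - 2) * (2 * ‖u x‖ ^ 2 + 2 * ‖highpass R u x‖ ^ 2)
      + ‖highpass R u x‖ ^ p) = 2 ^ p * (ε ^ (p - 2) * (2 * ‖u‖ ^ 2 + 2 * ‖highpass R u‖ ^ 2)
        + powerIntegral p (highpass R u)) := by
    rw [integral_const_mul]
    congr 1
    refine (integral_add ((i1.add i2).const_mul _) hhi).trans (congrArg₂ _ ?_ rfl)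
    rw [integral_const_mul]
    congr 1
    refine (integral_add i1 i2).trans (congrArg₂ _ ?_ ?_)
    · rw [integral_const_mul, norm_sq_eq_integral]
    · rw [integral_const_mul, norm_sq_eq_integral]
  rw [e1] at hmain
  have h5 : ‖highpass R u‖ ^ 2 ≤ ρ := by
    rw [← hρ]
    exact pow_le_pow_left₀ (norm_nonneg _) (norm_highpass_le R u) 2
  have h6 : powerIntegral p (highpass R u)
      ≤ gnConst p * ρ ^ ((p - 2) / 2) * M * R ^ (3 * (p - 2) / 2 - 1) := by
    refine hh.trans ?_
    rw [norm_rpow_eq hρ]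
    have hρ0 : 0 ≤ ρ := hρ ▸ sq_nonneg _
    calc _ ≤ gnConst p * ρ ^ ((p - 2) / 2) * (R ^ (3 * (p - 2) / 2 - 1) * M) := by gcongr
      _ = _ := by ring
  have h7 : 2 ^ p * (ε ^ (p - 2) * (2 * ‖u‖ ^ 2 + 2 * ‖highpass R u‖ ^ 2)
        + powerIntegral p (highpass R u)) ≤ 2 ^ p * (ε ^ (p - 2) * (4 * ρ)
        + gnConst p * ρ ^ ((p - 2) / 2) * M * R ^ (3 * (p - 2) / 2 - 1)) := by
    gcongr
    linarith
  linarith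

/-! ### Compactness of minimizing sequences up to translation. -/

theorem lowpass_translate (R : ℝ) (τ : R3) (u : L2) :
    lowpass R (translate τ u) 0 = lowpass R u τ := by
  rw [lowpass, lowpass, Real.fourierInv_eq, Real.fourierInv_eq, fourier_translate]
  refine integral_congr_ae ?_
  filter_upwards [coeFn_modulate τ (𝓕 u)] with ξ hξ
  by_cases hb : ξ ∈ Metric.ball (0 : R3) R
  · rw [Set.indicator_of_mem hb, Set.indicator_of_mem hb, hξ]
    simp [Circle.smul_def]
  · rw [Set.indicator_of_notMem hb, Set.indicator_of_notMem hb]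
    simp

theorem norm_sq_le_sobolevNorm {u : L2} (hu : MemHHalf u) :
    ‖u‖ ^ 2 ≤ sobolevNorm (1 / 2) u ^ 2 := by
  have := kinetic_nonneg hu
  rw [kinetic] at this
  linarith

theorem sobolevNorm_sub_sq_le {u w : L2} (hu : MemHHalf u) (hw : MemHHalf w) :
    sobolevNorm (1 / 2) (u - w) ^ 2
      ≤ 2 * sobolevNorm (1 / 2) u ^ 2 + 2 * sobolevNorm (1 / 2) w ^ 2 := by
  rw [← norm_lift_sq (memHHalf_sub hu hw), ← norm_lift_sq hu, ← norm_lift_sq hw, lift_sub hu hw]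
  nlinarith [norm_sub_le (lift u hu) (lift w hw), norm_nonneg (lift u hu - lift w hw),
    norm_nonneg (lift u hu), norm_nonneg (lift w hw),
    sq_nonneg (‖lift u hu‖ - ‖lift w hw‖)]

theorem powerIntegral_le_of_sobolevNorm_le {p : ℝ} (hp : 2 < p) (hp' : p ≤ 8 / 3) {u : L2}
    (hu : MemHHalf u) {M : ℝ} (hM : sobolevNorm (1 / 2) u ^ 2 ≤ M) :
    powerIntegral p u ≤ gnConst p * (2 * M) * (‖u‖ ^ 2) ^ ((p - 2) / 2) := by
  have h := powerIntegral_le_sobolev hp hp' hu one_pos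
  have hG := gnConst_pos hp
  rw [Real.one_rpow, Real.one_rpow, norm_rpow_eq rfl] at h
  refine h.trans ?_
  calc _ ≤ gnConst p * (‖u‖ ^ 2) ^ ((p - 2) / 2) * (2 * M) := by
        gcongr
        linarith [norm_sq_le_sobolevNorm hu]
    _ = _ := by ring

/-- Only the remainder of a weakly convergent sequence is tested against this bound. Its mass may be
zero, where the subhomogeneity inequality says nothing, so that case uses P = 0 directly. -/
theorem reducedEnergy_ge_of_lt {p α β ρ : ℝ} (hp : 2 < p) (hp' : p < 8 / 3) (hα : 0 < α)
    (hβ : 0 < β) (hsub : ∀ s : ℝ, 0 < s → s < ρ →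
      minReduced p α β ρ < ρ / s * minReduced p α β s) {v : L2} (hv : MemHHalf v)
    (hvρ : ‖v‖ ^ 2 < ρ) : ‖v‖ ^ 2 / ρ * minReduced p α β ρ ≤ reducedEnergy p α β v := by
  rcases (sq_nonneg ‖v‖).eq_or_lt with h0 | h0
  · have h1 := powerIntegral_le_of_sobolevNorm_le hp hp'.le hv le_rfl
    rw [← h0, Real.zero_rpow (by linarith), mul_zero] at h1
    rw [← h0, zero_div, zero_mul, reducedEnergy]
    have h2 := mul_le_mul_of_nonneg_left h1 hβ.le
    have := kinetic_nonneg hv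
    have := mul_nonneg hα.le (coulomb_nonneg v)
    linarith
  · have hρ : 0 < ρ := h0.trans hvρ
    refine le_trans ?_ (minReduced_le hp hp' hα hβ (mem_massSphere.2 ⟨hv, rfl⟩))
    have h1 := mul_lt_mul_of_pos_left (hsub _ h0 hvρ) (div_pos h0 hρ)
    refine h1.le.trans_eq ?_
    rw [← mul_assoc, div_mul_div_cancel₀ hρ.ne', div_self h0.ne', one_mul]

theorem reducedEnergy_splitting {p α β : ℝ} (hp : 2 < p) (hp' : p < 8 / 3) (hα : 0 < α)
    (hβ : 0 < β) {u : ℕ → L2} {w : L2} (hu : ∀ n, MemHHalf (u n)) (hw : MemHHalf w) {M : ℝ}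
    (hM : ∀ n, sobolevNorm (1 / 2) (u n - w) ^ 2 ≤ M)
    (hae : ∀ᵐ x, Tendsto (fun n => ‖(u n - w) x‖) atTop (𝓝 0))
    (hmass : Tendsto (fun n => ‖u n‖ ^ 2 - ‖u n - w‖ ^ 2) atTop (𝓝 (‖w‖ ^ 2)))
    (hsob : Tendsto (fun n => sobolevNorm (1 / 2) (u n) ^ 2
        - sobolevNorm (1 / 2) (u n - w) ^ 2) atTop (𝓝 (sobolevNorm (1 / 2) w ^ 2)))
    {ε : ℝ} (hε : 0 < ε) :
    ∀ᶠ n in atTop, reducedEnergy p α β w + reducedEnergy p α β (u n - w) - ε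
      ≤ reducedEnergy p α β (u n) := by
  have hM0 : 0 ≤ M := (sq_nonneg _).trans (hM 0)
  have hv : ∀ n, MemHHalf (u n - w) := fun n => memHHalf_sub (hu n) hw
  have hvM : ∀ n, ‖u n - w‖ ^ 2 ≤ M := fun n => (norm_sq_le_sobolevNorm (hv n)).trans (hM n)
  have hPM : ∀ q : ℝ, 2 < q → q ≤ 8 / 3 → ∀ n, powerIntegral q (u n - w)
      ≤ gnConst q * (2 * M) * M ^ ((q - 2) / 2) := fun q hq hq' n => by
    have hG := gnConst_pos hq
    refine (powerIntegral_le_of_sobolevNorm_le hq hq' (hv n) (hM n)).trans ?_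
    refine mul_le_mul_of_nonneg_left (Real.rpow_le_rpow (sq_nonneg _) (hvM n) (by linarith))
      (by positivity)
  have hP := eventually_powerIntegral_le hp hp'.le hu hw (hPM p hp hp'.le) hae
    (show 0 < ε / (4 * β) by positivity)
  have hC := eventually_coulomb_ge hu hw
    (M := max M (gnConst (8 / 3) * (2 * M) * M ^ (((8 / 3 : ℝ) - 2) / 2)))
    (fun n => (hvM n).trans (le_max_left _ _))
    (fun n => (hPM (8 / 3) (by norm_num) le_rfl n).trans (le_max_right _ _)) hae
    (show 0 < ε / (4 * α) by positivity)
  filter_upwards [hP, hC, hmass.eventually (gt_mem_nhds (show ‖w‖ ^ 2 < ‖w‖ ^ 2 + ε / 2 by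
    linarith)), hsob.eventually (lt_mem_nhds (show sobolevNorm (1 / 2) w ^ 2 - ε / 2
      < sobolevNorm (1 / 2) w ^ 2 by linarith))] with n h1 h2 h3 h4
  have h5 := mul_le_mul_of_nonneg_left h1 hβ.le
  have h6 := mul_le_mul_of_nonneg_left h2 hα.le
  have e1 : β * (ε / (4 * β)) = ε / 4 := by field_simp
  have e2 : α * (ε / (4 * α)) = ε / 4 := by field_simp
  simp only [reducedEnergy, kinetic]
  linarith

/-- The lower bound at the origin excludes vanishing, and strict subhomogeneity excludes loss of
part of the mass. -/
theorem compact_of_lowpass {p α β ρ : ℝ} (hp : 2 < p) (hp' : p < 8 / 3) (hα : 0 < α)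
    (hβ : 0 < β) (hρ : 0 < ρ) (hsub : ∀ s : ℝ, 0 < s → s < ρ →
      minReduced p α β ρ < ρ / s * minReduced p α β s) {u : ℕ → L2}
    (hu : ∀ n, u n ∈ massSphere ρ)
    (hJ : Tendsto (fun n => reducedEnergy p α β (u n)) atTop (𝓝 (minReduced p α β ρ)))
    {M : ℝ} (hM : ∀ n, sobolevNorm (1 / 2) (u n) ^ 2 ≤ M) {R ε : ℝ} (hε : 0 < ε)
    (hR : ∀ n, ε ≤ ‖lowpass R (u n) 0‖) :
    ∃ (φ : ℕ → ℕ) (w : L2), StrictMono φ ∧ w ∈ massSphere ρ ∧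
      reducedEnergy p α β w ≤ minReduced p α β ρ ∧
      Tendsto (fun n => sobolevNorm (1 / 2) (u (φ n) - w)) atTop (𝓝 0) := by
  have huH : ∀ n, MemHHalf (u n) := fun n => (mem_massSphere.1 (hu n)).1
  have hum : ∀ n, ‖u n‖ ^ 2 = ρ := fun n => (mem_massSphere.1 (hu n)).2
  obtain ⟨φ₁, w, hφ₁, hw, hweak, hmass, hsob⟩ := exists_weak_limit u huH M hM
  -- The value of the low-frequency part at the origin is weakly continuous, so it stays at least ε
  -- in the limit.
  have hw0 : 0 < ‖w‖ ^ 2 := by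
    have h1 := (hweak (wave R 0)).norm
    simp_rw [← lowpass_eq_inner] at h1
    have h2 : ε ≤ ‖lowpass R w 0‖ := ge_of_tendsto' h1 fun n => hR _
    refine pow_pos (norm_pos_iff.2 ?_) 2
    rintro rfl
    rw [lowpass_eq_inner, show (𝓕 (0 : L2) : L2) = 0 from (Lp.fourierTransformₗᵢ R3 ℂ).map_zero,
      inner_zero_right, norm_zero] at h2
    linarith
  set M' := 2 * M + 2 * sobolevNorm (1 / 2) w ^ 2 with hM'
  have hvM₁ : ∀ n, sobolevNorm (1 / 2) (u (φ₁ n) - w) ^ 2 ≤ M' := fun n => by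
    have := sobolevNorm_sub_sq_le (huH (φ₁ n)) hw
    linarith [hM (φ₁ n)]
  obtain ⟨φ₂, hφ₂, hae⟩ := exists_ae_convergent_subseq
    (fun n => memHHalf_sub (huH (φ₁ n)) hw) hvM₁ (fun g => by
      have := (hweak g).sub_const (inner ℂ g (𝓕 w : L2))
      rw [sub_self] at this
      refine this.congr fun n => ?_
      rw [fourier_sub, inner_sub_right])
  set φ := φ₁ ∘ φ₂ with hφ
  have hφm : StrictMono φ := hφ₁.comp hφ₂
  have hvH : ∀ n, MemHHalf (u (φ n) - w) := fun n => memHHalf_sub (huH _) hw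
  have hvM : ∀ n, sobolevNorm (1 / 2) (u (φ n) - w) ^ 2 ≤ M' := fun n => hvM₁ (φ₂ n)
  have hmass' := hmass.comp hφ₂.tendsto_atTop
  have hsob' := hsob.comp hφ₂.tendsto_atTop
  have hJ' := hJ.comp hφm.tendsto_atTop
  have hsplit : ∀ ε : ℝ, 0 < ε → ∀ᶠ n in atTop, reducedEnergy p α β w
      + reducedEnergy p α β (u (φ n) - w) - ε ≤ reducedEnergy p α β (u (φ n)) := fun ε hε =>
    reducedEnergy_splitting hp hp' hα hβ (fun n => huH (φ n)) hw hvM hae hmass' hsob' hε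
  have hvt : Tendsto (fun n => ‖u (φ n) - w‖ ^ 2) atTop (𝓝 (ρ - ‖w‖ ^ 2)) := by
    refine (hmass'.const_sub ρ).congr fun n => ?_
    simp only [Function.comp_apply, hum]
    rw [sub_sub_cancel]
    rfl
  have hwρ : ‖w‖ ^ 2 ≤ ρ := by
    have := ge_of_tendsto' hvt fun n => sq_nonneg ‖u (φ n) - w‖
    linarith
  rcases hwρ.lt_or_eq with hlt | heq
  · exfalso
    -- The remainder, of limiting mass ρ - ‖w‖² < ρ, needs at least its proportional share of the
    -- infimum, so `w` has at most its own share.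
    have h1 : reducedEnergy p α β w ≤ ‖w‖ ^ 2 / ρ * minReduced p α β ρ := by
      refine le_of_forall_pos_le_add fun ε hε => ?_
      have h2 : ∀ᶠ n in atTop, reducedEnergy p α β w + ‖u (φ n) - w‖ ^ 2 / ρ *
          minReduced p α β ρ - ε ≤ reducedEnergy p α β (u (φ n)) := by
        filter_upwards [hsplit ε hε, hvt.eventually (gt_mem_nhds
          (show ρ - ‖w‖ ^ 2 < ρ by linarith))] with n h3 h4
        have := reducedEnergy_ge_of_lt hp hp' hα hβ hsub (hvH n) h4
        linarith
      have h5 := le_of_tendsto_of_tendsto ((((hvt.div_const ρ).mul_const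
        (minReduced p α β ρ)).const_add (reducedEnergy p α β w)).sub_const ε) hJ' h2
      have h6 : (ρ - ‖w‖ ^ 2) / ρ * minReduced p α β ρ
          = minReduced p α β ρ - ‖w‖ ^ 2 / ρ * minReduced p α β ρ := by
        field_simp
      linarith
    have h2 := minReduced_le hp hp' hα hβ (mem_massSphere.2 ⟨hw, rfl⟩ : w ∈ massSphere (‖w‖ ^ 2))
    have h3 := mul_lt_mul_of_pos_left (hsub _ hw0 hlt) (div_pos hw0 hρ)
    rw [← mul_assoc, div_mul_div_cancel₀ hρ.ne', div_self hw0.ne', one_mul] at h3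
    linarith
  · have hwS : w ∈ massSphere ρ := mem_massSphere.2 ⟨hw, heq⟩
    rw [heq, sub_self] at hvt
    have hPt : Tendsto (fun n => powerIntegral p (u (φ n) - w)) atTop (𝓝 0) := by
      have h1 := (hvt.rpow_const (p := (p - 2) / 2) (Or.inr (by linarith))).const_mul
        (gnConst p * (2 * M'))
      rw [Real.zero_rpow (by linarith), mul_zero] at h1
      exact squeeze_zero (fun n => powerIntegral_nonneg p _)
        (fun n => powerIntegral_le_of_sobolevNorm_le hp hp'.le (hvH n) (hvM n)) h1
    have hvJ : ∀ n, kinetic (u (φ n) - w) - β * powerIntegral p (u (φ n) - w)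
        ≤ reducedEnergy p α β (u (φ n) - w) := fun n => by
      rw [reducedEnergy]
      linarith [mul_nonneg hα.le (coulomb_nonneg (u (φ n) - w))]
    -- As J(w) is at least the infimum, the splitting leaves nothing for J of the remainder. Its
    -- power integral already vanishes in the limit, so its kinetic energy does too.
    have hkin : Tendsto (fun n => kinetic (u (φ n) - w)) atTop (𝓝 0) := by
      refine tendsto_zero_of_forall_eventually_lt (fun n => kinetic_nonneg (hvH n)) fun ε hε => ?_
      have h1 := (hJ'.add (hPt.const_mul β)).eventually (gt_mem_nhds (show
        minReduced p α β ρ + β * 0 < minReduced p α β ρ + ε / 2 by linarith))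
      filter_upwards [hsplit (ε / 2) (by positivity), h1] with n h2 h3
      have h4 := minReduced_le hp hp' hα hβ hwS
      have h5 := hvJ n
      simp only [Function.comp_apply] at h3
      linarith
    refine ⟨φ, w, hφm, hwS, ?_, ?_⟩
    · refine le_of_forall_pos_le_add fun ε hε => ?_
      have h2 : ∀ᶠ n in atTop, reducedEnergy p α β w - β * powerIntegral p (u (φ n) - w) - ε
          ≤ reducedEnergy p α β (u (φ n)) := by
        filter_upwards [hsplit ε hε] with n h3
        linarith [hvJ n, kinetic_nonneg (hvH n)]
      have h5 := le_of_tendsto_of_tendsto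
        (((hPt.const_mul β).const_sub (reducedEnergy p α β w)).sub_const ε) hJ' h2
      linarith
    · have h1 := ((hkin.const_mul 2).add hvt).sqrt
      rw [mul_zero, add_zero, Real.sqrt_zero] at h1
      refine h1.congr fun n => ?_
      rw [kinetic]
      rw [show 2 * ((sobolevNorm (1 / 2) (u (φ n) - w) ^ 2 - ‖u (φ n) - w‖ ^ 2) / 2)
        + ‖u (φ n) - w‖ ^ 2 = sobolevNorm (1 / 2) (u (φ n) - w) ^ 2 by ring]
      exact Real.sqrt_sq (Real.sqrt_nonneg _)

theorem translate_mem_massSphere {ρ : ℝ} {u : L2} (hu : u ∈ massSphere ρ) (τ : R3) :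
    translate τ u ∈ massSphere ρ := by
  obtain ⟨h1, h2⟩ := mem_massSphere.1 hu
  exact mem_massSphere.2 ⟨memHHalf_translate h1 τ, by rw [norm_translate, h2]⟩

theorem reducedEnergy_translate (p α β : ℝ) (τ : R3) (u : L2) :
    reducedEnergy p α β (translate τ u) = reducedEnergy p α β u := by
  rw [reducedEnergy, kinetic_translate, coulomb_translate, powerIntegral_translate, reducedEnergy]

theorem compact_up_to_translation {p α β ρ : ℝ} (hp : 2 < p) (hp' : p < 8 / 3) (hα : 0 < α)
    (hβ : 0 < β) (hρ : 0 < ρ) (hneg : minReduced p α β ρ < 0)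
    (hsub : ∀ s : ℝ, 0 < s → s < ρ → minReduced p α β ρ < ρ / s * minReduced p α β s)
    {u : ℕ → L2} (hu : ∀ n, u n ∈ massSphere ρ)
    (hJ : Tendsto (fun n => reducedEnergy p α β (u n)) atTop (𝓝 (minReduced p α β ρ))) :
    ∃ (φ : ℕ → ℕ) (τ : ℕ → R3) (w : L2), StrictMono φ ∧ w ∈ massSphere ρ ∧
      reducedEnergy p α β w ≤ minReduced p α β ρ ∧
      Tendsto (fun n => sobolevNorm (1 / 2) (translate (τ n) (u (φ n)) - w)) atTop (𝓝 0) := by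
  obtain ⟨K, hK⟩ := coercive hp hp' hα hβ ρ
  obtain ⟨B, hB⟩ := hJ.bddAbove_range
  have hJB : ∀ n, reducedEnergy p α β (u n) ≤ B := fun n => hB ⟨n, rfl⟩
  have hM : ∀ n, sobolevNorm (1 / 2) (u n) ^ 2 ≤ 4 * (B + K) := fun n => by
    obtain ⟨h1, h2⟩ := mem_massSphere.1 (hu n)
    linarith [hK _ h1 h2, hJB n]
  -- Once J(u_n) is below half the negative infimum I, βP > -I/2 since T and D are nonnegative.
  -- Finitely many initial terms are dropped for this.
  obtain ⟨R, ε, -, hε, hlow⟩ := exists_lowpass_ge hp hp' ρ ((sq_nonneg _).trans (hM 0))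
    (show 0 < -minReduced p α β ρ / (2 * β) from div_pos (by linarith) (by linarith))
  obtain ⟨N, hN⟩ := eventually_atTop.1 (hJ.eventually (gt_mem_nhds
    (show minReduced p α β ρ < minReduced p α β ρ / 2 by linarith)))
  have hx : ∀ n, ∃ x, ε ≤ ‖lowpass R (u (n + N)) x‖ := fun n => by
    obtain ⟨h1, h2⟩ := mem_massSphere.1 (hu (n + N))
    refine hlow _ h1 h2 (hM _) ?_
    rw [div_le_iff₀ (by linarith)]
    have h3 := hN (n + N) (by omega)
    rw [reducedEnergy] at h3
    have := kinetic_nonneg h1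
    have := mul_nonneg hα.le (coulomb_nonneg (u (n + N)))
    linarith
  choose x hx using hx
  obtain ⟨φ, w, hφ, hw, hJw, ht⟩ := compact_of_lowpass hp hp' hα hβ hρ hsub
    (u := fun n => translate (x n) (u (n + N))) (fun n => translate_mem_massSphere (hu _) _)
    (by
      simp_rw [reducedEnergy_translate]
      exact hJ.comp (tendsto_add_atTop_nat N))
    (fun n => by
      rw [sobolevNorm_translate]
      exact hM _) hε (fun n => by
      rw [lowpass_translate]
      exact hx n)
  exact ⟨fun n => φ n + N, fun n => x (φ n), w, fun a b hab => by
    have := hφ hab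
    simpa using this, hw, hJw, ht⟩

/-! ### Passage to the extended-real infimum, and the theorem. -/

theorem groundEnergy_eq {p α β ρ : ℝ} (hp : 2 < p) (hp' : p < 8 / 3) (hα : 0 < α) (hβ : 0 < β)
    (hρ : 0 ≤ ρ) :
    groundEnergy p α β ρ = ((minReduced p α β ρ + ρ / 2 : ℝ) : EReal) := by
  have hE : ∀ u ∈ massSphere ρ, energy p α β u = reducedEnergy p α β u + ρ / 2 := fun u hu => by
    rw [energy_eq, (mem_massSphere.1 hu).2]
  refine le_antisymm ?_ ?_
  · refine le_of_forall_gt fun c hc => ?_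
    obtain ⟨r, hr1, hr2⟩ := EReal.lt_iff_exists_real_btwn.1 hc
    have hr1' : minReduced p α β ρ + ρ / 2 < r := by exact_mod_cast hr1
    obtain ⟨u, hu, hlt⟩ := exists_reducedEnergy_lt (p := p) (α := α) (β := β) hρ
      (e := r - ρ / 2) (by linarith)
    refine ((iInf₂_le u hu).trans_lt ?_).trans hr2
    rw [hE u hu]
    exact_mod_cast (by linarith : reducedEnergy p α β u + ρ / 2 < r)
  · refine le_iInf₂ fun u hu => ?_
    rw [hE u hu]
    have := minReduced_le hp hp' hα hβ hu
    exact_mod_cast (by linarith : minReduced p α β ρ + ρ / 2 ≤ reducedEnergy p α β u + ρ / 2)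

end SemiRelativistic

end

theorem theorem1p1 (p α β : ℝ) (hp : 2 < p) (hp' : p < 8 / 3) (hα : 0 < α) (hβ : 0 < β) :
    -- the terms of the energy are finite on the whole of `H^{1/2}`
    (∀ u : SemiRelativistic.L2, SemiRelativistic.MemHHalf u →
      Integrable (SemiRelativistic.coulombIntegrand u) ∧
      Integrable (fun x : SemiRelativistic.R3 => ‖u x‖ ^ p)) ∧
    -- the energy is bounded below on every `S(ρ)`
    (∀ ρ : ℝ, 0 < ρ → ⊥ < SemiRelativistic.groundEnergy p α β ρ) ∧
    -- for small `ρ`: compactness of minimizing sequences, and existence of minimizers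
    (∃ ρ₁ : ℝ, 0 < ρ₁ ∧ ∀ ρ : ℝ, 0 < ρ → ρ < ρ₁ →
      (∀ u : ℕ → SemiRelativistic.L2, (∀ n, u n ∈ SemiRelativistic.massSphere ρ) →
        Tendsto (fun n => (SemiRelativistic.energy p α β (u n) : EReal)) atTop
          (𝓝 (SemiRelativistic.groundEnergy p α β ρ)) →
        ∃ (φ : ℕ → ℕ) (τ : ℕ → SemiRelativistic.R3) (w : SemiRelativistic.L2),
          StrictMono φ ∧ SemiRelativistic.MemHHalf w ∧
          Tendsto (fun n => SemiRelativistic.sobolevNorm (1 / 2)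
            (SemiRelativistic.translate (τ n) (u (φ n)) - w)) atTop (𝓝 0)) ∧
      ∃ v : SemiRelativistic.L2, SemiRelativistic.IsMinimizer p α β ρ v) ∧
    -- the Pohozaev-type identity for every minimizer
    (∀ (ρ : ℝ) (v : SemiRelativistic.L2), 0 < ρ → SemiRelativistic.IsMinimizer p α β ρ v →
      1 / 2 * SemiRelativistic.sobolevNorm (1 / 2) v ^ 2
        - 1 / 2 * SemiRelativistic.sobolevNorm (-(1 / 2)) v ^ 2
        + α * SemiRelativistic.coulomb v
        - β * ((3 * p - 6) / 2) * SemiRelativistic.powerIntegral p v = 0) := by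
  open SemiRelativistic in
  refine ⟨fun u hu => ⟨integrable_coulombIntegrand hu, integrable_rpow hp hp'.le hu⟩,
    fun ρ hρ => ?_, ?_, fun ρ v _ hv => pohozaev hv⟩
  · rw [groundEnergy_eq hp hp' hα hβ hρ.le]
    exact EReal.bot_lt_coe _
  · obtain ⟨ρ₁, hρ₁, hneg, hsub⟩ := exists_strict_subhomogeneous hp hp' hα hβ
    refine ⟨ρ₁, hρ₁, fun ρ hρ hρ' => ⟨fun u hu hE => ?_, ?_⟩⟩
    · rw [groundEnergy_eq hp hp' hα hβ hρ.le] at hE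
      have hE' := EReal.tendsto_coe.1 hE
      have hJ : Tendsto (fun n => reducedEnergy p α β (u n)) atTop
          (𝓝 (minReduced p α β ρ)) := by
        have := hE'.sub_const (ρ / 2)
        rw [add_sub_cancel_right] at this
        refine this.congr fun n => ?_
        rw [energy_eq, (mem_massSphere.1 (hu n)).2, add_sub_cancel_right]
      obtain ⟨φ, τ, w, hφ, hw, -, ht⟩ := compact_up_to_translation hp hp' hα hβ hρ
        (hneg ρ hρ hρ') (fun s hs hsρ => hsub ρ s hs hsρ hρ') hu hJ
      exact ⟨φ, τ, w, hφ, (mem_massSphere.1 hw).1, ht⟩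
    -- Existence follows by applying compactness to some minimizing sequence, here with error
    -- 1/(n+1); the limit has energy at most the infimum.
    · have hex : ∀ n : ℕ, ∃ u ∈ massSphere ρ,
          reducedEnergy p α β u < minReduced p α β ρ + 1 / (n + 1) := fun n =>
        exists_reducedEnergy_lt hρ.le (by
          have : (0 : ℝ) < 1 / (n + 1) := by positivity
          linarith)
      choose u hu hlt using hex
      have hJ : Tendsto (fun n => reducedEnergy p α β (u n)) atTop
          (𝓝 (minReduced p α β ρ)) := by
        refine tendsto_of_tendsto_of_tendsto_of_le_of_le tendsto_const_nhds ?_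
          (fun n => minReduced_le hp hp' hα hβ (hu n)) (fun n => (hlt n).le)
        simpa using tendsto_one_div_add_atTop_nhds_zero_nat.const_add (minReduced p α β ρ)
      obtain ⟨-, -, w, -, hw, hJw, -⟩ := compact_up_to_translation hp hp' hα hβ hρ
        (hneg ρ hρ hρ') (fun s hs hsρ => hsub ρ s hs hsρ hρ') hu hJ
      refine ⟨w, hw, ?_⟩
      rw [groundEnergy_eq hp hp' hα hβ hρ.le, energy_eq, (mem_massSphere.1 hw).2,
        le_antisymm hJw (minReduced_le hp hp' hα hβ hw)]
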